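/- **Setting.** Latin indices run from 1 to 3 and repeated indices are summed. Let $\mathfrak g$ be a three-dimensional real Lie algebra of Bianchi type I–VIII (that is, not isomorphic to $\mathfrak{so}(3)$), with a basis $(e_i)$ and structure constants $[e_i,e_j]=C^k_{ij}e_k$; let $m>0$ and $\Lambda\in\mathbb R$. The unknowns are functions of $t$: a positive definite symmetric matrix $g_{ij}$ with inverse $g^{ij}$ (used to raise and lower indices), a symmetric matrix $k_{ij}$, vectors $E^i$, $u^i$, an antisymmetric matrix $F_{ij}$, and scalars $\Phi$, $U\ge 0$, $\rho\neq 0$, $e$. Put $$u^0=\sqrt{1+g_{ij}u^iu^j},\quad u_0=-u^0,\quad H=g^{ij}k_{ij},\quad \sigma_{ij}=k_{ij}-\tfrac H3 g_{ij},$$ $$\gamma^l_{ij}=\tfrac12 g^{lk}\big(-C^m_{jk}g_{im}+C^m_{ki}g_{jm}+C^m_{ij}g_{km}\big),\quad R_{ij}=\gamma^l_{lm}\gamma^m_{ji}-\gamma^m_{jl}\gamma^l_{mi}-C^l_{mj}\gamma^m_{li},\quad R=g^{ij}R_{ij},$$ $$T_{00}=U+\tfrac12m^2\Phi^2,\quad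 T_{0i}=0,\quad T_{ij}=g_{ij}\big(U-\tfrac12m^2\Phi^2\big),$$ $$\tau_{00}=\tfrac12E^iE_i+\tfrac14F^{ij}F_{ij},\quad \tau_{0j}=-E^kF_{jk},\quad \tau_{ij}=\tfrac12g_{ij}E^kE_k-E_iE_j-\tfrac14g_{ij}F^{kl}F_{kl}+g^{kl}F_{ik}F_{jl},$$ $$Q=H^2-24\pi T_{00}-3\Lambda .$$ The *evolution system* of the Einstein–Maxwell–massive scalar field equations is $$\dot g_{ij}=-2k_{ij},$$ $$\dot k_{ij}=R_{ij}+Hk_{ij}-2k^l_jk_{il}-8\pi(T_{ij}+\tau_{ij}+\rho u_iu_j)+4\pi\big[-T_{00}-\rho u_0^2+g^{lm}(T_{lm}+\rho u_lu_m)\big]g_{ij}-\Lambda g_{ij},$$ $$\dot E^i=HE^i-\big(C^j_{jk}g^{kl}g^{im}+\tfrac12C^i_{jk}g^{jl}g^{km}\big)F_{lm}+4\pi e u^i,\qquad \dot F_{ij}=C^k_{ij}g_{kl}E^l,$$ $$\dot u^i=2k^i_ju^j-\gamma^i_{jk}\frac{u^ju^k}{u^0}-4\pi\frac e\rho E^i+4\pi\frac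 e\rho\frac{g^{il}F_{jl}u^j}{u^0},\qquad \dot\Phi=\sqrt{2U},\qquad \dot U=2HU-m^2\Phi\sqrt{2U},$$ $$\dot\rho=-\Big[\frac{k_{ij}u^iu^j}{(u^0)^2}+\frac{C^i_{ij}u^j}{u^0}-H\Big]\rho+4\pi e\frac{g_{ij}E^ju^i}{(u^0)^2},\qquad \dot e=-\Big[\frac{k_{ij}u^iu^j}{(u^0)^2}+\frac{C^i_{ij}u^j}{u^0}-H\Big]e+4\pi\frac{g_{ij}E^ju^i}{(u^0)^2}\frac{e^2}{\rho},$$ and the *constraints* are $$R-k_{ij}k^{ij}+H^2=16\pi(T_{00}+\tau_{00}+\rho u_0^2)+2\Lambda,\qquad \nabla^ik_{ij}=-8\pi(T_{0j}+\tau_{0j}+\rho u_0u_j),$$ $$C^l_{ij}F_{kl}+C^l_{ki}F_{jl}+C^l_{jk}F_{il}=0,\qquad C^i_{ik}E^k+4\pi e u^0=0,$$ where $\nabla_lk_{ij}=-\gamma^n_{li}k_{nj}-\gamma^n_{lj}k_{in}$. **Theorem.** Consider a global solution on $[0,\infty)$ of the evolution system whose initial values satisfy the constraints and $\Phi^0:=\Phi(0)>0$,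 $U(0)>0$, $\rho(0)>0$, $e(0)\ge0$, $H(0)<0$, and let $\Lambda>-4\pi m^2(\Phi^0)^2$. Put $\gamma=\big[\tfrac13(\Lambda+4\pi m^2(\Phi^0)^2)\big]^{1/2}$. Then there are $L>0$ and a symmetric positive definite constant matrix $(G_{ij})$, with inverse $(G^{ij})$, such that with $$C_0=\Lambda+4\pi m^2L,\qquad \delta=\big[\tfrac13(\Lambda+4\pi m^2L)\big]^{1/2},\qquad \nu=3\delta-\gamma$$ the following hold. 1. As $t\to\infty$, each of $Q$, $\sigma_{ij}\sigma^{ij}$, $|R|$, $\tau_{00}$, $\rho$, $\dot\Phi^2$, $F^{ij}F_{ij}$, $E^iE_i$ is $\mathcal O(e^{-2\gamma t})$. 2. $\|\sigma(t)\|\le Ce^{-\gamma t}\|g(t)\|$ for all $t\ge 0$, where $\|\cdot\|$ is the Euclidean operator norm of matrices. 3. As $t\to\infty$, $\Phi^2\to L$, $T_{00}\to\tfrac{m^2}2L$, and $H=-(3C_0)^{1/2}+\mathcal O(e^{-2\delta t})$. 4. $|e^{-2\delta t}g_{ij}|\le C$ and $|e^{2\delta t}g^{ij}|\le C$ for all $t\ge0$;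 and as $t\to\infty$, $g_{ij}(t)=e^{2\delta t}\big(G_{ij}+\mathcal O(e^{-\gamma t})\big)$ and $g^{ij}(t)=e^{-2\delta t}\big(G^{ij}+\mathcal O(e^{-\gamma t})\big)$. 5. For all $t\ge0$: $|k_{ij}|\le Ce^{2\delta t}$, $|E^i|\le Ce^{\nu t}$, $|F_{ij}|\le Ce^{(2\delta+\nu)t}$, $|F^{ij}|\le Ce^{(\delta-\gamma)t}$, $|e|\le Ce^{\nu t}$. Here $C>0$ denotes constants, possibly different in each estimate, that do not depend on $t$. -/

import Mathlib

open Filter Asymptotics Topology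

noncomputable section

namespace EMSF

/-- `3 × 3` real matrices, the components of a tensor with two spatial indices. -/
abbrev Mat3 := Matrix (Fin 3) (Fin 3) ℝ

/-! ### The Lie algebra of the spatial sections -/

/-- The structure constants of a Lie algebra in a basis (left invariant frame) `b`:
`[e_i, e_j] = C^k_{ij} e_k`, and `structureConstants b k i j = C^k_{ij}`. -/
def structureConstants {L : Type*} [LieRing L] [LieAlgebra ℝ L] (b : Module.Basis (Fin 3) ℝ L)
    (k i j : Fin 3) : ℝ :=
  b.repr ⁅b i, b j⁆ k

/-- A real Lie algebra is of Bianchi type IX if it is isomorphic to `so(3)`, that is, to `ℝ³` with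
the cross product as bracket. The three dimensional real Lie algebras of the types I to VIII are
all the others. -/
def IsBianchiIX (L : Type*) [LieRing L] [LieAlgebra ℝ L] : Prop :=
  ∃ f : L ≃ₗ[ℝ] (Fin 3 → ℝ), ∀ x y : L, f ⁅x, y⁆ = crossProduct (f x) (f y)

/-! ### The unknowns and the tensors built from them

Everywhere `C k i j` stands for the structure constant `C^k_{ij}`. Components refer to the frame
`(∂_t, e_1, e_2, e_3)` of the metric `-dt² + g_ij e^i ⊗ e^j`. -/

/-- The values, at one instant, of the unknowns of the system: the metric `g_ij`, the second
fundamental form `k_ij`, the electric field `E^i = F^{0i}`, the magnetic part `F_ij` of the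
electromagnetic field, the spatial velocity `u^i`, the scalar field `Φ`, the variable
`U = (dΦ/dt)²/2`, the matter density `ρ`, the charge density `e`. -/
structure State where
  g : Mat3
  k : Mat3
  E : Fin 3 → ℝ
  F : Mat3
  u : Fin 3 → ℝ
  Φ : ℝ
  U : ℝ
  ρ : ℝ
  e : ℝ

namespace State

variable (C : Fin 3 → Fin 3 → Fin 3 → ℝ) (m Λ : ℝ) (s : State)

/-- The inverse metric `g^{ij}`. -/
def gi : Mat3 := s.g⁻¹

/-- Raising both indices: `a^{ij} = g^{il} g^{jm} a_{lm}`. -/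
def raise (a : Mat3) (i j : Fin 3) : ℝ := ∑ l, ∑ n, s.gi i l * s.gi j n * a l n

/-- The full contraction `a_{ij} a^{ij}`. -/
def normSq (a : Mat3) : ℝ := ∑ i, ∑ j, a i j * s.raise a i j

/-- `k^i_j = g^{il} k_{lj}`. -/
def kMixed (i j : Fin 3) : ℝ := ∑ l, s.gi i l * s.k l j

/-- The mean curvature `H = g^{ij} k_{ij}`. -/
def H : ℝ := ∑ i, ∑ j, s.gi i j * s.k i j

/-- The trace-free part of the second fundamental form: `σ_ij = k_ij - (H/3) g_ij`. -/
def σ : Mat3 := s.k - (s.H / 3) • s.g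

/-- `u^0 = √(1 + g_ij u^i u^j)`. -/
def u0 : ℝ := √(1 + ∑ i, ∑ j, s.g i j * s.u i * s.u j)

/-- `u_i = g_ij u^j`; moreover `u_0 = -u^0`. -/
def uLow (i : Fin 3) : ℝ := ∑ j, s.g i j * s.u j

/-- `E_i = g_ij E^j`. -/
def ELow (i : Fin 3) : ℝ := ∑ j, s.g i j * s.E j

/-- `E^i E_i`. -/
def ESq : ℝ := ∑ i, s.E i * s.ELow i

/-- The Ricci rotation coefficients, `γ^l_{ij} = conn C s l i j`:
`γ^l_{ij} = ½ g^{lk} (-C^m_{jk} g_{im} + C^m_{ki} g_{jm} + C^m_{ij} g_{km})`. -/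
def conn (l i j : Fin 3) : ℝ :=
  (1 / 2) * ∑ k, s.gi l k *
    ∑ n, (-(C n j k) * s.g i n + C n k i * s.g j n + C n i j * s.g k n)

/-- The Ricci tensor of `g`:
`R_ij = γ^l_{lm} γ^m_{ji} - γ^m_{jl} γ^l_{mi} - C^l_{mj} γ^m_{li}`. -/
def Ric (i j : Fin 3) : ℝ :=
  ∑ l, ∑ n, (s.conn C l l n * s.conn C n j i - s.conn C n j l * s.conn C l n i
    - C l n j * s.conn C n l i)

/-- The scalar curvature of `g`: `R = g^{ij} R_ij`. -/
def R : ℝ := ∑ i, ∑ j, s.gi i j * s.Ric C i j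

/-- `T_00 = ½ (dΦ/dt)² + ½ m² Φ²`, where `(dΦ/dt)² = 2 U`. -/
def T00 : ℝ := s.U + (1 / 2) * m ^ 2 * s.Φ ^ 2

/-- `T_ij = ½ g_ij ((dΦ/dt)² - m² Φ²)`, where `(dΦ/dt)² = 2 U`. The components `T_0i` vanish. -/
def T (i j : Fin 3) : ℝ := s.g i j * (s.U - (1 / 2) * m ^ 2 * s.Φ ^ 2)

/-- `τ_00 = ½ g_ij E^i E^j + ¼ F^{ij} F_ij`. -/
def τ00 : ℝ := (1 / 2) * s.ESq + (1 / 4) * s.normSq s.F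

/-- `τ_0j = -E^k F_jk`. -/
def τ0 (j : Fin 3) : ℝ := -∑ k, s.E k * s.F j k

/-- `τ_ij = ½ g_ij E^k E_k - E_i E_j - ¼ g_ij F^{kl} F_kl + g^{kl} F_ik F_jl`. -/
def τ (i j : Fin 3) : ℝ :=
  (1 / 2) * s.g i j * s.ESq - s.ELow i * s.ELow j - (1 / 4) * s.g i j * s.normSq s.F
    + ∑ k, ∑ l, s.gi k l * s.F i k * s.F j l

/-- `∇^i k_ij = g^{il} ∇_l k_ij`; the components of `k` are constant on the spatial sections, so
`∇_l k_ij = -γ^n_{li} k_nj - γ^n_{lj} k_in`. -/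
def divk (j : Fin 3) : ℝ :=
  ∑ i, ∑ l, s.gi i l * ∑ n, (-(s.conn C n l i * s.k n j) - s.conn C n l j * s.k i n)

/-- `Q = H² - 24 π T_00 - 3 Λ`. -/
def Q : ℝ := s.H ^ 2 - 24 * Real.pi * s.T00 m - 3 * Λ

/-! ### The right-hand sides of the evolution system -/

/-- `dk_ij/dt = R_ij + H k_ij - 2 k^l_j k_il - 8π (T_ij + τ_ij + ρ u_i u_j)
+ 4π [-T_00 - ρ u_0² + g^{lm} (T_lm + ρ u_l u_m)] g_ij - Λ g_ij`. -/
def kRate (i j : Fin 3) : ℝ :=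
  s.Ric C i j + s.H * s.k i j - 2 * ∑ l, s.kMixed l j * s.k i l
    - 8 * Real.pi * (s.T m i j + s.τ i j + s.ρ * s.uLow i * s.uLow j)
    + 4 * Real.pi * (-s.T00 m - s.ρ * s.u0 ^ 2
        + ∑ l, ∑ n, s.gi l n * (s.T m l n + s.ρ * s.uLow l * s.uLow n)) * s.g i j
    - Λ * s.g i j

/-- `dE^i/dt = H E^i - (C^j_{jk} g^{kl} g^{im} + ½ C^i_{jk} g^{jl} g^{km}) F_lm + 4π e u^i`. -/
def ERate (i : Fin 3) : ℝ :=
  s.H * s.E i - (∑ j, ∑ k, C j j k * s.raise s.F k i)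
    - (1 / 2) * (∑ j, ∑ k, C i j k * s.raise s.F j k) + 4 * Real.pi * s.e * s.u i

/-- `dF_ij/dt = C^k_{ij} g_kl E^l`. -/
def FRate (i j : Fin 3) : ℝ := ∑ k, C k i j * s.ELow k

/-- `du^i/dt = 2 k^i_j u^j - γ^i_{jk} u^j u^k / u^0 - 4π (e/ρ) E^i
+ 4π (e/ρ) g^{il} F_jl u^j / u^0`. -/
def uRate (i : Fin 3) : ℝ :=
  2 * (∑ j, s.kMixed i j * s.u j) - (∑ j, ∑ k, s.conn C i j k * s.u j * s.u k) / s.u0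
    - 4 * Real.pi * (s.e / s.ρ) * s.E i
    + 4 * Real.pi * (s.e / s.ρ) * ((∑ j, ∑ l, s.gi i l * s.F j l * s.u j) / s.u0)

/-- `dU/dt = 2 H U - m² Φ √(2U)`. -/
def URate : ℝ := 2 * s.H * s.U - m ^ 2 * s.Φ * √(2 * s.U)

/-- The bracket `k_ij u^i u^j / (u^0)² + C^i_{ij} u^j / u^0 - k^i_i` in the equations for the two
densities. -/
def densityCoeff : ℝ :=
  (∑ i, ∑ j, s.k i j * s.u i * s.u j) / s.u0 ^ 2 + (∑ i, ∑ j, C i i j * s.u j) / s.u0 - s.H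

/-- `dρ/dt`. -/
def ρRate : ℝ :=
  -(s.densityCoeff C) * s.ρ
    + 4 * Real.pi * s.e * ((∑ i, s.ELow i * s.u i) / s.u0 ^ 2)

/-- `de/dt`. -/
def eRate : ℝ :=
  -(s.densityCoeff C) * s.e
    + 4 * Real.pi * ((∑ i, s.ELow i * s.u i) / s.u0 ^ 2) * (s.e ^ 2 / s.ρ)

/-- The constraint equations. In the second one, `u_0 = -u^0` and `T_0j = 0`. -/
structure Constraints : Prop where
  hamiltonian : s.R C - s.normSq s.k + s.H ^ 2
    = 16 * Real.pi * (s.T00 m + s.τ00 + s.ρ * s.u0 ^ 2) + 2 * Λ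
  momentum : ∀ j, s.divk C j = -(8 * Real.pi) * (s.τ0 j + s.ρ * (-s.u0) * s.uLow j)
  magnetic : ∀ i j k, ∑ l, (C l i j * s.F k l + C l k i * s.F j l + C l j k * s.F i l) = 0
  electric : (∑ i, ∑ k, C i i k * s.E k) + 4 * Real.pi * s.e * s.u0 = 0

/-- Admissible initial data. -/
structure IsInitialData : Prop where
  g_posDef : s.g.PosDef
  k_symm : s.k.IsSymm
  F_antisymm : s.F.transpose = -s.F
  Φ_pos : 0 < s.Φ
  U_pos : 0 < s.U
  ρ_pos : 0 < s.ρ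
  e_nonneg : 0 ≤ s.e
  constraints : s.Constraints C m Λ

end State

/-- `v` is a solution on `[0, ∞)` of the evolution system of the Einstein-Maxwell-massive scalar
field equations with mass `m` and cosmological constant `Λ`. The first three fields say that `v`
takes its values where the system makes sense: `g` is a Riemannian metric, `√(2U)` and the
quotient `e / ρ` are defined. At `t = 0` the derivatives are one-sided. -/
structure IsGlobalSolution (C : Fin 3 → Fin 3 → Fin 3 → ℝ) (m Λ : ℝ) (v : ℝ → State) :
    Prop where
  g_posDef : ∀ t, 0 ≤ t → (v t).g.PosDef
  U_nonneg : ∀ t, 0 ≤ t → 0 ≤ (v t).U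
  ρ_ne_zero : ∀ t, 0 ≤ t → (v t).ρ ≠ 0
  g_eq : ∀ t, 0 ≤ t → ∀ i j,
    HasDerivWithinAt (fun r => (v r).g i j) (-2 * (v t).k i j) (Set.Ici 0) t
  k_eq : ∀ t, 0 ≤ t → ∀ i j,
    HasDerivWithinAt (fun r => (v r).k i j) ((v t).kRate C m Λ i j) (Set.Ici 0) t
  E_eq : ∀ t, 0 ≤ t → ∀ i,
    HasDerivWithinAt (fun r => (v r).E i) ((v t).ERate C i) (Set.Ici 0) t
  F_eq : ∀ t, 0 ≤ t → ∀ i j,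
    HasDerivWithinAt (fun r => (v r).F i j) ((v t).FRate C i j) (Set.Ici 0) t
  u_eq : ∀ t, 0 ≤ t → ∀ i,
    HasDerivWithinAt (fun r => (v r).u i) ((v t).uRate C i) (Set.Ici 0) t
  Φ_eq : ∀ t, 0 ≤ t →
    HasDerivWithinAt (fun r => (v r).Φ) (√(2 * (v t).U)) (Set.Ici 0) t
  U_eq : ∀ t, 0 ≤ t →
    HasDerivWithinAt (fun r => (v r).U) ((v t).URate m) (Set.Ici 0) t
  ρ_eq : ∀ t, 0 ≤ t →
    HasDerivWithinAt (fun r => (v r).ρ) ((v t).ρRate C) (Set.Ici 0) t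
  e_eq : ∀ t, 0 ≤ t →
    HasDerivWithinAt (fun r => (v r).e) ((v t).eRate C) (Set.Ici 0) t

/-- The operator norm `sup ‖A x‖ / ‖x‖` of a matrix for the Euclidean norm. -/
def opNorm (A : Mat3) : ℝ := ‖Matrix.toEuclideanCLM (n := Fin 3) (𝕜 := ℝ) A‖

end EMSF

end

open scoped Matrix

noncomputable section

namespace EMSF

/-! ### Structure constants -/

-- The whole argument rests on $Q=H^2-24\pi T_{00}-3\Lambda$. The Hamiltonian constraint turns it
-- into $24\pi(\tau_{00}+\rho(u^0)^2)+\tfrac32\sigma_{ij}\sigma^{ij}-\tfrac32R$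
-- (`State.Constraints.Q_eq`). Outside Bianchi type IX one has $R\le0$ (`R_nonpos`), so every term
-- is nonnegative and $Q$ dominates each of them. Along the evolution $\dot
-- Q=2H(Q/3+\text{nonnegative})$. Since $\Phi$ is nondecreasing, $H^2\ge9\gamma^2$; hence $H$ never
-- vanishes, keeps its sign and satisfies $H\le-3\gamma$. So $\dot Q\le-2\gamma Q$, and all the
-- decay rates $e^{-2\gamma t}$ of the geometric and matter quantities follow.
--
-- This needs the constraints at all times, while they are assumed only at $t=0$. Their propagation
-- (`IsGlobalSolution.constraints`) is the algebraic bulk: the magnetic constraint is conserved, the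
-- Gauss defect solves a linear equation, the momentum defect solves one up to multiples of these
-- two, and the Hamiltonian defect one up to a contraction of the momentum defect. The geometric
-- inputs are the contracted Bianchi identity `divMix_ricMat` and the first variation of the scalar
-- curvature `scalFormDeriv_eq`. Both are checked in an orthonormal frame, where the metric
-- disappears and only polynomial identities in the structure constants remain.
--
-- The scalar field stops in finite time: while $U>0$, $\sqrt{2U}$ decreases at least at the
-- constant rate $m^2\Phi(0)$. Thus $U=0$ after some $T$, $\Phi$ is frozen, and $L=\Phi(T)^2$. From
-- then on $H^2=Q+9\delta^2$, which upgrades the decay rate of $Q$ to $2\delta$ and gives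
-- $H+3\delta=O(e^{-2\delta t})$.
--
-- Finally $e^{-2\delta t}g$ and $e^{2\delta t}g^{-1}$ have relative growth rates governed by
-- $H+3\delta$ and $\sigma$, hence $O(e^{-\gamma t})$, so both converge exponentially
-- (`exists_limit_of_relative_deriv_le`). Their limits are mutually inverse, which makes $G$
-- positive definite. The component bounds come from the invariant norms by Cauchy–Schwarz.

/-- The two laws satisfied by the structure constants of a Lie algebra. -/
structure IsLieConstants (C : Fin 3 → Fin 3 → Fin 3 → ℝ) : Prop where
  skew : ∀ k i j, C k i j = -C k j i
  jacobi : ∀ n i j k, ∑ l, (C l i j * C n k l + C l k i * C n j l + C l j k * C n i l) = 0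

theorem repr_lie_eq_sum {L : Type*} [LieRing L] [LieAlgebra ℝ L] (b : Module.Basis (Fin 3) ℝ L)
    (x y : L) (k : Fin 3) :
    b.repr ⁅x, y⁆ k = ∑ i, ∑ j, b.repr x i * b.repr y j * structureConstants b k i j := by
  conv_lhs => rw [← b.sum_repr x, ← b.sum_repr y]
  rw [sum_lie, map_sum, Finsupp.finsetSum_apply]
  refine Finset.sum_congr rfl fun i _ => ?_
  rw [lie_sum, map_sum, Finsupp.finsetSum_apply]
  refine Finset.sum_congr rfl fun j _ => ?_
  simp only [smul_lie, lie_smul, map_smul, Finsupp.smul_apply, smul_eq_mul, structureConstants]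
  ring

theorem isLieConstants_structureConstants {L : Type*} [LieRing L] [LieAlgebra ℝ L]
    (b : Module.Basis (Fin 3) ℝ L) : IsLieConstants (structureConstants b) where
  skew k i j := by
    unfold structureConstants
    rw [← lie_skew, map_neg]
    rfl
  jacobi n i j k := by
    have key : ∀ x y z : Fin 3, b.repr ⁅b x, ⁅b y, b z⁆⁆ n
        = ∑ l, structureConstants b l y z * structureConstants b n x l := by
      intro x y z
      rw [repr_lie_eq_sum]
      simp [Finsupp.single_apply, structureConstants]
    simp only [Finset.sum_add_distrib, ← key]
    have h := congrArg (fun w => b.repr w n) (lie_jacobi (b i) (b j) (b k))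
    simp only [map_add, Finsupp.add_apply, map_zero, Finsupp.zero_apply] at h
    linarith

/-- The matrix of `ad e_j`. -/
def adMat (C : Fin 3 → Fin 3 → Fin 3 → ℝ) (j : Fin 3) : Mat3 := Matrix.of fun k l => C k j l

/-- The matrix of the `m`-th component of the bracket. -/
def brMat (C : Fin 3 → Fin 3 → Fin 3 → ℝ) (m : Fin 3) : Mat3 := Matrix.of fun k i => C m k i

/-- The covector `C^i_{ij}`. -/
def traceForm (C : Fin 3 → Fin 3 → Fin 3 → ℝ) (j : Fin 3) : ℝ := ∑ i, C i i j

/-- The matrices of the Levi-Civita connection in an orthonormal frame. -/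
def connON (c : Fin 3 → Fin 3 → Fin 3 → ℝ) (d : Fin 3) : Mat3 :=
  (1 / 2 : ℝ) • (-(adMat c d)ᵀ - adMat c d + brMat c d)

/-- The Ricci tensor in an orthonormal frame. -/
def ricON (c : Fin 3 → Fin 3 → Fin 3 → ℝ) : Mat3 :=
  Matrix.of fun b d => ∑ f, traceForm c f * connON c b f d - (connON c d * connON c b).trace

/-- The structure constants in the frame given by the columns of `P`, with `Q` the inverse
of `P`. -/
def frameConst (C : Fin 3 → Fin 3 → Fin 3 → ℝ) (P Q : Mat3) (a b d : Fin 3) : ℝ :=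
  ∑ j, P j b * (Q * adMat C j * P) a d

theorem adMat_frameConst (C : Fin 3 → Fin 3 → Fin 3 → ℝ) (P Q : Mat3) (b : Fin 3) :
    adMat (frameConst C P Q) b = ∑ j, P j b • (Q * adMat C j * P) := by
  ext a d
  simp [adMat, frameConst, Matrix.sum_apply]

theorem brMat_frameConst (C : Fin 3 → Fin 3 → Fin 3 → ℝ) (P Q : Mat3) (d : Fin 3) :
    brMat (frameConst C P Q) d = ∑ m, Q d m • (Pᵀ * brMat C m * P) := by
  ext x y
  simp only [brMat, adMat, frameConst, Matrix.sum_apply, Matrix.of_apply, Matrix.mul_apply,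
    Matrix.smul_apply, Matrix.transpose_apply, Fin.sum_univ_three, smul_eq_mul]
  ring

theorem frameConst_skew {C : Fin 3 → Fin 3 → Fin 3 → ℝ} (hC : ∀ k i j, C k i j = -C k j i)
    (P Q : Mat3) (a b d : Fin 3) : frameConst C P Q a b d = -frameConst C P Q a d b := by
  have h (k) : C k 0 0 = 0 ∧ C k 1 1 = 0 ∧ C k 2 2 = 0 := by
    refine ⟨?_, ?_, ?_⟩
    · linarith [hC k 0 0]
    · linarith [hC k 1 1]
    · linarith [hC k 2 2]
  simp only [adMat, frameConst, Matrix.of_apply, Matrix.mul_apply, Fin.sum_univ_three,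
    (h _).1, (h _).2.1, (h _).2.2, hC _ 1 0, hC _ 2 0, hC _ 2 1]
  ring

/-- The inverse of `adMat_frameConst`: the coefficients `P j b` are undone by `Q e l`. -/
theorem conj_adMat {C : Fin 3 → Fin 3 → Fin 3 → ℝ} {P Q : Mat3} (hPQ : P * Q = 1) (l : Fin 3) :
    Q * adMat C l * P = ∑ e, Q e l • adMat (frameConst C P Q) e := by
  simp only [adMat_frameConst, Finset.smul_sum, smul_smul]
  rw [Finset.sum_comm]
  simp only [← Finset.sum_smul]
  have h (j) : ∑ e, Q e l * P j e = (1 : Mat3) j l := by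
    rw [← hPQ, Matrix.mul_apply]
    exact Finset.sum_congr rfl fun _ _ => mul_comm _ _
  simp [h, Matrix.one_apply, ite_smul]

/-- The Jacobi identity in the form "ad is a representation". This form is compatible with
conjugation, so it passes to a new frame without expanding sums. -/
theorem IsLieConstants.adMat_commutator {C : Fin 3 → Fin 3 → Fin 3 → ℝ} (hC : IsLieConstants C)
    (i j : Fin 3) :
    adMat C i * adMat C j - adMat C j * adMat C i = ∑ l, C l i j • adMat C l := by
  ext n k
  have h := hC.jacobi n i j k
  simp only [adMat, Matrix.sum_apply, Matrix.of_apply, Matrix.mul_apply,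
    Matrix.smul_apply, Matrix.sub_apply, Fin.sum_univ_three, smul_eq_mul] at h ⊢
  rw [hC.skew n k 0, hC.skew n k 1, hC.skew n k 2, hC.skew 0 k i, hC.skew 1 k i,
    hC.skew 2 k i] at h
  linarith

theorem IsLieConstants.of_commutator {C : Fin 3 → Fin 3 → Fin 3 → ℝ}
    (hC : ∀ k i j, C k i j = -C k j i)
    (h : ∀ i j, adMat C i * adMat C j - adMat C j * adMat C i = ∑ l, C l i j • adMat C l) :
    IsLieConstants C where
  skew := hC
  jacobi n i j k := by
    have h := congrFun (congrFun (h i j) n) k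
    simp only [adMat, Matrix.sum_apply, Matrix.of_apply, Matrix.mul_apply,
      Matrix.smul_apply, Matrix.sub_apply, Fin.sum_univ_three, smul_eq_mul] at h ⊢
    rw [hC n k 0, hC n k 1, hC n k 2, hC 0 k i, hC 1 k i, hC 2 k i]
    linarith

theorem IsLieConstants.frameConst {C : Fin 3 → Fin 3 → Fin 3 → ℝ} (hC : IsLieConstants C)
    {P Q : Mat3} (hPQ : P * Q = 1) : IsLieConstants (frameConst C P Q) := by
  refine IsLieConstants.of_commutator (frameConst_skew hC.skew P Q) fun b d => ?_
  have e1 (b d : Fin 3) :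
      adMat (EMSF.frameConst C P Q) b * adMat (EMSF.frameConst C P Q) d
        = ∑ i, ∑ j, (P i b * P j d) • (Q * (adMat C i * adMat C j) * P) := by
    rw [adMat_frameConst, adMat_frameConst, Finset.sum_mul]
    refine Finset.sum_congr rfl fun i _ => ?_
    rw [Finset.mul_sum]
    refine Finset.sum_congr rfl fun j _ => ?_
    rw [smul_mul_assoc, mul_smul_comm, smul_smul]
    congr 1
    simp only [Matrix.mul_assoc]
    rw [← Matrix.mul_assoc P Q, hPQ, Matrix.one_mul]
  have e2 : adMat (EMSF.frameConst C P Q) b * adMat (EMSF.frameConst C P Q) d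
      - adMat (EMSF.frameConst C P Q) d * adMat (EMSF.frameConst C P Q) b
        = ∑ i, ∑ j, (P i b * P j d) • (Q * (∑ l, C l i j • adMat C l) * P) := by
    simp only [← hC.adMat_commutator]
    rw [e1, e1, Finset.sum_comm (s := Finset.univ) (t := Finset.univ)
      (f := fun i j => (P i d * P j b) • (Q * (adMat C i * adMat C j) * P)),
      ← Finset.sum_sub_distrib]
    refine Finset.sum_congr rfl fun i _ => ?_
    rw [← Finset.sum_sub_distrib]
    refine Finset.sum_congr rfl fun j _ => ?_
    rw [mul_comm (P j d), ← smul_sub, Matrix.mul_sub, Matrix.sub_mul]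
  rw [e2]
  have e3 (i j : Fin 3) : Q * (∑ l, C l i j • adMat C l) * P
      = ∑ e, (∑ l, C l i j * Q e l) • adMat (EMSF.frameConst C P Q) e := by
    rw [Finset.mul_sum, Finset.sum_mul]
    simp only [mul_smul_comm, smul_mul_assoc, conj_adMat hPQ, Finset.smul_sum, smul_smul,
      Finset.sum_smul]
    rw [Finset.sum_comm]
  simp only [e3, Finset.smul_sum, smul_smul]
  simp only [Finset.sum_comm (s := Finset.univ) (t := Finset.univ)
      (f := fun j e => (P _ b * P j d * ∑ l, C l _ j * Q e l) •
        adMat (EMSF.frameConst C P Q) e)]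
  rw [Finset.sum_comm]
  refine Finset.sum_congr rfl fun e _ => ?_
  simp only [← Finset.sum_smul]
  congr 1
  simp only [adMat, EMSF.frameConst, Matrix.of_apply, Matrix.mul_apply, Fin.sum_univ_three]
  ring

theorem traceForm_eq {C : Fin 3 → Fin 3 → Fin 3 → ℝ} (hC : ∀ k i j, C k i j = -C k j i)
    (j : Fin 3) : traceForm C j = -(adMat C j).trace := by
  simp only [traceForm, Matrix.trace, Matrix.diag, adMat, Matrix.of_apply, fun i => hC i i j,
    Finset.sum_neg_distrib]

theorem traceForm_frameConst {C : Fin 3 → Fin 3 → Fin 3 → ℝ} (hC : ∀ k i j, C k i j = -C k j i)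
    {P Q : Mat3} (hPQ : P * Q = 1) (d : Fin 3) :
    traceForm (frameConst C P Q) d = ∑ j, traceForm C j * P j d := by
  rw [traceForm_eq (frameConst_skew hC P Q), adMat_frameConst]
  simp only [traceForm_eq hC, Matrix.trace_sum, Matrix.trace_smul]
  rw [← Finset.sum_neg_distrib]
  refine Finset.sum_congr rfl fun j _ => ?_
  rw [Matrix.trace_mul_cycle, hPQ, Matrix.one_mul, smul_eq_mul]
  ring

/-! ### Orthonormal frames -/

/-- The columns of `P` form an orthonormal frame of the metric of `s`, with dual frame given by
the rows of `Q`. -/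
structure IsFrame (s : State) (P Q : Mat3) : Prop where
  inv : P * Q = 1
  g_eq : s.g = Qᵀ * Q
  gi_eq : s.gi = P * Pᵀ

/-- A positive definite matrix factors as $Q^TQ$, and $P=Q^{-1}$. Frame changes of this kind reduce
the tensor identities below to the case $g=1$. -/
theorem exists_isFrame {s : State} (hs : s.g.PosDef) : ∃ P Q : Mat3, IsFrame s P Q := by
  open scoped MatrixOrder in
  obtain ⟨Q, hQ⟩ := CStarAlgebra.nonneg_iff_eq_star_mul_self.mp hs.posSemidef.nonneg
  have hQ' : s.g = Qᵀ * Q := by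
    rw [hQ, Matrix.star_eq_conjTranspose, Matrix.conjTranspose_eq_transpose_of_trivial]
  have hdet : IsUnit Q.det := by
    have h := hs.det_pos
    rw [hQ', Matrix.det_mul, Matrix.det_transpose] at h
    exact isUnit_iff_ne_zero.2 fun h0 => by simp [h0] at h
  refine ⟨Q⁻¹, Q, Matrix.nonsing_inv_mul Q hdet, hQ', ?_⟩
  rw [State.gi, hQ', Matrix.mul_inv_rev, Matrix.transpose_nonsing_inv]

namespace IsFrame

variable {s : State} {P Q : Mat3} (hf : IsFrame s P Q)
include hf

theorem inv' : Q * P = 1 := mul_eq_one_comm.1 hf.inv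

theorem transpose_inv : Qᵀ * Pᵀ = 1 := by
  rw [← Matrix.transpose_mul, hf.inv, Matrix.transpose_one]

theorem transpose_inv' : Pᵀ * Qᵀ = 1 := by
  rw [← Matrix.transpose_mul, hf.inv', Matrix.transpose_one]

end IsFrame

theorem State.gi_mul_g {s : State} (hs : s.g.PosDef) : s.gi * s.g = 1 :=
  Matrix.nonsing_inv_mul _ (isUnit_iff_ne_zero.2 hs.det_pos.ne')

theorem State.g_mul_gi {s : State} (hs : s.g.PosDef) : s.g * s.gi = 1 :=
  Matrix.mul_nonsing_inv _ (isUnit_iff_ne_zero.2 hs.det_pos.ne')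

theorem State.g_symm {s : State} (hs : s.g.PosDef) (i j : Fin 3) : s.g i j = s.g j i := by
  have h := hs.isHermitian.apply j i
  simpa using h

theorem State.gi_symm {s : State} (hs : s.g.PosDef) (i j : Fin 3) : s.gi i j = s.gi j i := by
  have h := hs.inv.isHermitian.apply j i
  simpa [State.gi] using h

/-! ### The connection and the Ricci tensor in an orthonormal frame -/

/-- The matrices `(γ^l_{ij})_{l,i}`. -/
def connMat (C : Fin 3 → Fin 3 → Fin 3 → ℝ) (s : State) (j : Fin 3) : Mat3 :=
  Matrix.of fun l i => s.conn C l i j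

/-- The Ricci tensor as a matrix. -/
def ricMat (C : Fin 3 → Fin 3 → Fin 3 → ℝ) (s : State) : Mat3 := Matrix.of (s.Ric C)

section Ricci

variable {C : Fin 3 → Fin 3 → Fin 3 → ℝ} {s : State} {P Q : Mat3}

theorem connMat_eq (hC : ∀ k i j, C k i j = -C k j i) (hs : s.g.PosDef) (j : Fin 3) :
    connMat C s j = (1 / 2 : ℝ) • (-(s.gi * (adMat C j)ᵀ * s.g) - adMat C j
      + s.gi * ∑ m, s.g j m • brMat C m) := by
  have h1 : -(s.gi * (adMat C j)ᵀ * s.g) - adMat C j + s.gi * ∑ m, s.g j m • brMat C m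
      = s.gi * (-((adMat C j)ᵀ * s.g) - s.g * adMat C j + ∑ m, s.g j m • brMat C m) := by
    rw [Matrix.mul_add, Matrix.mul_sub, Matrix.mul_neg, ← Matrix.mul_assoc, ← Matrix.mul_assoc,
      State.gi_mul_g hs, Matrix.one_mul]
  rw [h1]
  ext l i
  have e : ∀ k, ∑ n, (-(C n j k) * s.g i n + C n k i * s.g j n + C n i j * s.g k n)
      = (-((adMat C j)ᵀ * s.g) - s.g * adMat C j + ∑ m, s.g j m • brMat C m) k i := by
    intro k
    simp only [adMat, brMat, Matrix.of_apply, Matrix.mul_apply, Fin.sum_univ_three,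
      Matrix.add_apply, Matrix.sub_apply, Matrix.neg_apply, Matrix.smul_apply, smul_eq_mul,
      Matrix.transpose_apply, hC _ i j, State.g_symm hs i]
    ring
  simp only [connMat, Matrix.of_apply, State.conn, e, Matrix.smul_apply, smul_eq_mul]
  rw [Matrix.mul_apply]

/-- The frame change is constant on the group, so the connection coefficients transform as a tensor,
with no inhomogeneous term. -/
theorem sum_smul_conj_connMat (hC : ∀ k i j, C k i j = -C k j i) (hs : s.g.PosDef)
    (hf : IsFrame s P Q) (d : Fin 3) :
    ∑ j, P j d • (Q * connMat C s j * P) = connON (frameConst C P Q) d := by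
  have e (j : Fin 3) : Q * connMat C s j * P = (1 / 2 : ℝ) • (-(Q * adMat C j * P)ᵀ
      - Q * adMat C j * P + ∑ m, s.g j m • (Pᵀ * brMat C m * P)) := by
    rw [connMat_eq hC hs, Matrix.mul_smul, Matrix.smul_mul]
    congr 1
    rw [Matrix.mul_add, Matrix.add_mul, Matrix.mul_sub, Matrix.sub_mul, Matrix.mul_neg,
      Matrix.neg_mul]
    congr 1
    · congr 2
      rw [hf.gi_eq, hf.g_eq, Matrix.transpose_mul, Matrix.transpose_mul]
      calc Q * (P * Pᵀ * (adMat C j)ᵀ * (Qᵀ * Q)) * P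
          = (Q * P) * Pᵀ * (adMat C j)ᵀ * Qᵀ * (Q * P) := by simp only [Matrix.mul_assoc]
        _ = Pᵀ * ((adMat C j)ᵀ * Qᵀ) := by
            simp only [hf.inv', Matrix.one_mul, Matrix.mul_one, Matrix.mul_assoc]
    · rw [hf.gi_eq, ← Matrix.mul_assoc, ← Matrix.mul_assoc, hf.inv', Matrix.one_mul,
        Finset.mul_sum, Finset.sum_mul]
      simp only [Matrix.mul_smul, Matrix.smul_mul]
  have e' (m : Fin 3) : ∑ j, P j d * s.g j m = Q d m := by
    have h := congrFun (congrFun (show Pᵀ * s.g = Q by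
      rw [hf.g_eq, ← Matrix.mul_assoc, hf.transpose_inv', Matrix.one_mul]) d) m
    rw [← h, Matrix.mul_apply]
    rfl
  simp only [e, connON, adMat_frameConst, brMat_frameConst, smul_comm _ (1 / 2 : ℝ),
    ← Finset.smul_sum, smul_add, smul_sub, smul_neg, Finset.sum_add_distrib,
    Finset.sum_sub_distrib, Finset.sum_neg_distrib, Matrix.transpose_sum, Matrix.transpose_smul]
  congr 2
  simp only [Finset.smul_sum, smul_smul]
  rw [Finset.sum_comm]
  simp only [← Finset.sum_smul, e']

/-- The last term of the connection is $g^{-1}$ times an antisymmetric matrix, hence traceless; the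
other two contribute $-\tfrac12\operatorname{tr}\operatorname{ad}e_j$ each. -/
theorem conn_trace (hC : ∀ k i j, C k i j = -C k j i) (hs : s.g.PosDef) (j : Fin 3) :
    ∑ l, s.conn C l l j = traceForm C j := by
  have h : ∑ l, s.conn C l l j = (connMat C s j).trace := rfl
  have h2 : (s.gi * ∑ m, s.g j m • brMat C m).trace = 0 := by
    set B := ∑ m, s.g j m • brMat C m with hB
    have hBt : Bᵀ = -B := by
      ext x y
      simp only [hB, brMat, Matrix.transpose_apply, Matrix.neg_apply,
        Matrix.smul_apply, Matrix.add_apply, Matrix.of_apply, smul_eq_mul, Fin.sum_univ_three,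
        hC _ y x]
      ring
    have hg : s.giᵀ = s.gi := by ext x y; exact State.gi_symm hs y x
    have := Matrix.trace_transpose (s.gi * B)
    rw [Matrix.transpose_mul, hBt, hg, Matrix.neg_mul, Matrix.trace_neg,
      Matrix.trace_mul_comm] at this
    linarith
  rw [h, connMat_eq hC hs, Matrix.trace_smul, Matrix.trace_add, h2, Matrix.trace_sub,
    Matrix.trace_neg, Matrix.trace_mul_cycle, State.g_mul_gi hs, Matrix.one_mul,
    Matrix.trace_transpose, traceForm_eq hC, smul_eq_mul]
  ring

theorem conn_torsion (hC : ∀ k i j, C k i j = -C k j i) (hs : s.g.PosDef) (n l j : Fin 3) :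
    s.conn C n l j - s.conn C n j l = C n l j := by
  have h : C n l j = ∑ k, s.gi n k * ∑ m, s.g k m * C m l j := by
    have h := congrFun (congrFun (show s.gi * (s.g * adMat C l) = adMat C l by
      rw [← Matrix.mul_assoc, State.gi_mul_g hs, Matrix.one_mul]) n) j
    simp only [Matrix.mul_apply, adMat, Matrix.of_apply] at h
    exact h.symm
  rw [h]
  simp only [State.conn, Fin.sum_univ_three, hC _ j l, hC _ l 0, hC _ l 1, hC _ l 2,
    hC _ j 0, hC _ j 1, hC _ j 2]
  ring

/-- Vanishing torsion replaces $C^l_{mj}$ by a difference of connection coefficients; one of the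
resulting products cancels the middle term of the definition. -/
theorem Ric_eq (hC : ∀ k i j, C k i j = -C k j i) (hs : s.g.PosDef) (i j : Fin 3) :
    s.Ric C i j = ∑ m, traceForm C m * connMat C s i m j
      - (connMat C s j * connMat C s i).trace := by
  simp only [← conn_trace hC hs, State.Ric, Matrix.trace, Matrix.diag, Matrix.mul_apply, connMat,
    Matrix.of_apply, Finset.sum_sub_distrib]
  rw [Finset.sum_comm (f := fun l n => C l n j * s.conn C n l i),
    Finset.sum_comm (f := fun l n => s.conn C l l n * s.conn C n j i)]
  simp only [← conn_torsion hC hs _ _ j, sub_mul, Finset.sum_sub_distrib, Finset.sum_mul]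
  rw [Finset.sum_comm (f := fun l n => s.conn C n j l * s.conn C l n i)]
  have h := Finset.sum_comm (s := Finset.univ) (t := Finset.univ)
    (f := fun x y => s.conn C y x j * s.conn C x y i)
  linarith

theorem conj_ricMat (hC : ∀ k i j, C k i j = -C k j i) (hs : s.g.PosDef) (hf : IsFrame s P Q) :
    Pᵀ * ricMat C s * P = ricON (frameConst C P Q) := by
  ext b d
  have e1 : (connON (frameConst C P Q) d * connON (frameConst C P Q) b).trace
      = ∑ i, ∑ j, P i b * P j d * (connMat C s j * connMat C s i).trace := by
    rw [← sum_smul_conj_connMat hC hs hf d, ← sum_smul_conj_connMat hC hs hf b, Finset.mul_sum,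
      Matrix.trace_sum]
    refine Finset.sum_congr rfl fun i _ => ?_
    rw [Finset.sum_mul, Matrix.trace_sum]
    refine Finset.sum_congr rfl fun j _ => ?_
    rw [smul_mul_assoc, mul_smul_comm, Matrix.trace_smul, Matrix.trace_smul, smul_eq_mul,
      smul_eq_mul]
    have : Q * connMat C s j * P * (Q * connMat C s i * P)
        = Q * (connMat C s j * connMat C s i) * P := by
      simp only [Matrix.mul_assoc]
      rw [← Matrix.mul_assoc P Q, hf.inv, Matrix.one_mul]
    rw [this, Matrix.trace_mul_cycle, hf.inv, Matrix.one_mul]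
    ring
  have e2 : ∑ f, traceForm (frameConst C P Q) f * connON (frameConst C P Q) b f d
      = ∑ i, ∑ j, P i b * P j d * ∑ m, traceForm C m * connMat C s i m j := by
    have h (m : Fin 3) : ∑ f, P m f * connON (frameConst C P Q) b f d
        = ∑ i, P i b * (connMat C s i * P) m d := by
      rw [← Matrix.mul_apply, ← sum_smul_conj_connMat hC hs hf b, Finset.mul_sum,
        Matrix.sum_apply]
      refine Finset.sum_congr rfl fun i _ => ?_
      rw [Matrix.mul_smul, ← Matrix.mul_assoc, ← Matrix.mul_assoc, hf.inv, Matrix.one_mul]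
      rfl
    simp only [traceForm_frameConst hC hf.inv, Finset.sum_mul]
    rw [Finset.sum_comm]
    simp only [mul_assoc, ← Finset.mul_sum, h]
    simp only [Matrix.mul_apply, Fin.sum_univ_three]
    ring
  simp only [ricON, Matrix.of_apply, e1, e2, ← Finset.sum_sub_distrib, ← mul_sub]
  simp only [Matrix.mul_apply, ricMat, Matrix.of_apply, Matrix.transpose_apply, Ric_eq hC hs,
    Fin.sum_univ_three]
  ring

end Ricci

/-! ### Divergence of symmetric tensors -/

/-- The divergence of a symmetric tensor with mixed components `X`. -/
def divMix (C : Fin 3 → Fin 3 → Fin 3 → ℝ) (X : Mat3) (j : Fin 3) : ℝ :=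
  ∑ n, traceForm C n * X n j - ∑ m, ∑ n, C m n j * X n m

theorem divMix_eq {C : Fin 3 → Fin 3 → Fin 3 → ℝ} (hC : ∀ k i j, C k i j = -C k j i)
    (X : Mat3) (j : Fin 3) :
    divMix C X j = ∑ n, traceForm C n * X n j + (adMat C j * X).trace := by
  simp only [divMix, Matrix.trace, Matrix.diag, Matrix.mul_apply, adMat, Matrix.of_apply,
    fun m n => hC m n j, neg_mul, Finset.sum_neg_distrib, sub_neg_eq_add]

theorem divMix_frameConst {C : Fin 3 → Fin 3 → Fin 3 → ℝ} (hC : ∀ k i j, C k i j = -C k j i)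
    {P Q : Mat3} (hPQ : P * Q = 1) (X : Mat3) (d : Fin 3) :
    divMix (frameConst C P Q) (Q * X * P) d = ∑ j, P j d * divMix C X j := by
  rw [divMix_eq (frameConst_skew hC P Q)]
  simp only [divMix_eq hC, mul_add, Finset.sum_add_distrib]
  congr 1
  · simp only [traceForm_frameConst hC hPQ, Finset.sum_mul]
    rw [Finset.sum_comm]
    simp only [mul_assoc, ← Finset.mul_sum]
    have (m : Fin 3) : ∑ f, P m f * (Q * (X * P)) f d = (X * P) m d := by
      rw [← Matrix.mul_apply, ← Matrix.mul_assoc, hPQ, Matrix.one_mul]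
    simp only [this]
    simp only [Matrix.mul_apply, Fin.sum_univ_three]
    ring
  · rw [adMat_frameConst, Finset.sum_mul, Matrix.trace_sum]
    refine Finset.sum_congr rfl fun j _ => ?_
    rw [smul_mul_assoc, Matrix.trace_smul, smul_eq_mul]
    congr 1
    have : Q * adMat C j * P * (Q * X * P) = Q * (adMat C j * X) * P := by
      simp only [Matrix.mul_assoc]
      rw [← Matrix.mul_assoc P Q, hPQ, Matrix.one_mul]
    rw [this, Matrix.trace_mul_cycle, hPQ, Matrix.one_mul]

/-- With $N$ = `bianchiMat c` and $a$ = `traceForm c`, the Jacobi identity is $Na=0$, and the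
divergence of Ricci is the vector $(2N-\operatorname{tr}N)Na$. -/
theorem divMix_ricON {c : Fin 3 → Fin 3 → Fin 3 → ℝ} (hc : IsLieConstants c) (d : Fin 3) :
    divMix c (ricON c) d = 0 := by
  have hd (k) : c k 0 0 = 0 ∧ c k 1 1 = 0 ∧ c k 2 2 = 0 := by
    refine ⟨?_, ?_, ?_⟩
    · linarith [hc.skew k 0 0]
    · linarith [hc.skew k 1 1]
    · linarith [hc.skew k 2 2]
  have J (n) := hc.jacobi n 0 1 2
  simp only [Fin.sum_univ_three, (hd _).1, (hd _).2.1, (hd _).2.2, hc.skew _ 1 0, hc.skew _ 0 2,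
    hc.skew _ 2 1] at J
  fin_cases d <;>
  simp only [divMix, ricON, connON, traceForm, adMat, brMat, Matrix.trace, Matrix.diag,
    Matrix.mul_apply, Matrix.of_apply, Matrix.smul_apply, Matrix.add_apply, Matrix.sub_apply,
    Matrix.neg_apply, Matrix.transpose_apply, smul_eq_mul, Fin.sum_univ_three, (hd _).1,
    (hd _).2.1, (hd _).2.2, hc.skew _ 1 0, hc.skew _ 0 2, hc.skew _ 2 1, Fin.zero_eta,
    Fin.mk_one, Fin.reduceFinMk]
  -- The coefficients in the three cases are the rows of $2N-(\operatorname{tr}N)\,1$.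
  · linear_combination (c 0 1 2 - c 1 2 0 - c 2 0 1) * J 0 + (c 0 2 0 + c 1 1 2) * J 1
      + (c 0 0 1 + c 2 1 2) * J 2
  · linear_combination (c 0 2 0 + c 1 1 2) * J 0 + (-c 0 1 2 + c 1 2 0 - c 2 0 1) * J 1
      + (c 1 0 1 + c 2 2 0) * J 2
  · linear_combination (c 0 0 1 + c 2 1 2) * J 0 + (c 1 0 1 + c 2 2 0) * J 1
      + (-c 0 1 2 - c 1 2 0 + c 2 0 1) * J 2

/-- The contracted second Bianchi identity. -/
theorem divMix_ricMat {C : Fin 3 → Fin 3 → Fin 3 → ℝ} (hC : IsLieConstants C) {s : State}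
    (hs : s.g.PosDef) (j : Fin 3) : divMix C (s.gi * ricMat C s) j = 0 := by
  obtain ⟨P, Q, hf⟩ := exists_isFrame hs
  have e : Q * (s.gi * ricMat C s) * P = ricON (frameConst C P Q) := by
    rw [← conj_ricMat hC.skew hs hf, hf.gi_eq]
    simp only [← Matrix.mul_assoc]
    rw [hf.inv', Matrix.one_mul]
  have h (d : Fin 3) : ∑ j, P j d * divMix C (s.gi * ricMat C s) j = 0 := by
    rw [← divMix_frameConst hC.skew hf.inv, e, divMix_ricON (hC.frameConst hf.inv)]
  have h2 : Qᵀ *ᵥ (Pᵀ *ᵥ divMix C (s.gi * ricMat C s)) = 0 := by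
    rw [show Pᵀ *ᵥ divMix C (s.gi * ricMat C s) = 0 from funext h, Matrix.mulVec_zero]
  rw [Matrix.mulVec_mulVec, hf.transpose_inv, Matrix.one_mulVec] at h2
  exact congrFun h2 j

/-! ### The scalar curvature -/

/-- The scalar curvature of the metric `g` with inverse `h` as a polynomial in `g`, `h` and the
structure constants. -/
def scalForm (C : Fin 3 → Fin 3 → Fin 3 → ℝ) (g h : Mat3) : ℝ :=
  -(∑ i, ∑ l, h i l * (traceForm C i * traceForm C l))
    - (1 / 4) * (∑ i, ∑ l, h i l * (adMat C i * h * (adMat C l)ᵀ * g).trace)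
    - (1 / 2) * (∑ i, ∑ l, h i l * (adMat C i * adMat C l).trace)

/-- The derivative of `scalForm C g h` when `g` and `h` have the derivatives `-2 k` and `2 κ`. -/
def scalFormDeriv (C : Fin 3 → Fin 3 → Fin 3 → ℝ) (g h k κ : Mat3) : ℝ :=
  -2 * (∑ i, ∑ l, κ i l * (traceForm C i * traceForm C l))
    - (1 / 2) * (∑ i, ∑ l, κ i l * (adMat C i * h * (adMat C l)ᵀ * g).trace)
    - (1 / 2) * (∑ i, ∑ l, h i l * (adMat C i * κ * (adMat C l)ᵀ * g).trace)
    + (1 / 2) * (∑ i, ∑ l, h i l * (adMat C i * h * (adMat C l)ᵀ * k).trace)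
    - ∑ i, ∑ l, κ i l * (adMat C i * adMat C l).trace

theorem sum_conj_mul (P M : Mat3) (φ : Fin 3 → Fin 3 → ℝ) :
    ∑ i, ∑ l, (P * M * Pᵀ) i l * φ i l
      = ∑ b, ∑ d, M b d * ∑ i, ∑ l, P i b * P l d * φ i l := by
  simp only [Matrix.mul_apply, Matrix.transpose_apply, Fin.sum_univ_three]
  ring

section Frame

variable {C : Fin 3 → Fin 3 → Fin 3 → ℝ} {P Q : Mat3}

theorem trace_adMat_frameConst_transpose (Y Z : Mat3) (b d : Fin 3) :
    ∑ i, ∑ l, P i b * P l d * (adMat C i * (P * Y * Pᵀ) * (adMat C l)ᵀ * (Qᵀ * Z * Q)).trace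
      = (adMat (frameConst C P Q) b * Y * (adMat (frameConst C P Q) d)ᵀ * Z).trace := by
  rw [adMat_frameConst, adMat_frameConst, Matrix.transpose_sum, Finset.sum_mul, Finset.sum_mul,
    Finset.sum_mul, Matrix.trace_sum]
  refine Finset.sum_congr rfl fun i _ => ?_
  rw [Finset.mul_sum, Finset.sum_mul, Matrix.trace_sum]
  refine Finset.sum_congr rfl fun l _ => ?_
  have : adMat C i * (P * Y * Pᵀ) * (adMat C l)ᵀ * (Qᵀ * Z * Q)
      = adMat C i * (P * Y * Pᵀ) * (adMat C l)ᵀ * (Qᵀ * Z) * Q := by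
    simp only [Matrix.mul_assoc]
  simp only [Matrix.transpose_smul, smul_mul_assoc, mul_smul_comm, Matrix.trace_smul, smul_eq_mul]
  rw [this, Matrix.trace_mul_comm]
  simp only [Matrix.mul_assoc, Matrix.transpose_mul]
  ring

theorem trace_adMat_frameConst_mul (hPQ : P * Q = 1) (b d : Fin 3) :
    ∑ i, ∑ l, P i b * P l d * (adMat C i * adMat C l).trace
      = (adMat (frameConst C P Q) b * adMat (frameConst C P Q) d).trace := by
  rw [adMat_frameConst, adMat_frameConst, Finset.sum_mul, Matrix.trace_sum]
  refine Finset.sum_congr rfl fun i _ => ?_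
  rw [Finset.mul_sum, Matrix.trace_sum]
  refine Finset.sum_congr rfl fun l _ => ?_
  have : Q * adMat C i * P * (Q * adMat C l * P) = Q * (adMat C i * adMat C l) * P := by
    simp only [Matrix.mul_assoc]
    rw [← Matrix.mul_assoc P Q, hPQ, Matrix.one_mul]
  rw [smul_mul_assoc, mul_smul_comm, Matrix.trace_smul, Matrix.trace_smul, this,
    Matrix.trace_mul_cycle, hPQ, Matrix.one_mul, smul_eq_mul, smul_eq_mul]
  ring

theorem traceForm_mul_frameConst (hC : ∀ k i j, C k i j = -C k j i) (hPQ : P * Q = 1)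
    (b d : Fin 3) :
    ∑ i, ∑ l, P i b * P l d * (traceForm C i * traceForm C l)
      = traceForm (frameConst C P Q) b * traceForm (frameConst C P Q) d := by
  rw [traceForm_frameConst hC hPQ, traceForm_frameConst hC hPQ, Finset.sum_mul_sum]
  exact Finset.sum_congr rfl fun i _ => Finset.sum_congr rfl fun l _ => by ring

theorem scalForm_frameConst (hC : ∀ k i j, C k i j = -C k j i) (hPQ : P * Q = 1) :
    scalForm C (Qᵀ * Q) (P * Pᵀ) = scalForm (frameConst C P Q) 1 1 := by
  have hP : P * Pᵀ = P * (1 : Mat3) * Pᵀ := by rw [Matrix.mul_one]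
  have hQ : Qᵀ * Q = Qᵀ * (1 : Mat3) * Q := by rw [Matrix.mul_one]
  unfold scalForm
  rw [hP, hQ]
  simp only [sum_conj_mul, trace_adMat_frameConst_transpose, trace_adMat_frameConst_mul hPQ,
    traceForm_mul_frameConst hC hPQ]

theorem scalFormDeriv_frameConst (hC : ∀ k i j, C k i j = -C k j i) (hPQ : P * Q = 1)
    (k : Mat3) :
    scalFormDeriv C (Qᵀ * Q) (P * Pᵀ) (Qᵀ * k * Q) (P * k * Pᵀ)
      = scalFormDeriv (frameConst C P Q) 1 1 k k := by
  have hP : P * Pᵀ = P * (1 : Mat3) * Pᵀ := by rw [Matrix.mul_one]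
  have hQ : Qᵀ * Q = Qᵀ * (1 : Mat3) * Q := by rw [Matrix.mul_one]
  unfold scalFormDeriv
  rw [hP, hQ]
  simp only [sum_conj_mul, trace_adMat_frameConst_transpose, trace_adMat_frameConst_mul hPQ,
    traceForm_mul_frameConst hC hPQ]

end Frame

theorem diag_eq_zero {C : Fin 3 → Fin 3 → Fin 3 → ℝ} (hC : ∀ k i j, C k i j = -C k j i)
    (k : Fin 3) : C k 0 0 = 0 ∧ C k 1 1 = 0 ∧ C k 2 2 = 0 :=
  ⟨by linarith [hC k 0 0], by linarith [hC k 1 1], by linarith [hC k 2 2]⟩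

theorem trace_ricON {c : Fin 3 → Fin 3 → Fin 3 → ℝ} (hc : ∀ k i j, c k i j = -c k j i) :
    (ricON c).trace = scalForm c 1 1 := by
  have hd := diag_eq_zero hc
  simp only [scalForm, ricON, connON, traceForm, adMat, brMat, Matrix.trace, Matrix.diag,
    Matrix.mul_apply, Matrix.of_apply, Matrix.smul_apply, Matrix.add_apply, Matrix.sub_apply,
    Matrix.neg_apply, Matrix.transpose_apply, smul_eq_mul, Fin.sum_univ_three, (hd _).1,
    (hd _).2.1, (hd _).2.2, hc _ 1 0, hc _ 0 2, hc _ 2 1, Matrix.one_apply, Fin.isValue,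
    Fin.reduceEq, if_true, if_false, mul_one, mul_zero, zero_mul, one_mul, add_zero, zero_add]
  ring

/-- For $\dot g=-2k$ the variation of $R$ is $2R^{ij}k_{ij}-2\nabla^i\nabla^jk_{ij}+2\Delta H$. By
homogeneity $\Delta H=0$, and the divergence of an invariant covector is its contraction with the
trace form. The identity is polynomial and uses skewness but not Jacobi. -/
theorem scalFormDeriv_one {c : Fin 3 → Fin 3 → Fin 3 → ℝ} (hc : ∀ k i j, c k i j = -c k j i)
    {k : Mat3} (hk : ∀ i j, k i j = k j i) :
    scalFormDeriv c 1 1 k k = 2 * (ricON c * k).trace - 2 * ∑ d, traceForm c d * divMix c k d := by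
  have hd := diag_eq_zero hc
  simp only [scalFormDeriv, ricON, connON, traceForm, divMix, adMat, brMat, Matrix.trace,
    Matrix.diag, Matrix.mul_apply, Matrix.of_apply, Matrix.smul_apply, Matrix.add_apply,
    Matrix.sub_apply, Matrix.neg_apply, Matrix.transpose_apply, smul_eq_mul, Fin.sum_univ_three,
    (hd _).1, (hd _).2.1, (hd _).2.2, hc _ 1 0, hc _ 0 2, hc _ 2 1, Matrix.one_apply, Fin.isValue,
    Fin.reduceEq, if_true, if_false, mul_one, mul_zero, zero_mul, one_mul, add_zero, zero_add,
    hk 1 0, hk 2 0, hk 2 1]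
  ring

theorem R_eq_trace_ricON {C : Fin 3 → Fin 3 → Fin 3 → ℝ} (hC : ∀ k i j, C k i j = -C k j i)
    {s : State} (hs : s.g.PosDef) {P Q : Mat3} (hf : IsFrame s P Q) :
    s.R C = (ricON (frameConst C P Q)).trace := by
  rw [← conj_ricMat hC hs hf, Matrix.mul_assoc, Matrix.trace_mul_comm, Matrix.mul_assoc,
    ← hf.gi_eq]
  simp only [State.R, Matrix.trace, Matrix.diag, Matrix.mul_apply, ricMat, Matrix.of_apply]
  exact Finset.sum_congr rfl fun i _ => Finset.sum_congr rfl fun j _ => by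
    rw [State.gi_symm hs, mul_comm]

/-- As a polynomial in $g$ and $g^{-1}$, the scalar curvature can be differentiated in time by the
product rule. -/
theorem R_eq_scalForm {C : Fin 3 → Fin 3 → Fin 3 → ℝ} (hC : ∀ k i j, C k i j = -C k j i)
    {s : State} (hs : s.g.PosDef) : s.R C = scalForm C s.g s.gi := by
  obtain ⟨P, Q, hf⟩ := exists_isFrame hs
  rw [R_eq_trace_ricON hC hs hf, trace_ricON (frameConst_skew hC P Q), hf.g_eq, hf.gi_eq,
    scalForm_frameConst hC hf.inv]

/-- The first variation of the scalar curvature. -/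
theorem scalFormDeriv_eq {C : Fin 3 → Fin 3 → Fin 3 → ℝ} (hC : ∀ k i j, C k i j = -C k j i)
    {s : State} (hs : s.g.PosDef) (hk : s.k.IsSymm) :
    scalFormDeriv C s.g s.gi s.k (s.gi * s.k * s.gi)
      = 2 * (s.gi * ricMat C s * (s.gi * s.k)).trace
        - 2 * ∑ i, ∑ j, s.gi i j * (traceForm C i * divMix C (s.gi * s.k) j) := by
  obtain ⟨P, Q, hf⟩ := exists_isFrame hs
  set k' := Pᵀ * s.k * P with hk'
  have e1 : s.k = Qᵀ * k' * Q := by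
    calc s.k = (Qᵀ * Pᵀ) * s.k * (P * Q) := by
          rw [hf.transpose_inv, hf.inv, Matrix.one_mul, Matrix.mul_one]
      _ = Qᵀ * k' * Q := by simp only [hk', Matrix.mul_assoc]
  have e2 : s.gi * s.k * s.gi = P * k' * Pᵀ := by
    rw [hf.gi_eq]; simp only [hk', Matrix.mul_assoc]
  have e3 : Q * (s.gi * s.k) * P = k' := by
    rw [hf.gi_eq]
    simp only [← Matrix.mul_assoc]
    rw [hf.inv', Matrix.one_mul]
  have e4 : (s.gi * ricMat C s * (s.gi * s.k)).trace = (ricON (frameConst C P Q) * k').trace := by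
    rw [← conj_ricMat hC hs hf, hf.gi_eq]
    calc (P * Pᵀ * ricMat C s * (P * Pᵀ * s.k)).trace
        = (P * (Pᵀ * ricMat C s * P * Pᵀ * s.k)).trace := by simp only [Matrix.mul_assoc]
      _ = (Pᵀ * ricMat C s * P * k').trace := by
          rw [Matrix.trace_mul_comm]; simp only [hk', Matrix.mul_assoc]
  have e5 : ∑ i, ∑ j, s.gi i j * (traceForm C i * divMix C (s.gi * s.k) j)
      = ∑ d, traceForm (frameConst C P Q) d * divMix (frameConst C P Q) k' d := by
    rw [← e3]
    simp only [divMix_frameConst hC hf.inv, traceForm_frameConst hC hf.inv]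
    generalize divMix C (s.gi * s.k) = D
    rw [hf.gi_eq]
    simp only [Matrix.mul_apply, Matrix.transpose_apply, Fin.sum_univ_three]
    ring
  have hsym : ∀ i j, k' i j = k' j i := by
    intro i j
    have : k'ᵀ = k' := by
      rw [hk', Matrix.transpose_mul, Matrix.transpose_mul, Matrix.transpose_transpose, hk.eq,
        Matrix.mul_assoc]
    exact congrFun (congrFun this j) i
  rw [e4, e5, ← scalFormDeriv_one (frameConst_skew hC P Q) hsym,
    ← scalFormDeriv_frameConst hC hf.inv, ← hf.g_eq, ← hf.gi_eq, ← e1, ← e2]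

/-! ### The sign of the scalar curvature -/

/-- The symmetric matrix of the Bianchi classification. -/
def bianchiMat (c : Fin 3 → Fin 3 → Fin 3 → ℝ) : Mat3 :=
  !![c 0 1 2, (c 0 2 0 + c 1 1 2) / 2, (c 0 0 1 + c 2 1 2) / 2;
     (c 0 2 0 + c 1 1 2) / 2, c 1 2 0, (c 1 0 1 + c 2 2 0) / 2;
     (c 0 0 1 + c 2 1 2) / 2, (c 1 0 1 + c 2 2 0) / 2, c 2 0 1]

/-- Structure constants in dimension three split into a symmetric matrix $N$ and the trace covector
$a$. Only the $N$ part can make the scalar curvature positive. -/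
theorem trace_ricON_eq_bianchi {c : Fin 3 → Fin 3 → Fin 3 → ℝ}
    (hc : ∀ k i j, c k i j = -c k j i) :
    (ricON c).trace = (bianchiMat c).trace ^ 2 / 2 - (bianchiMat c * bianchiMat c).trace
      - 3 / 2 * ∑ i, traceForm c i ^ 2 := by
  have hd := diag_eq_zero hc
  simp only [bianchiMat, ricON, connON, traceForm, adMat, brMat, Matrix.trace, Matrix.diag,
    Matrix.mul_apply, Matrix.of_apply, Matrix.smul_apply, Matrix.add_apply, Matrix.sub_apply,
    Matrix.neg_apply, Matrix.transpose_apply, smul_eq_mul, Fin.sum_univ_three, (hd _).1,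
    (hd _).2.1, (hd _).2.2, hc _ 1 0, hc _ 0 2, hc _ 2 1, Matrix.cons_val', Matrix.cons_val_zero,
    Matrix.cons_val_one, Matrix.cons_val, Matrix.cons_val_fin_one]
  ring

theorem bianchiMat_mulVec_traceForm {c : Fin 3 → Fin 3 → Fin 3 → ℝ} (hc : IsLieConstants c) :
    bianchiMat c *ᵥ traceForm c = 0 := by
  have hd := diag_eq_zero hc.skew
  have J (n) := hc.jacobi n 0 1 2
  simp only [Fin.sum_univ_three, (hd _).1, (hd _).2.1, (hd _).2.2, hc.skew _ 1 0, hc.skew _ 0 2,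
    hc.skew _ 2 1] at J
  ext i
  fin_cases i <;>
  simp only [bianchiMat, traceForm, Matrix.mulVec, dotProduct, Matrix.of_apply,
    Fin.sum_univ_three, (hd _).1, (hd _).2.1, (hd _).2.2, hc.skew _ 1 0, hc.skew _ 0 2,
    hc.skew _ 2 1, Matrix.cons_val', Matrix.cons_val_zero, Matrix.cons_val_one, Matrix.cons_val,
    Matrix.cons_val_fin_one, Fin.zero_eta, Fin.mk_one, Fin.reduceFinMk, Pi.zero_apply]
  · linear_combination J 0
  · linear_combination J 1
  · linear_combination J 2

/-- Twice the quantity assumed positive equals $4l_0l_1-(l_0+l_1-l_2)^2$ in the eigenvalues, and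
likewise for any other pair. So the eigenvalues all have the same sign. -/
theorem posDef_or_neg_posDef {n : Mat3} (hn : n.IsHermitian)
    (h : 0 < n.trace ^ 2 / 2 - (n * n).trace) : n.PosDef ∨ (-n).PosDef := by
  have h1 : n.trace = ∑ i, hn.eigenvalues i := by
    simpa using hn.trace_eq_sum_eigenvalues
  have h2 : (n * n).trace = ∑ i, hn.eigenvalues i ^ 2 := by
    have e := hn.spectral_theorem
    have : n * n = Unitary.conjStarAlgAut ℝ _ hn.eigenvectorUnitary
        (Matrix.diagonal fun i => hn.eigenvalues i ^ 2) := by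
      conv_lhs => rw [e, ← map_mul, Matrix.diagonal_mul_diagonal]
      congr 2
      ext i
      simp [sq]
    rw [this, Unitary.conjStarAlgAut_apply, Matrix.trace_mul_cycle, Unitary.coe_star_mul_self,
      Matrix.one_mul, Matrix.trace_diagonal]
  set l := hn.eigenvalues with hl
  rw [h1, h2] at h
  simp only [Fin.sum_univ_three] at h
  have p01 : 0 < l 0 * l 1 := by nlinarith [sq_nonneg (l 0 + l 1 - l 2)]
  have p02 : 0 < l 0 * l 2 := by nlinarith [sq_nonneg (l 0 + l 2 - l 1)]
  rcases lt_trichotomy (l 0) 0 with h0 | h0 | h0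
  · right
    have h1' : l 1 < 0 := by nlinarith
    have h2' : l 2 < 0 := by nlinarith
    have hneg (i : Fin 3) : l i < 0 := by fin_cases i <;> assumption
    have e := hn.spectral_theorem
    have hp : (Unitary.conjStarAlgAut ℝ _ hn.eigenvectorUnitary
        (Matrix.diagonal fun i => -hn.eigenvalues i)) = -n := by
      conv_rhs => rw [e, ← map_neg]
      congr 1
      ext i j
      simp [Matrix.diagonal_apply]
      split <;> simp
    rw [← hp, Unitary.conjStarAlgAut_apply,
      Matrix.IsUnit.posDef_star_right_conjugate_iff Unitary.isUnit_coe]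
    exact Matrix.PosDef.diagonal fun i => by simpa using hneg i
  · simp [h0] at p01
  · left
    have h1' : 0 < l 1 := by nlinarith
    have h2' : 0 < l 2 := by nlinarith
    rw [hn.posDef_iff_eigenvalues_pos]
    intro i
    fin_cases i <;> assumption

theorem transpose_mulVec_cross (M : Mat3) (x y : Fin 3 → ℝ) :
    Mᵀ *ᵥ crossProduct (M *ᵥ x) (M *ᵥ y) = M.det • crossProduct x y := by
  ext i
  fin_cases i <;>
  simp [cross_apply, Matrix.mulVec, dotProduct, Fin.sum_univ_three, Matrix.det_fin_three] <;> ring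

theorem adjugate_neg_three (n : Mat3) : (-n).adjugate = n.adjugate := by
  rw [Matrix.adjugate_fin_three, Matrix.adjugate_fin_three]
  simp

/-- For $n$ positive definite the adjugate is $\det(n)\,n^{-1}$; in dimension three the adjugate is
even in $n$, which covers the negative case. -/
theorem posDef_adjugate {n : Mat3} (hn : n.PosDef ∨ (-n).PosDef) : n.adjugate.PosDef := by
  have key : ∀ {a : Mat3}, a.PosDef → a.adjugate.PosDef := fun {a} ha => by
    have h := ha.inv.smul ha.det_pos
    rwa [Matrix.inv_def, Ring.inverse_eq_inv', smul_smul, mul_inv_cancel₀ ha.det_pos.ne',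
      one_smul] at h
  rcases hn with h | h
  · exact key h
  · rw [← adjugate_neg_three]; exact key h

theorem det_ne_zero_of_definite {n : Mat3} (hn : n.PosDef ∨ (-n).PosDef) : n.det ≠ 0 := by
  rcases hn with h | h
  · exact h.det_pos.ne'
  · intro h0
    have := h.det_pos
    rw [Matrix.det_neg, h0] at this
    simp at this

/-- The bracket `n (x × y)` with `n` definite is isomorphic to the cross product. -/
theorem exists_conj_cross {n : Mat3} (hn : n.PosDef ∨ (-n).PosDef) :
    ∃ M : Mat3, M.det ≠ 0 ∧
      ∀ x y, M *ᵥ (n *ᵥ crossProduct x y) = crossProduct (M *ᵥ x) (M *ᵥ y) := by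
  have hdet := det_ne_zero_of_definite hn
  -- A square root of the adjugate has $(\det M)^2=(\det n)^2$; in odd dimension replacing $M$ by
  -- $-M$ corrects the sign. Then $M^TMn=\det(n)\,1$, and the cofactor identity for the cross
  -- product yields the claim after cancelling $M^T$.
  have key : ∃ M : Mat3, Mᵀ * M = n.adjugate ∧ M.det = n.det := by
    open scoped MatrixOrder in
    obtain ⟨Q, hQ⟩ :=
      CStarAlgebra.nonneg_iff_eq_star_mul_self.mp (posDef_adjugate hn).posSemidef.nonneg
    have hQ' : Qᵀ * Q = n.adjugate := by
      rw [hQ, Matrix.star_eq_conjTranspose, Matrix.conjTranspose_eq_transpose_of_trivial]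
    have h := congrArg Matrix.det hQ'
    rw [Matrix.det_mul, Matrix.det_transpose, Matrix.det_adjugate, Fintype.card_fin, ← sq] at h
    rcases sq_eq_sq_iff_eq_or_eq_neg.1 h with h | h
    · exact ⟨Q, hQ', h⟩
    · refine ⟨-Q, by simpa using hQ', ?_⟩
      rw [Matrix.det_neg, h]
      simp
      norm_num
  obtain ⟨M, hM, hMd⟩ := key
  refine ⟨M, hMd ▸ hdet, fun x y => ?_⟩
  have h : Mᵀ *ᵥ (M *ᵥ (n *ᵥ crossProduct x y))
      = Mᵀ *ᵥ crossProduct (M *ᵥ x) (M *ᵥ y) := by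
    rw [transpose_mulVec_cross, Matrix.mulVec_mulVec, hM, Matrix.mulVec_mulVec,
      Matrix.adjugate_mul, hMd, Matrix.smul_mulVec, Matrix.one_mulVec]
  refine Matrix.mulVec_injective_of_isUnit ?_ h
  rw [Matrix.isUnit_iff_isUnit_det, Matrix.det_transpose, hMd]
  exact isUnit_iff_ne_zero.2 hdet

theorem frameConst_bracket {C : Fin 3 → Fin 3 → Fin 3 → ℝ} {P Q : Mat3} (hPQ : P * Q = 1)
    (x y : Fin 3 → ℝ) (a : Fin 3) :
    ∑ b, ∑ d, frameConst C P Q a b d * (Q *ᵥ x) b * (Q *ᵥ y) d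
      = (Q *ᵥ fun k => ∑ i, ∑ j, x i * y j * C k i j) a := by
  have e1 (j : Fin 3) : ∑ d, (Q * adMat C j * P) a d * (Q *ᵥ y) d = ((Q * adMat C j) *ᵥ y) a := by
    have h : (Q * adMat C j * P) *ᵥ (Q *ᵥ y) = (Q * adMat C j) *ᵥ y := by
      rw [Matrix.mulVec_mulVec, Matrix.mul_assoc, hPQ, Matrix.mul_one]
    exact congrFun h a
  have e2 (j : Fin 3) : ∑ b, P j b * (Q *ᵥ x) b = x j := by
    have h : P *ᵥ (Q *ᵥ x) = x := by
      rw [Matrix.mulVec_mulVec, hPQ, Matrix.one_mulVec]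
    exact congrFun h j
  have e3 : ∑ b, ∑ d, frameConst C P Q a b d * (Q *ᵥ x) b * (Q *ᵥ y) d
      = ∑ j, (∑ b, P j b * (Q *ᵥ x) b) * ∑ d, (Q * adMat C j * P) a d * (Q *ᵥ y) d := by
    generalize Q *ᵥ x = x'
    generalize Q *ᵥ y = y'
    simp only [frameConst]
    generalize hX : (fun j => Q * adMat C j * P) = X
    have hX (j) : Q * adMat C j * P = X j := by rw [← hX]
    simp only [hX, Fin.sum_univ_three]
    ring
  rw [e3]
  simp only [e1, e2]
  simp only [Matrix.mulVec, dotProduct, Matrix.mul_apply, adMat, Matrix.of_apply,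
    Fin.sum_univ_three]
  ring

/-- In the unimodular case $a=0$, only the symmetric part $N$ of the structure constants survives.
-/
theorem bracket_eq_bianchiMat {c : Fin 3 → Fin 3 → Fin 3 → ℝ} (hc : ∀ k i j, c k i j = -c k j i)
    (ha : traceForm c = 0) (x y : Fin 3 → ℝ) (a : Fin 3) :
    ∑ b, ∑ d, c a b d * x b * y d = (bianchiMat c *ᵥ crossProduct x y) a := by
  have hd := diag_eq_zero hc
  have h (j) : traceForm c j = 0 := congrFun ha j
  have h0 := h 0
  have h1 := h 1
  have h2 := h 2
  simp only [traceForm, Fin.sum_univ_three, (hd _).1, (hd _).2.1, (hd _).2.2, hc _ 1 0, hc _ 0 2,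
    hc _ 2 1] at h0 h1 h2
  fin_cases a <;>
  simp only [bianchiMat, cross_apply, Matrix.mulVec, dotProduct, Matrix.of_apply,
    Fin.sum_univ_three, (hd _).1, (hd _).2.1, (hd _).2.2, hc _ 1 0, hc _ 0 2, hc _ 2 1,
    Matrix.cons_val', Matrix.cons_val_zero, Matrix.cons_val_one, Matrix.cons_val,
    Matrix.cons_val_fin_one, Fin.zero_eta, Fin.mk_one, Fin.reduceFinMk]
  · linear_combination (h2 / 2) * (x 0 * y 2 - x 2 * y 0) + (h1 / 2) * (x 0 * y 1 - x 1 * y 0)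
  · linear_combination (h2 / 2) * (x 1 * y 2 - x 2 * y 1) - (h0 / 2) * (x 0 * y 1 - x 1 * y 0)
  · linear_combination -(h1 / 2) * (x 1 * y 2 - x 2 * y 1) - (h0 / 2) * (x 0 * y 2 - x 2 * y 0)

/-- Left invariant metrics on three dimensional Lie groups that are not of Bianchi type IX have
nonpositive scalar curvature. -/
theorem R_nonpos {L : Type*} [LieRing L] [LieAlgebra ℝ L] (b : Module.Basis (Fin 3) ℝ L)
    (hL : ¬ IsBianchiIX L) {s : State} (hs : s.g.PosDef) : s.R (structureConstants b) ≤ 0 := by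
  have hC := isLieConstants_structureConstants b
  obtain ⟨P, Q, hf⟩ := exists_isFrame hs
  set c := frameConst (structureConstants b) P Q with hc
  have hcL : IsLieConstants c := hC.frameConst hf.inv
  rw [R_eq_trace_ricON hC.skew hs hf, ← hc, trace_ricON_eq_bianchi hcL.skew]
  -- Positive curvature makes $N$ definite. Then $Na=0$ forces $a=0$, so the bracket is $N(x\times
  -- y)$, which is isomorphic to the cross product: type IX.
  by_contra! hpos
  have hsq : 0 ≤ ∑ i, traceForm c i ^ 2 := Finset.sum_nonneg fun i _ => sq_nonneg _
  have hherm : (bianchiMat c).IsHermitian := by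
    ext i j
    fin_cases i <;> fin_cases j <;> simp [bianchiMat]
  have hdef := posDef_or_neg_posDef hherm (by linarith)
  have ha : traceForm c = 0 :=
    Matrix.eq_zero_of_mulVec_eq_zero (det_ne_zero_of_definite hdef)
      (bianchiMat_mulVec_traceForm hcL)
  obtain ⟨M, hM, hMc⟩ := exists_conj_cross hdef
  have hQ : Q.det ≠ 0 := by
    intro h0
    have := congrArg Matrix.det hf.inv
    rw [Matrix.det_mul, h0] at this
    simp at this
  have hu : IsUnit (M * Q).det := by
    rw [Matrix.det_mul]
    exact isUnit_iff_ne_zero.2 (mul_ne_zero hM hQ)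
  refine hL ⟨b.equivFun.trans (Matrix.toLin'OfInv (Matrix.nonsing_inv_mul _ hu)
    (Matrix.mul_nonsing_inv _ hu)), fun x y => ?_⟩
  have e (z : L) : (b.equivFun.trans (Matrix.toLin'OfInv (Matrix.nonsing_inv_mul _ hu)
    (Matrix.mul_nonsing_inv _ hu))) z = M *ᵥ (Q *ᵥ (b.repr z)) := by
    rw [Matrix.mulVec_mulVec]
    rfl
  rw [e, e, e, ← hMc]
  congr 1
  ext a
  rw [← bracket_eq_bianchiMat hcL.skew ha, hc, frameConst_bracket hf.inv]
  congr 2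
  ext k
  exact repr_lie_eq_sum b x y k

/-! ### Calculus of matrix valued functions on `[0, ∞)` -/

/-- The entries of `A` have the entries of `A'` as (one-sided at `0`) derivatives at `t`. -/
def MDeriv (A : ℝ → Mat3) (A' : Mat3) (t : ℝ) : Prop :=
  ∀ i j, HasDerivWithinAt (fun r => A r i j) (A' i j) (Set.Ici 0) t

namespace MDeriv

variable {A B : ℝ → Mat3} {A' B' : Mat3} {t : ℝ}

theorem const (X : Mat3) (t : ℝ) : MDeriv (fun _ => X) 0 t := fun _ _ =>
  hasDerivWithinAt_const ..

theorem mul (hA : MDeriv A A' t) (hB : MDeriv B B' t) :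
    MDeriv (fun r => A r * B r) (A' * B t + A t * B') t := by
  intro i j
  simp only [Matrix.mul_apply, Matrix.add_apply, ← Finset.sum_add_distrib]
  exact HasDerivWithinAt.fun_sum fun l _ => (hA i l).mul (hB l j)

theorem transpose (hA : MDeriv A A' t) : MDeriv (fun r => (A r)ᵀ) A'ᵀ t := fun i j => hA j i

theorem trace (hA : MDeriv A A' t) :
    HasDerivWithinAt (fun r => (A r).trace) A'.trace (Set.Ici 0) t := by
  simp only [Matrix.trace, Matrix.diag]
  exact HasDerivWithinAt.fun_sum fun l _ => hA l l

theorem unique {A'' : Mat3} (ht : 0 ≤ t) (hA : MDeriv A A' t) (hA' : MDeriv A A'' t) :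
    A' = A'' := by
  ext i j
  exact (uniqueDiffOn_Ici (0 : ℝ) t ht).eq_deriv _ (hA i j) (hA' i j)

end MDeriv

/-- Grönwall on $[0,t]$, where the coefficient is bounded by compactness. The constraint defects
other than the magnetic one are shown to vanish by this lemma. -/
theorem eq_zero_of_linear_ode {y f : ℝ → ℝ} (hf : ContinuousOn f (Set.Ici 0))
    (hy : ∀ t, 0 ≤ t → HasDerivWithinAt y (f t * y t) (Set.Ici 0) t) (h0 : y 0 = 0) {t : ℝ}
    (ht : 0 ≤ t) : y t = 0 := by
  obtain ⟨K, hK⟩ := isCompact_Icc.exists_bound_of_continuousOn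
    (hf.mono (Set.Icc_subset_Ici_self : Set.Icc 0 t ⊆ Set.Ici 0))
  refine eq_zero_of_abs_deriv_le_mul_abs_self_of_eq_zero_right (f' := fun r => f r * y r) (K := K)
    (fun r hr => ((hy r hr.1).continuousWithinAt).mono Set.Icc_subset_Ici_self)
    (fun r hr => (hy r hr.1).mono (Set.Ici_subset_Ici.2 hr.1)) h0 (fun r hr => ?_) t ⟨ht, le_rfl⟩
  rw [norm_mul]
  exact mul_le_mul_of_nonneg_right (hK r ⟨hr.1, hr.2.le⟩) (norm_nonneg _)

theorem eq_initial_of_deriv_zero {y : ℝ → ℝ}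
    (hy : ∀ t, 0 ≤ t → HasDerivWithinAt y 0 (Set.Ici 0) t) {t : ℝ} (ht : 0 ≤ t) : y t = y 0 := by
  have := eq_zero_of_linear_ode (y := fun r => y r - y 0) (f := fun _ => 0) continuousOn_const
    (fun r hr => by simpa using (hy r hr).sub_const (y 0)) (sub_self _) ht
  linarith

theorem hasDerivWithinAt_sum_mul {x y : ℝ → Fin 3 → ℝ} {x' y' : Fin 3 → ℝ} {t : ℝ}
    (hx : ∀ i, HasDerivWithinAt (fun r => x r i) (x' i) (Set.Ici 0) t)
    (hy : ∀ i, HasDerivWithinAt (fun r => y r i) (y' i) (Set.Ici 0) t) :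
    HasDerivWithinAt (fun r => ∑ i, x r i * y r i) (∑ i, (x' i * y t i + x t i * y' i))
      (Set.Ici 0) t :=
  HasDerivWithinAt.fun_sum fun l _ => (hx l).mul (hy l)

-- Metric, curvature and Faraday tensor along a solution.

section Solution

variable {C : Fin 3 → Fin 3 → Fin 3 → ℝ} {m Λ : ℝ} {v : ℝ → State}

namespace IsGlobalSolution

variable (h : IsGlobalSolution C m Λ v)
include h

theorem g_deriv {t : ℝ} (ht : 0 ≤ t) : MDeriv (fun r => (v r).g) ((-2 : ℝ) • (v t).k) t :=
  fun i j => by simpa using h.g_eq t ht i j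

/-- Up to the factor $-2$, $k$ is the derivative of the symmetric matrix $g$. -/
theorem k_symm {t : ℝ} (ht : 0 ≤ t) : (v t).k.IsSymm := by
  refine Matrix.IsSymm.ext fun i j => ?_
  have h1 := h.g_eq t ht i j
  have h2 := (h.g_eq t ht j i).congr (f₁ := fun r => (v r).g i j)
    (fun r hr => State.g_symm (h.g_posDef r hr) i j) (State.g_symm (h.g_posDef t ht) i j)
  have := (uniqueDiffOn_Ici (0 : ℝ) t ht).eq_deriv _ h1 h2
  linarith

/-- Cramer's formula gives differentiability; differentiating $g^{-1}g=1$ then identifies the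
derivative. -/
theorem gi_deriv {t : ℝ} (ht : 0 ≤ t) :
    MDeriv (fun r => (v r).gi) ((2 : ℝ) • ((v t).gi * (v t).k * (v t).gi)) t := by
  have hg (i j : Fin 3) : DifferentiableWithinAt ℝ (fun r => (v r).g i j) (Set.Ici 0) t :=
    (h.g_eq t ht i j).differentiableWithinAt
  have hdet : DifferentiableWithinAt ℝ (fun r => (v r).g.det) (Set.Ici 0) t := by
    simp only [Matrix.det_fin_three]
    fun_prop
  have hadj (i j : Fin 3) :
      DifferentiableWithinAt ℝ (fun r => (v r).g.adjugate i j) (Set.Ici 0) t := by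
    simp only [Matrix.adjugate_fin_three]
    fin_cases i <;> fin_cases j <;> simp <;> fun_prop
  have hgi (i j : Fin 3) : DifferentiableWithinAt ℝ (fun r => (v r).gi i j) (Set.Ici 0) t := by
    simp only [State.gi, Matrix.inv_def, Ring.inverse_eq_inv', Matrix.smul_apply, smul_eq_mul]
    exact (hdet.inv (h.g_posDef t ht).det_pos.ne').mul (hadj i j)
  let X : Mat3 := Matrix.of fun i j => derivWithin (fun r => (v r).gi i j) (Set.Ici 0) t
  have hX : MDeriv (fun r => (v r).gi) X t := fun i j => (hgi i j).hasDerivWithinAt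
  have h1 := hX.mul (h.g_deriv ht)
  have h2 : MDeriv (fun r => (v r).gi * (v r).g) 0 t := by
    intro i j
    refine (MDeriv.const (1 : Mat3) t i j).congr (fun r hr => ?_) ?_
    · simp only [State.gi_mul_g (h.g_posDef r hr)]
    · simp only [State.gi_mul_g (h.g_posDef t ht)]
  have h3 := h1.unique ht h2
  have h4 : X = (2 : ℝ) • ((v t).gi * (v t).k * (v t).gi) := by
    have h5 : X * (v t).g = (2 : ℝ) • ((v t).gi * (v t).k) := by
      rw [Matrix.mul_smul] at h3
      rw [eq_neg_of_add_eq_zero_left h3, neg_smul, neg_neg]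
    calc X = X * (v t).g * (v t).gi := by
          rw [Matrix.mul_assoc, State.g_mul_gi (h.g_posDef t ht), Matrix.mul_one]
      _ = _ := by rw [h5, Matrix.smul_mul]
  rw [← h4]
  exact hX

theorem k_deriv {t : ℝ} (ht : 0 ≤ t) :
    MDeriv (fun r => (v r).k) (Matrix.of ((v t).kRate C m Λ)) t :=
  fun i j => by simpa using h.k_eq t ht i j

theorem F_deriv {t : ℝ} (ht : 0 ≤ t) :
    MDeriv (fun r => (v r).F) (Matrix.of ((v t).FRate C)) t :=
  fun i j => by simpa using h.F_eq t ht i j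

/-- The derivative of the scalar curvature along the evolution. -/
theorem R_deriv (hC : ∀ k i j, C k i j = -C k j i) {t : ℝ} (ht : 0 ≤ t) :
    HasDerivWithinAt (fun r => (v r).R C)
      (2 * ((v t).gi * ricMat C (v t) * ((v t).gi * (v t).k)).trace
        - 2 * ∑ i, ∑ j, (v t).gi i j
          * (traceForm C i * divMix C ((v t).gi * (v t).k) j)) (Set.Ici 0) t := by
  rw [← scalFormDeriv_eq hC (h.g_posDef t ht) (h.k_symm ht)]
  refine HasDerivWithinAt.congr (f := fun r => scalForm C (v r).g (v r).gi) ?_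
    (fun r hr => R_eq_scalForm hC (h.g_posDef r hr)) (R_eq_scalForm hC (h.g_posDef t ht))
  have hg := h.g_deriv ht
  have hi := h.gi_deriv ht
  set κ := (v t).gi * (v t).k * (v t).gi with hκ
  have tr1 (i l : Fin 3) := (((MDeriv.const (adMat C i) t).mul hi).mul
    (MDeriv.const (adMat C l)ᵀ t)).mul hg |>.trace
  have s1 := HasDerivWithinAt.fun_sum (u := Finset.univ) fun i _ =>
    HasDerivWithinAt.fun_sum (u := Finset.univ) fun l _ =>
      (hi i l).mul_const (traceForm C i * traceForm C l)
  have s2 := HasDerivWithinAt.fun_sum (u := Finset.univ) fun i _ =>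
    HasDerivWithinAt.fun_sum (u := Finset.univ) fun l _ => (hi i l).mul (tr1 i l)
  have s3 := HasDerivWithinAt.fun_sum (u := Finset.univ) fun i _ =>
    HasDerivWithinAt.fun_sum (u := Finset.univ) fun l _ =>
      (hi i l).mul_const (adMat C i * adMat C l).trace
  refine ((s1.neg.sub (s2.const_mul (1 / 4))).sub (s3.const_mul (1 / 2))).congr_deriv ?_
  simp only [scalFormDeriv, Matrix.zero_mul, Matrix.mul_zero, zero_add, add_zero,
    Matrix.mul_smul, Matrix.smul_mul, Matrix.trace_add, Matrix.trace_smul, smul_eq_mul,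
    Matrix.smul_apply, Finset.mul_sum, ← Finset.sum_sub_distrib, ← Finset.sum_add_distrib,
    ← Finset.sum_neg_distrib]
  exact Finset.sum_congr rfl fun i _ => Finset.sum_congr rfl fun l _ => by ring

/-- The rate of $F$ is skew in its indices because the structure constants are, so $F+F^T$ is
conserved. -/
theorem F_antisymm (hC : ∀ k i j, C k i j = -C k j i) (h0 : (v 0).F.transpose = -(v 0).F)
    {t : ℝ} (ht : 0 ≤ t) (i j : Fin 3) : (v t).F i j = -(v t).F j i := by
  have hd : ∀ r, 0 ≤ r →
      HasDerivWithinAt (fun r => (v r).F i j + (v r).F j i) 0 (Set.Ici 0) r := by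
    intro r hr
    refine ((h.F_eq r hr i j).add (h.F_eq r hr j i)).congr_deriv ?_
    simp only [State.FRate, fun k => hC k i j]
    rw [← Finset.sum_add_distrib]
    exact Finset.sum_eq_zero fun k _ => by ring
  have hconst := eq_initial_of_deriv_zero hd ht
  have h00 : (v 0).F j i = -(v 0).F i j := congrFun (congrFun h0 i) j
  linarith

end IsGlobalSolution

end Solution

/-! ### Raising and lowering indices -/

namespace State

/-- `g_ij u^i u^j`. -/
def uSq (s : State) : ℝ := ∑ i, ∑ j, s.g i j * s.u i * s.u j

/-- `k_ij u^i u^j`. -/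
def kuu (s : State) : ℝ := ∑ i, ∑ j, s.k i j * s.u i * s.u j

/-- `g_ij E^i u^j`. -/
def Eu (s : State) : ℝ := ∑ i, s.ELow i * s.u i

/-- `C^i_{ij} u^j`. -/
def divu (C : Fin 3 → Fin 3 → Fin 3 → ℝ) (s : State) : ℝ := ∑ j, traceForm C j * s.u j

/-- `C^m_{nj} u^n u_m`. -/
def Cuu (C : Fin 3 → Fin 3 → Fin 3 → ℝ) (s : State) (j : Fin 3) : ℝ :=
  ∑ n, ∑ l, C n l j * s.u l * s.uLow n

variable {s : State}

theorem lower_raise (hs : s.g.PosDef) (x : Fin 3 → ℝ) (j : Fin 3) :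
    ∑ i, s.g j i * ∑ l, s.gi i l * x l = x j := by
  have h : s.g *ᵥ (s.gi *ᵥ x) = x := by
    rw [Matrix.mulVec_mulVec, g_mul_gi hs, Matrix.one_mulVec]
  exact congrFun h j

theorem raise_lower (hs : s.g.PosDef) (x : Fin 3 → ℝ) (j : Fin 3) :
    ∑ i, s.gi j i * ∑ l, s.g i l * x l = x j := by
  have h : s.gi *ᵥ (s.g *ᵥ x) = x := by
    rw [Matrix.mulVec_mulVec, gi_mul_g hs, Matrix.one_mulVec]
  exact congrFun h j

theorem raise_uLow (hs : s.g.PosDef) (j : Fin 3) : ∑ i, s.gi j i * s.uLow i = s.u j :=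
  raise_lower hs s.u j

theorem raise_ELow (hs : s.g.PosDef) (j : Fin 3) : ∑ i, s.gi j i * s.ELow i = s.E j :=
  raise_lower hs s.E j

theorem uSq_eq (s : State) : s.uSq = ∑ i, s.u i * s.uLow i := by
  simp only [uSq, uLow, Finset.mul_sum]
  exact Finset.sum_congr rfl fun i _ => Finset.sum_congr rfl fun j _ => by ring

theorem uSq_nonneg (hs : s.g.PosDef) : 0 ≤ s.uSq := by
  have h := hs.posSemidef.dotProduct_mulVec_nonneg s.u
  rw [uSq_eq]
  simpa [dotProduct, Matrix.mulVec, uLow] using h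

theorem ESq_nonneg (hs : s.g.PosDef) : 0 ≤ s.ESq := by
  have h := hs.posSemidef.dotProduct_mulVec_nonneg s.E
  simpa [dotProduct, Matrix.mulVec, ELow, ESq] using h

theorem u0_sq (hs : s.g.PosDef) : s.u0 ^ 2 = 1 + s.uSq :=
  Real.sq_sqrt (show 0 ≤ 1 + s.uSq by linarith [uSq_nonneg hs])

theorem u0_pos (hs : s.g.PosDef) : 0 < s.u0 :=
  Real.sqrt_pos.2 (show 0 < 1 + s.uSq by linarith [uSq_nonneg hs])

theorem kMixed_eq (s : State) (i j : Fin 3) : s.kMixed i j = (s.gi * s.k) i j := rfl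

theorem H_eq (s : State) (hk : s.k.IsSymm) : s.H = (s.gi * s.k).trace := by
  simp only [H, Matrix.trace, Matrix.diag, Matrix.mul_apply]
  exact Finset.sum_congr rfl fun i _ => Finset.sum_congr rfl fun j _ => by rw [hk.apply]

theorem raise_eq (s : State) (a : Mat3) (i j : Fin 3) :
    s.raise a i j = (s.gi * a * s.giᵀ) i j := by
  simp only [raise, Matrix.mul_apply, Matrix.transpose_apply, Fin.sum_univ_three]
  ring

theorem raise_antisymm (s : State) {a : Mat3} (ha : ∀ i j, a i j = -a j i) (i j : Fin 3) :
    s.raise a i j = -s.raise a j i := by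
  simp only [raise]
  rw [Finset.sum_comm, ← Finset.sum_neg_distrib]
  refine Finset.sum_congr rfl fun l _ => ?_
  rw [← Finset.sum_neg_distrib]
  exact Finset.sum_congr rfl fun n _ => by rw [ha n l]; ring

/-- Contracting with $u^ju^k$ removes the skew term of the connection, and the remaining two
coincide. -/
theorem conn_mul_u_u {C : Fin 3 → Fin 3 → Fin 3 → ℝ} (hC : ∀ k i j, C k i j = -C k j i)
    (hs : s.g.PosDef) (i : Fin 3) :
    ∑ j, ∑ k, s.conn C i j k * s.u j * s.u k = -∑ l, s.gi i l * s.Cuu C l := by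
  have hd := diag_eq_zero hC
  simp only [conn, Cuu, uLow, Fin.sum_univ_three, (hd _).1, (hd _).2.1, (hd _).2.2, hC _ 1 0,
    hC _ 2 0, hC _ 2 1, g_symm hs 1 0, g_symm hs 2 0, g_symm hs 2 1]
  ring

theorem uRate_eq {C : Fin 3 → Fin 3 → Fin 3 → ℝ} (hC : ∀ k i j, C k i j = -C k j i)
    (hs : s.g.PosDef) (hF : ∀ i j, s.F i j = -s.F j i) (i : Fin 3) :
    s.uRate C i = (∑ l, s.gi i l * (2 * ∑ j, s.k l j * s.u j + s.Cuu C l / s.u0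
      - 4 * Real.pi * (s.e / s.ρ) * ((∑ j, s.F l j * s.u j) / s.u0)))
      - 4 * Real.pi * (s.e / s.ρ) * s.E i := by
  have e : ∑ j, ∑ l, s.gi i l * s.F j l * s.u j = -∑ l, s.gi i l * ∑ j, s.F l j * s.u j := by
    rw [Finset.sum_comm, ← Finset.sum_neg_distrib]
    refine Finset.sum_congr rfl fun l _ => ?_
    rw [Finset.mul_sum, ← Finset.sum_neg_distrib]
    exact Finset.sum_congr rfl fun j _ => by rw [hF j l]; ring
  rw [uRate, conn_mul_u_u hC hs, e]
  simp only [kMixed, Fin.sum_univ_three]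
  ring

theorem lower_uRate {C : Fin 3 → Fin 3 → Fin 3 → ℝ} (hC : ∀ k i j, C k i j = -C k j i)
    (hs : s.g.PosDef) (hF : ∀ i j, s.F i j = -s.F j i) (j : Fin 3) :
    ∑ i, s.g j i * s.uRate C i = 2 * ∑ i, s.k j i * s.u i + s.Cuu C j / s.u0
      - 4 * Real.pi * (s.e / s.ρ) * ((∑ i, s.F j i * s.u i) / s.u0)
      - 4 * Real.pi * (s.e / s.ρ) * s.ELow j := by
  simp only [uRate_eq hC hs hF]
  have e := lower_raise hs (fun l => 2 * ∑ j, s.k l j * s.u j + s.Cuu C l / s.u0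
      - 4 * Real.pi * (s.e / s.ρ) * ((∑ j, s.F l j * s.u j) / s.u0)) j
  rw [← e]
  simp only [mul_sub (s.g j _), Finset.sum_sub_distrib (f := fun i => s.g j i * ∑ l, _)]
  congr 1
  simp only [ELow, Finset.mul_sum]
  exact Finset.sum_congr rfl fun i _ => by ring

theorem sum_u_mul_Cuu {C : Fin 3 → Fin 3 → Fin 3 → ℝ} (hC : ∀ k i j, C k i j = -C k j i)
    (s : State) : ∑ j, s.u j * s.Cuu C j = 0 := by
  have hd := diag_eq_zero hC
  simp only [Cuu, Fin.sum_univ_three, (hd _).1, (hd _).2.1, (hd _).2.2, hC _ 1 0,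
    hC _ 2 0, hC _ 2 1]
  ring

theorem sum_u_mul_F_u (hF : ∀ i j, s.F i j = -s.F j i) :
    ∑ j, s.u j * ∑ i, s.F j i * s.u i = 0 := by
  have h0 : s.F 0 0 = 0 := by linarith [hF 0 0]
  have h1 : s.F 1 1 = 0 := by linarith [hF 1 1]
  have h2 : s.F 2 2 = 0 := by linarith [hF 2 2]
  simp only [Fin.sum_univ_three, hF 1 0, hF 2 0, hF 2 1, h0, h1, h2]
  ring

/-- The connection term and the magnetic force do no work, by skewness; only $k$ and the electric
force remain. -/
theorem sum_uLow_mul_uRate {C : Fin 3 → Fin 3 → Fin 3 → ℝ} (hC : ∀ k i j, C k i j = -C k j i)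
    (hs : s.g.PosDef) (hF : ∀ i j, s.F i j = -s.F j i) :
    ∑ i, s.uRate C i * s.uLow i = 2 * s.kuu - 4 * Real.pi * (s.e / s.ρ) * s.Eu := by
  have e1 : ∑ i, s.uRate C i * s.uLow i = ∑ j, s.u j * ∑ i, s.g j i * s.uRate C i := by
    simp only [uLow, Finset.mul_sum]
    rw [Finset.sum_comm]
    exact Finset.sum_congr rfl fun i _ => Finset.sum_congr rfl fun j _ => by
      rw [g_symm hs i j]; ring
  have e2 := sum_u_mul_Cuu hC s
  have e3 := sum_u_mul_F_u hF
  rw [e1]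
  simp only [lower_uRate hC hs hF]
  simp only [kuu, Eu, Fin.sum_univ_three] at e2 e3 ⊢
  linear_combination (1 / s.u0) * e2 - 4 * Real.pi * (s.e / s.ρ) / s.u0 * e3

theorem sum_traceForm_u (C : Fin 3 → Fin 3 → Fin 3 → ℝ) (s : State) :
    ∑ i, ∑ j, C i i j * s.u j = s.divu C := by
  simp only [divu, traceForm, Finset.sum_mul]
  exact Finset.sum_comm

theorem sum_traceForm_E (C : Fin 3 → Fin 3 → Fin 3 → ℝ) (s : State) :
    ∑ i, ∑ k, C i i k * s.E k = ∑ k, traceForm C k * s.E k := by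
  simp only [traceForm, Finset.sum_mul]
  exact Finset.sum_comm

theorem ERate_eq (C : Fin 3 → Fin 3 → Fin 3 → ℝ) (s : State) (i : Fin 3) :
    s.ERate C i = s.H * s.E i - (∑ k, traceForm C k * s.raise s.F k i)
      - (1 / 2) * (∑ j, ∑ k, C i j k * s.raise s.F j k) + 4 * Real.pi * s.e * s.u i := by
  rw [ERate]
  congr 3
  simp only [traceForm, Finset.sum_mul]
  exact Finset.sum_comm

end State

/-- The trace form is $-\operatorname{tr}\operatorname{ad}$ and commutators are traceless. -/
theorem IsLieConstants.traceForm_bracket {C : Fin 3 → Fin 3 → Fin 3 → ℝ} (hC : IsLieConstants C)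
    (j k : Fin 3) : ∑ i, traceForm C i * C i j k = 0 := by
  have h := congrArg Matrix.trace (hC.adMat_commutator j k)
  rw [Matrix.trace_sub, Matrix.trace_mul_comm, sub_self, Matrix.trace_sum] at h
  simp only [Matrix.trace_smul, smul_eq_mul] at h
  simp only [traceForm_eq hC.skew]
  rw [show ∑ i, -(adMat C i).trace * C i j k = -∑ i, C i j k * (adMat C i).trace by
    rw [← Finset.sum_neg_distrib]; exact Finset.sum_congr rfl fun i _ => by ring, ← h, neg_zero]

-- Velocity, densities and the Gauss law.

section Solution

variable {C : Fin 3 → Fin 3 → Fin 3 → ℝ} {m Λ : ℝ} {v : ℝ → State}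

namespace IsGlobalSolution

variable (h : IsGlobalSolution C m Λ v) (hC : IsLieConstants C)
  (hF : ∀ t, 0 ≤ t → ∀ i j, (v t).F i j = -(v t).F j i)
include h

theorem ELow_deriv {t : ℝ} (ht : 0 ≤ t) (j : Fin 3) :
    HasDerivWithinAt (fun r => (v r).ELow j)
      (∑ i, (-2 * (v t).k j i * (v t).E i + (v t).g j i * (v t).ERate C i)) (Set.Ici 0) t :=
  hasDerivWithinAt_sum_mul (fun i => h.g_eq t ht j i) (h.E_eq t ht)

include hC hF

/-- Lowering the index absorbs the $2k^i_ju^j$ term, since $\dot g=-2k$. -/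
theorem uLow_deriv {t : ℝ} (ht : 0 ≤ t) (j : Fin 3) :
    HasDerivWithinAt (fun r => (v r).uLow j)
      ((v t).Cuu C j / (v t).u0
      - 4 * Real.pi * ((v t).e / (v t).ρ) * ((∑ i, (v t).F j i * (v t).u i) / (v t).u0)
      - 4 * Real.pi * ((v t).e / (v t).ρ) * (v t).ELow j) (Set.Ici 0) t := by
  refine (hasDerivWithinAt_sum_mul (fun i => h.g_eq t ht j i) (h.u_eq t ht)).congr_deriv ?_
  rw [Finset.sum_add_distrib, State.lower_uRate hC.skew (h.g_posDef t ht) (hF t ht)]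
  simp only [Fin.sum_univ_three]
  ring

theorem uSq_deriv {t : ℝ} (ht : 0 ≤ t) :
    HasDerivWithinAt (fun r => (v r).uSq)
      (2 * (v t).kuu - 8 * Real.pi * ((v t).e / (v t).ρ) * (v t).Eu) (Set.Ici 0) t := by
  simp only [State.uSq_eq]
  refine (hasDerivWithinAt_sum_mul (h.u_eq t ht)
    (fun i => h.uLow_deriv hC hF ht i)).congr_deriv ?_
  rw [Finset.sum_add_distrib, State.sum_uLow_mul_uRate hC.skew (h.g_posDef t ht) (hF t ht)]
  have e2 := State.sum_u_mul_Cuu hC.skew (v t)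
  have e3 := State.sum_u_mul_F_u (hF t ht)
  simp only [State.Eu, Fin.sum_univ_three] at e2 e3 ⊢
  linear_combination (1 / (v t).u0) * e2 - 4 * Real.pi * ((v t).e / (v t).ρ) / (v t).u0 * e3

theorem u0_deriv {t : ℝ} (ht : 0 ≤ t) :
    HasDerivWithinAt (fun r => (v r).u0)
      (((v t).kuu - 4 * Real.pi * ((v t).e / (v t).ρ) * (v t).Eu) / (v t).u0)
      (Set.Ici 0) t := by
  have hp := State.u0_pos (h.g_posDef t ht)
  have h1 := ((h.uSq_deriv hC hF ht).const_add 1).sqrt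
    (by rw [← State.u0_sq (h.g_posDef t ht)]; positivity)
  refine h1.congr_deriv ?_
  change _ / (2 * (v t).u0) = _
  field_simp
  ring

/-- Continuity equation of the dust: the $k_{ij}u^iu^j$ and $E\cdot u$ terms in the rates of $\rho$
and $u^0$ cancel. -/
theorem rho_u0_deriv {t : ℝ} (ht : 0 ≤ t) :
    HasDerivWithinAt (fun r => (v r).ρ * (v r).u0)
      ((v t).ρ * ((v t).H * (v t).u0 - (v t).divu C)) (Set.Ici 0) t := by
  have hp := State.u0_pos (h.g_posDef t ht)
  have hρ := h.ρ_ne_zero t ht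
  refine ((h.ρ_eq t ht).mul (h.u0_deriv hC hF ht)).congr_deriv ?_
  rw [State.ρRate, State.densityCoeff, State.sum_traceForm_u]
  change (-((v t).kuu / (v t).u0 ^ 2 + (v t).divu C / (v t).u0 - (v t).H) * (v t).ρ
    + 4 * Real.pi * (v t).e * ((v t).Eu / (v t).u0 ^ 2)) * (v t).u0 + _ = _
  field_simp
  ring

theorem e_u0_deriv {t : ℝ} (ht : 0 ≤ t) :
    HasDerivWithinAt (fun r => (v r).e * (v r).u0)
      ((v t).e * ((v t).H * (v t).u0 - (v t).divu C)) (Set.Ici 0) t := by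
  have hp := State.u0_pos (h.g_posDef t ht)
  have hρ := h.ρ_ne_zero t ht
  refine ((h.e_eq t ht).mul (h.u0_deriv hC hF ht)).congr_deriv ?_
  rw [State.eRate, State.densityCoeff, State.sum_traceForm_u]
  change (-((v t).kuu / (v t).u0 ^ 2 + (v t).divu C / (v t).u0 - (v t).H) * (v t).e
    + 4 * Real.pi * ((v t).Eu / (v t).u0 ^ 2) * ((v t).e ^ 2 / (v t).ρ)) * (v t).u0 + _ = _
  field_simp
  ring

/-- The Gauss law is propagated by the evolution. -/
theorem electric_deriv {t : ℝ} (ht : 0 ≤ t) :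
    HasDerivWithinAt
      (fun r => (∑ i, ∑ k, C i i k * (v r).E k) + 4 * Real.pi * (v r).e * (v r).u0)
      ((v t).H * ((∑ i, ∑ k, C i i k * (v t).E k) + 4 * Real.pi * (v t).e * (v t).u0))
      (Set.Ici 0) t := by
  simp only [State.sum_traceForm_E, mul_assoc (4 * Real.pi)]
  refine ((HasDerivWithinAt.fun_sum (u := Finset.univ) fun k _ =>
    (h.E_eq t ht k).const_mul (traceForm C k)).add
    ((h.e_u0_deriv hC hF ht).const_mul (4 * Real.pi))).congr_deriv ?_
  have hr := (v t).raise_antisymm (hF t ht)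
  have r0 : (v t).raise (v t).F 0 0 = 0 := by linarith [hr 0 0]
  have r1 : (v t).raise (v t).F 1 1 = 0 := by linarith [hr 1 1]
  have r2 : (v t).raise (v t).F 2 2 = 0 := by linarith [hr 2 2]
  have e2 (j k : Fin 3) := hC.traceForm_bracket j k
  simp only [State.ERate_eq]
  generalize (v t).raise (v t).F = X at *
  simp only [State.divu, Fin.sum_univ_three, r0, r1, r2, hr 1 0, hr 2 0, hr 2 1] at e2 ⊢
  -- The trace form kills brackets, and the quadratic term in the trace form vanishes against the
  -- antisymmetric $F^{ki}$.
  linear_combination -(1 / 2) * (X 0 1 * e2 0 1 + X 0 2 * e2 0 2 + X 1 2 * e2 1 2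
    - X 0 1 * e2 1 0 - X 0 2 * e2 2 0 - X 1 2 * e2 2 1)

end IsGlobalSolution

end Solution

/-! ### The momentum constraint -/

section DivMix

variable (C : Fin 3 → Fin 3 → Fin 3 → ℝ)

theorem divMix_add (X Y : Mat3) (j : Fin 3) :
    divMix C (X + Y) j = divMix C X j + divMix C Y j := by
  simp only [divMix, Matrix.add_apply, mul_add, Finset.sum_add_distrib]
  ring

theorem divMix_smul (a : ℝ) (X : Mat3) (j : Fin 3) : divMix C (a • X) j = a * divMix C X j := by
  simp only [divMix, Matrix.smul_apply, smul_eq_mul, mul_sub, Finset.mul_sum]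
  congr 1
  · exact Finset.sum_congr rfl fun i _ => by ring
  · exact Finset.sum_congr rfl fun i _ => Finset.sum_congr rfl fun l _ => by ring

theorem divMix_sub (X Y : Mat3) (j : Fin 3) :
    divMix C (X - Y) j = divMix C X j - divMix C Y j := by
  rw [sub_eq_add_neg, divMix_add, ← neg_one_smul ℝ Y, divMix_smul]
  ring

theorem divMix_one (j : Fin 3) : divMix C 1 j = 0 := by
  simp [divMix, Matrix.one_apply, traceForm]

end DivMix

namespace State

variable {C : Fin 3 → Fin 3 → Fin 3 → ℝ} {m Λ : ℝ} {s : State}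

/-- In mixed components the divergence has constant coefficients and no metric. It follows from
$g^{il}\gamma^n_{li}=-g^{nk}C^i_{ik}$, and because the skew part of the connection vanishes against
the symmetric $k$. -/
theorem divk_eq (hC : ∀ k i j, C k i j = -C k j i) (hs : s.g.PosDef) (hk : s.k.IsSymm)
    (j : Fin 3) : s.divk C j = divMix C (s.gi * s.k) j := by
  have hgt : s.giᵀ = s.gi := by ext x y; exact gi_symm hs y x
  have e1 (n : Fin 3) : ∑ i, ∑ l, s.gi i l * s.conn C n l i
      = -∑ k, s.gi n k * traceForm C k := by
    have key (X : Mat3) : ∑ i, ∑ l, ∑ p, s.gi i l * (s.g l p * X p i) = X.trace := by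
      rw [show X.trace = (s.gi * s.g * X).trace by rw [gi_mul_g hs, Matrix.one_mul]]
      simp only [Matrix.trace, Matrix.diag, Matrix.mul_apply, Fin.sum_univ_three]
      ring
    have e (k : Fin 3) : ∑ i, ∑ l, s.gi i l
        * ∑ p, (-(C p i k) * s.g l p + C p k l * s.g i p + C p l i * s.g k p)
        = -2 * traceForm C k := by
      have k1 := key (Matrix.of fun p i => C p i k)
      have k2 : traceForm C k = (Matrix.of fun p i => C p i k).trace := rfl
      rw [k2, ← k1]
      have hd := diag_eq_zero hC
      simp only [Matrix.of_apply, Fin.sum_univ_three, gi_symm hs 1 0, gi_symm hs 2 0,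
        gi_symm hs 2 1, hC _ k 0, hC _ k 1, hC _ k 2, (hd _).1, (hd _).2.1, (hd _).2.2, hC _ 1 0,
        hC _ 2 0, hC _ 2 1]
      ring
    have e' : ∑ i, ∑ l, s.gi i l * s.conn C n l i = (1 / 2) * ∑ k, s.gi n k *
        ∑ i, ∑ l, s.gi i l
        * ∑ p, (-(C p i k) * s.g l p + C p k l * s.g i p + C p l i * s.g k p) := by
      obtain ⟨Y, hY⟩ : ∃ Y : Fin 3 → Fin 3 → Fin 3 → ℝ, ∀ i l k,
          ∑ p, (-(C p i k) * s.g l p + C p k l * s.g i p + C p l i * s.g k p) = Y i l k :=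
        ⟨_, fun _ _ _ => rfl⟩
      simp only [conn, hY]
      simp only [Fin.sum_univ_three]
      ring
    rw [e']
    simp only [e]
    simp only [Fin.sum_univ_three]
    ring
  have e2 : (connMat C s j * (s.gi * s.k)).trace = -(adMat C j * (s.gi * s.k)).trace := by
    rw [connMat_eq hC hs, Matrix.smul_mul, Matrix.trace_smul, Matrix.add_mul, Matrix.sub_mul,
      Matrix.neg_mul, Matrix.trace_add, Matrix.trace_sub, Matrix.trace_neg]
    have t1 : (s.gi * (adMat C j)ᵀ * s.g * (s.gi * s.k)).trace
        = (adMat C j * (s.gi * s.k)).trace := by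
      rw [show s.gi * (adMat C j)ᵀ * s.g * (s.gi * s.k)
        = s.gi * (adMat C j)ᵀ * (s.g * s.gi) * s.k by simp only [Matrix.mul_assoc],
        g_mul_gi hs, Matrix.mul_one, ← Matrix.trace_transpose, Matrix.transpose_mul,
        Matrix.transpose_mul, Matrix.transpose_transpose, hgt, hk.eq, Matrix.trace_mul_comm,
        Matrix.mul_assoc]
    have t2 : (s.gi * (∑ p, s.g j p • brMat C p) * (s.gi * s.k)).trace = 0 := by
      set B := ∑ p, s.g j p • brMat C p with hB
      have hBt : Bᵀ = -B := by
        ext x y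
        simp only [hB, brMat, Matrix.transpose_apply, Matrix.neg_apply, Matrix.smul_apply,
          Matrix.add_apply, Matrix.of_apply, smul_eq_mul, Fin.sum_univ_three, hC _ y x]
        ring
      have := Matrix.trace_transpose (s.gi * B * (s.gi * s.k))
      rw [Matrix.transpose_mul, Matrix.transpose_mul, Matrix.transpose_mul, hBt, hgt, hk.eq,
        Matrix.neg_mul, Matrix.mul_neg, Matrix.trace_neg] at this
      have e3 : (s.k * s.gi * (B * s.gi)).trace = (s.gi * B * (s.gi * s.k)).trace := by
        rw [Matrix.mul_assoc, Matrix.trace_mul_comm, Matrix.mul_assoc, Matrix.mul_assoc,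
          Matrix.mul_assoc]
      linarith
    rw [t1, t2, smul_eq_mul]
    ring
  rw [divMix_eq hC, ← neg_neg (adMat C j * (s.gi * s.k)).trace, ← e2]
  have e3 : ∑ n, traceForm C n * (s.gi * s.k) n j
      = -∑ n, (∑ i, ∑ l, s.gi i l * s.conn C n l i) * s.k n j := by
    simp only [e1]
    simp only [Matrix.mul_apply, Fin.sum_univ_three, gi_symm hs 1 0, gi_symm hs 2 0,
      gi_symm hs 2 1]
    ring
  rw [e3]
  simp only [divk, connMat, Matrix.trace, Matrix.diag, Matrix.mul_apply, Matrix.of_apply]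
  generalize s.conn C = Γ
  simp only [Fin.sum_univ_three, gi_symm hs 1 0, gi_symm hs 2 0, gi_symm hs 2 1, hk.apply 0 1,
    hk.apply 0 2, hk.apply 1 2]
  ring

/-- The spatial stress tensor of the electromagnetic field and of the dust, with mixed
components. -/
def matterMix (s : State) : Mat3 :=
  ((1 / 2) * s.ESq - (1 / 4) * s.normSq s.F) • (1 : Mat3) - Matrix.vecMulVec s.E s.ELow
    + Matrix.of (s.raise s.F) * s.Fᵀ + s.ρ • Matrix.vecMulVec s.u s.uLow

theorem gi_mul_matter (hs : s.g.PosDef) :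
    s.gi * Matrix.of (fun i j => s.τ i j + s.ρ * s.uLow i * s.uLow j) = s.matterMix := by
  have e : (Matrix.of (fun i j => s.τ i j + s.ρ * s.uLow i * s.uLow j) : Mat3)
      = ((1 / 2) * s.ESq - (1 / 4) * s.normSq s.F) • s.g - Matrix.vecMulVec s.ELow s.ELow
        + s.F * s.gi * s.Fᵀ + s.ρ • Matrix.vecMulVec s.uLow s.uLow := by
    ext i j
    simp only [τ, Matrix.of_apply, Matrix.add_apply, Matrix.sub_apply, Matrix.smul_apply,
      smul_eq_mul, Matrix.vecMulVec_apply, Matrix.mul_apply, Matrix.transpose_apply,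
      Fin.sum_univ_three]
    ring
  have hgt : s.giᵀ = s.gi := by ext x y; exact gi_symm hs y x
  have hX : (Matrix.of (s.raise s.F) : Mat3) = s.gi * s.F * s.gi := by
    ext i j
    rw [Matrix.of_apply, raise_eq, hgt]
  rw [e, matterMix, hX]
  simp only [Matrix.mul_add, Matrix.mul_sub, Matrix.mul_smul, gi_mul_g hs, Matrix.mul_vecMulVec,
    ← Matrix.mul_assoc]
  rw [show s.gi *ᵥ s.ELow = s.E from funext (raise_ELow hs),
    show s.gi *ᵥ s.uLow = s.u from funext (raise_uLow hs)]

/-- Since $g^{lm}g_{lm}=3$ and $(u^0)^2=1+u_iu^i$, both $U$ and the kinetic part of the dust drop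
out of the coefficient of $g$. -/
theorem kRate_eq (hs : s.g.PosDef) :
    (Matrix.of (s.kRate C m Λ) : Mat3) = ricMat C s + s.H • s.k - (2 : ℝ) • (s.k * (s.gi * s.k))
      - (8 * Real.pi) • Matrix.of (fun i j => s.τ i j + s.ρ * s.uLow i * s.uLow j)
      + (-(4 * Real.pi * m ^ 2 * s.Φ ^ 2) - 4 * Real.pi * s.ρ - Λ) • s.g := by
  have e : ∑ l, ∑ n, s.gi l n * (s.T m l n + s.ρ * s.uLow l * s.uLow n)
      = 3 * (s.U - (1 / 2) * m ^ 2 * s.Φ ^ 2) + s.ρ * s.uSq := by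
    have e1 : ∑ l, ∑ n, s.gi l n * s.g l n = 3 := by
      have h := congrArg Matrix.trace (gi_mul_g hs)
      simp only [Matrix.trace, Matrix.diag, Matrix.mul_apply] at h
      rw [show ∑ l, ∑ n, s.gi l n * s.g l n = ∑ l, ∑ n, s.gi l n * s.g n l from
        Finset.sum_congr rfl fun l _ => Finset.sum_congr rfl fun n _ => by rw [g_symm hs], h]
      simp
    have e2 : s.uSq = ∑ l, s.uLow l * ∑ n, s.gi l n * s.uLow n := by
      simp only [raise_uLow hs, uSq_eq, mul_comm]
    rw [e2]
    simp only [T, Fin.sum_univ_three] at e1 ⊢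
    linear_combination (s.U - (1 / 2) * m ^ 2 * s.Φ ^ 2) * e1
  have hu := u0_sq hs
  ext i j
  simp only [Matrix.of_apply, kRate, e]
  simp only [Matrix.of_apply, Matrix.add_apply, Matrix.sub_apply, Matrix.smul_apply,
    smul_eq_mul, ricMat, T, T00, hu]
  have e3 : ∑ l, s.kMixed l j * s.k i l = (s.k * (s.gi * s.k)) i j := by
    rw [Matrix.mul_apply]
    exact Finset.sum_congr rfl fun l _ => by rw [kMixed_eq, mul_comm]
  rw [e3]
  ring

end State

-- Evolution of the mixed second fundamental form and of its divergence.

section Solution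

variable {C : Fin 3 → Fin 3 → Fin 3 → ℝ} {m Λ : ℝ} {v : ℝ → State}

namespace IsGlobalSolution

variable (h : IsGlobalSolution C m Λ v)
include h

/-- Raising an index removes the quadratic term $-2k^l_jk_{il}$, which cancels against the
derivative of $g^{-1}$. -/
theorem kMixed_deriv {t : ℝ} (ht : 0 ≤ t) :
    MDeriv (fun r => (v r).gi * (v r).k) ((v t).H • ((v t).gi * (v t).k)
      + (v t).gi * ricMat C (v t) - (8 * Real.pi) • (v t).matterMix
      + (-(4 * Real.pi * m ^ 2 * (v t).Φ ^ 2) - 4 * Real.pi * (v t).ρ - Λ) • (1 : Mat3)) t := by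
  have h1 := (h.gi_deriv ht).mul (h.k_deriv ht)
  have hs := h.g_posDef t ht
  rw [State.kRate_eq hs] at h1
  convert h1 using 1
  rw [← State.gi_mul_matter hs]
  simp only [Matrix.mul_add, Matrix.mul_sub, Matrix.mul_smul, Matrix.smul_mul, State.gi_mul_g hs,
    Matrix.mul_assoc]
  abel

/-- `divMix` is linear with time-independent coefficients, kills the identity, and kills Ricci by
the contracted Bianchi identity. -/
theorem divk_deriv (hC : IsLieConstants C) {t : ℝ} (ht : 0 ≤ t) (j : Fin 3) :
    HasDerivWithinAt (fun r => (v r).divk C j)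
      ((v t).H * (v t).divk C j - 8 * Real.pi * divMix C (v t).matterMix j) (Set.Ici 0) t := by
  have hs := h.g_posDef t ht
  have hK := h.kMixed_deriv ht
  set K' := (v t).H • ((v t).gi * (v t).k) + (v t).gi * ricMat C (v t)
      - (8 * Real.pi) • (v t).matterMix
      + (-(4 * Real.pi * m ^ 2 * (v t).Φ ^ 2) - 4 * Real.pi * (v t).ρ - Λ) • (1 : Mat3) with hK'
  have e : (v t).H * (v t).divk C j - 8 * Real.pi * divMix C (v t).matterMix j
      = divMix C K' j := by
    rw [hK', divMix_add, divMix_sub, divMix_add, divMix_smul,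
      divMix_smul, divMix_smul, divMix_one, divMix_ricMat hC hs,
      State.divk_eq hC.skew hs (h.k_symm ht)]
    ring
  rw [e]
  refine HasDerivWithinAt.congr (f := fun r => divMix C ((v r).gi * (v r).k) j) ?_
    (fun r hr => State.divk_eq hC.skew (h.g_posDef r hr) (h.k_symm hr) j)
    (State.divk_eq hC.skew hs (h.k_symm ht) j)
  simp only [divMix]
  exact (HasDerivWithinAt.fun_sum fun n _ => (hK n j).const_mul _).sub
    (HasDerivWithinAt.fun_sum fun p _ => HasDerivWithinAt.fun_sum fun n _ =>
      (hK n p).const_mul _)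

end IsGlobalSolution

end Solution

-- Magnetic and momentum constraints.

section Solution

variable {C : Fin 3 → Fin 3 → Fin 3 → ℝ} {m Λ : ℝ} {v : ℝ → State}

namespace IsGlobalSolution

variable (h : IsGlobalSolution C m Λ v) (hC : IsLieConstants C)
  (hF : ∀ t, 0 ≤ t → ∀ i j, (v t).F i j = -(v t).F j i)
include h hC

/-- The magnetic constraint is constant in time. -/
theorem magnetic_deriv {t : ℝ} (ht : 0 ≤ t) (i j k : Fin 3) :
    HasDerivWithinAt (fun r => ∑ l, (C l i j * (v r).F k l + C l k i * (v r).F j l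
      + C l j k * (v r).F i l)) 0 (Set.Ici 0) t := by
  refine (HasDerivWithinAt.fun_sum (u := Finset.univ) fun l _ =>
    (((h.F_eq t ht k l).const_mul (C l i j)).add ((h.F_eq t ht j l).const_mul (C l k i))).add
    ((h.F_eq t ht i l).const_mul (C l j k))).congr_deriv ?_
  have e : ∑ n, (v t).ELow n
      * ∑ l, (C l i j * C n k l + C l k i * C n j l + C l j k * C n i l) = 0 :=
    Finset.sum_eq_zero fun n _ => by rw [hC.jacobi, mul_zero]
  rw [← e]
  simp only [State.FRate, Fin.sum_univ_three]
  ring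

include hF

theorem rho_u0_uLow_deriv {t : ℝ} (ht : 0 ≤ t) (j : Fin 3) :
    HasDerivWithinAt (fun r => (v r).ρ * (v r).u0 * (v r).uLow j)
      ((v t).H * ((v t).ρ * (v t).u0 * (v t).uLow j) - (v t).ρ * (v t).divu C * (v t).uLow j
        + (v t).ρ * (v t).Cuu C j - 4 * Real.pi * (v t).e * (∑ i, (v t).F j i * (v t).u i)
        - 4 * Real.pi * (v t).e * (v t).u0 * (v t).ELow j) (Set.Ici 0) t := by
  have hp := State.u0_pos (h.g_posDef t ht)
  have hρ := h.ρ_ne_zero t ht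
  refine ((h.rho_u0_deriv hC hF ht).mul (h.uLow_deriv hC hF ht j)).congr_deriv ?_
  generalize ∑ i, (v t).F j i * (v t).u i = y
  field_simp
  ring

/-- The divergence of the matter stress balances the Poynting and dust momenta, up to the Gauss
defect times $E_j$ and the magnetic defect contracted with $F^{pq}$. Hence the equation becomes
homogeneous once those two constraints hold. -/
theorem momentum_deriv {t : ℝ} (ht : 0 ≤ t) (j : Fin 3) :
    HasDerivWithinAt (fun r => (v r).divk C j
        + 8 * Real.pi * ((v r).τ0 j - (v r).ρ * (v r).u0 * (v r).uLow j))
      ((v t).H * ((v t).divk C j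
        + 8 * Real.pi * ((v t).τ0 j - (v t).ρ * (v t).u0 * (v t).uLow j))
        + 8 * Real.pi * (v t).ELow j
          * ((∑ i, ∑ k, C i i k * (v t).E k) + 4 * Real.pi * (v t).e * (v t).u0)
        + 4 * Real.pi * ∑ p, ∑ q, (v t).raise (v t).F p q
          * ∑ l, (C l p q * (v t).F j l + C l j p * (v t).F q l + C l q j * (v t).F p l))
      (Set.Ici 0) t := by
  have hτ := (hasDerivWithinAt_sum_mul (h.E_eq t ht) (h.F_eq t ht j)).neg
  refine ((h.divk_deriv hC ht j).add ((hτ.sub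
    (h.rho_u0_uLow_deriv hC hF ht j)).const_mul (8 * Real.pi))).congr_deriv ?_
  have hr := (v t).raise_antisymm (hF t ht)
  have r0 : (v t).raise (v t).F 0 0 = 0 := by linarith [hr 0 0]
  have r1 : (v t).raise (v t).F 1 1 = 0 := by linarith [hr 1 1]
  have r2 : (v t).raise (v t).F 2 2 = 0 := by linarith [hr 2 2]
  have f := hF t ht
  have f0 : (v t).F 0 0 = 0 := by linarith [f 0 0]
  have f1 : (v t).F 1 1 = 0 := by linarith [f 1 1]
  have f2 : (v t).F 2 2 = 0 := by linarith [f 2 2]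
  have hd := diag_eq_zero hC.skew
  have hc := hC.skew
  simp only [State.matterMix, divMix_add, divMix_sub, divMix_smul, divMix_one, State.ERate_eq,
    State.sum_traceForm_E, State.τ0, State.FRate, State.divu, State.Cuu]
  generalize (v t).raise (v t).F = X at *
  generalize (v t).divk C j = dk
  simp only [divMix, Matrix.vecMulVec_apply, Matrix.mul_apply, Matrix.of_apply,
    Matrix.transpose_apply]
  fin_cases j <;>
  simp only [traceForm, Fin.sum_univ_three, r0, r1, r2, f0, f1, f2, hr 1 0, hr 2 0, hr 2 1, f 1 0,
    f 2 0, f 2 1, (hd _).1, (hd _).2.1, (hd _).2.2, hc _ 1 0, hc _ 2 0, hc _ 2 1, Fin.zero_eta,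
    Fin.mk_one, Fin.reduceFinMk] <;>
  ring

end IsGlobalSolution

end Solution

/-! ### The Hamiltonian constraint -/

namespace State

variable {s : State}

theorem raise_mul_ELow (hs : s.g.PosDef) (k : Fin 3) :
    ∑ i, s.raise s.F k i * s.ELow i = -∑ j, s.gi k j * s.τ0 j := by
  have e (l : Fin 3) : ∑ n, s.F l n * ∑ i, s.gi n i * s.ELow i = -s.τ0 l := by
    simp only [raise_ELow hs, τ0, neg_neg]
    exact Finset.sum_congr rfl fun n _ => mul_comm _ _
  have e' : ∑ i, s.raise s.F k i * s.ELow i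
      = ∑ l, s.gi k l * ∑ n, s.F l n * ∑ i, s.gi n i * s.ELow i := by
    simp only [raise, Fin.sum_univ_three, gi_symm hs 1 0, gi_symm hs 2 0, gi_symm hs 2 1]
    ring
  rw [e']
  simp only [e, mul_neg, Finset.sum_neg_distrib]

theorem g_mul_kMixed (hs : s.g.PosDef) : s.g * (s.gi * s.k) = s.k := by
  rw [← Matrix.mul_assoc, g_mul_gi hs, Matrix.one_mul]

theorem trace_vecMulVec_kMixed (hs : s.g.PosDef) (x : Fin 3 → ℝ) :
    (Matrix.vecMulVec x (s.g *ᵥ x) * (s.gi * s.k)).trace = ∑ i, ∑ j, s.k i j * x i * x j := by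
  rw [Matrix.vecMulVec_mul, Matrix.trace_vecMulVec,
    show (s.g *ᵥ x) ᵥ* (s.gi * s.k) = x ᵥ* s.k by
      rw [show s.g *ᵥ x = x ᵥ* s.g from by
        ext i
        simp only [Matrix.mulVec, Matrix.vecMul, dotProduct]
        exact Finset.sum_congr rfl fun j _ => by rw [g_symm hs i j, mul_comm],
        Matrix.vecMul_vecMul, g_mul_kMixed hs]]
  simp only [dotProduct, Matrix.vecMul, Finset.mul_sum]
  rw [Finset.sum_comm]
  exact Finset.sum_congr rfl fun i _ => Finset.sum_congr rfl fun j _ => by ring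

theorem normSq_k_eq (hs : s.g.PosDef) (hk : s.k.IsSymm) :
    s.normSq s.k = (s.gi * s.k * (s.gi * s.k)).trace := by
  simp only [normSq, raise, Matrix.trace, Matrix.diag, Matrix.mul_apply, Fin.sum_univ_three,
    gi_symm hs 1 0, gi_symm hs 2 0, gi_symm hs 2 1, hk.apply 0 1, hk.apply 0 2, hk.apply 1 2]
  ring

theorem normSq_F_eq (s : State) :
    s.normSq s.F = (Matrix.of (s.raise s.F) * s.Fᵀ).trace := by
  simp only [normSq, Matrix.trace, Matrix.diag, Matrix.mul_apply, Matrix.of_apply,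
    Matrix.transpose_apply]
  exact Finset.sum_congr rfl fun i _ => Finset.sum_congr rfl fun j _ => mul_comm _ _

/-- The spacetime stress tensor of the electromagnetic field is trace-free, so its spatial trace is
its energy density: $3(\tfrac12E^2-\tfrac14F^2)-E^2+F^2$. -/
theorem trace_matterMix (s : State) : s.matterMix.trace = s.τ00 + s.ρ * s.uSq := by
  have e1 : (Matrix.vecMulVec s.E s.ELow).trace = s.ESq := by
    rw [Matrix.trace_vecMulVec]; rfl
  have e2 : (Matrix.vecMulVec s.u s.uLow).trace = s.uSq := by
    rw [Matrix.trace_vecMulVec, uSq_eq]; rfl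
  rw [matterMix, Matrix.trace_add, Matrix.trace_add, Matrix.trace_sub, Matrix.trace_smul,
    Matrix.trace_smul, e1, e2, ← normSq_F_eq, Matrix.trace_one, τ00]
  simp
  ring

theorem trace_matterMix_mul (hs : s.g.PosDef) (hk : s.k.IsSymm) :
    (s.matterMix * (s.gi * s.k)).trace = ((1 / 2) * s.ESq - (1 / 4) * s.normSq s.F) * s.H
      - (∑ i, ∑ j, s.k i j * s.E i * s.E j)
      + (Matrix.of (s.raise s.F) * s.Fᵀ * (s.gi * s.k)).trace + s.ρ * s.kuu := by
  rw [matterMix, Matrix.add_mul, Matrix.add_mul, Matrix.sub_mul, Matrix.trace_add,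
    Matrix.trace_add, Matrix.trace_sub, Matrix.smul_mul, Matrix.smul_mul, Matrix.trace_smul,
    Matrix.trace_smul, Matrix.one_mul, ← H_eq s hk]
  rw [show s.ELow = s.g *ᵥ s.E from rfl, show s.uLow = s.g *ᵥ s.u from rfl,
    trace_vecMulVec_kMixed hs, trace_vecMulVec_kMixed hs]
  rfl

end State

-- Energy balance and the Hamiltonian constraint.

section Solution

variable {C : Fin 3 → Fin 3 → Fin 3 → ℝ} {m Λ : ℝ} {v : ℝ → State}

namespace IsGlobalSolution

variable (h : IsGlobalSolution C m Λ v) (hC : IsLieConstants C)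
  (hF : ∀ t, 0 ≤ t → ∀ i j, (v t).F i j = -(v t).F j i)
include h

theorem T00_deriv {t : ℝ} (ht : 0 ≤ t) :
    HasDerivWithinAt (fun r => (v r).T00 m) (2 * (v t).H * (v t).U) (Set.Ici 0) t := by
  refine ((h.U_eq t ht).add (((h.Φ_eq t ht).pow 2).const_mul
    ((1 / 2) * m ^ 2))).congr_deriv ?_
  simp only [State.URate]
  push_cast
  ring

theorem ESq_deriv {t : ℝ} (ht : 0 ≤ t) :
    HasDerivWithinAt (fun r => (v r).ESq) (2 * (∑ i, (v t).ERate C i * (v t).ELow i)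
      - 2 * ∑ i, ∑ j, (v t).k i j * (v t).E i * (v t).E j) (Set.Ici 0) t := by
  refine (hasDerivWithinAt_sum_mul (h.E_eq t ht) (h.ELow_deriv ht)).congr_deriv ?_
  have hs := h.g_posDef t ht
  generalize (v t).ERate C = E'
  simp only [State.ELow, Fin.sum_univ_three, State.g_symm hs 1 0, State.g_symm hs 2 0,
    State.g_symm hs 2 1]
  ring

theorem H_deriv {t : ℝ} (ht : 0 ≤ t) :
    HasDerivWithinAt (fun r => (v r).H) ((v t).H ^ 2 + (v t).R C
      - 8 * Real.pi * ((v t).τ00 + (v t).ρ * (v t).uSq)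
      + 3 * (-(4 * Real.pi * m ^ 2 * (v t).Φ ^ 2) - 4 * Real.pi * (v t).ρ - Λ))
      (Set.Ici 0) t := by
  refine HasDerivWithinAt.congr (f := fun r => ((v r).gi * (v r).k).trace) ?_
    (fun r hr => (v r).H_eq (h.k_symm hr)) ((v t).H_eq (h.k_symm ht))
  refine (h.kMixed_deriv ht).trace.congr_deriv ?_
  have hR : ((v t).gi * ricMat C (v t)).trace = (v t).R C := by
    simp only [State.R, Matrix.trace, Matrix.diag, Matrix.mul_apply, ricMat, Matrix.of_apply]
    rw [Finset.sum_comm]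
    exact Finset.sum_congr rfl fun i _ => Finset.sum_congr rfl fun j _ => by
      rw [State.gi_symm (h.g_posDef t ht)]
  rw [Matrix.trace_add, Matrix.trace_sub, Matrix.trace_add, Matrix.trace_smul, Matrix.trace_smul,
    Matrix.trace_smul, ← (v t).H_eq (h.k_symm ht), hR, State.trace_matterMix, Matrix.trace_one]
  simp only [smul_eq_mul, Fintype.card_fin]
  push_cast
  ring

theorem H_continuousOn : ContinuousOn (fun r => (v r).H) (Set.Ici 0) :=
  fun _ ht => (h.H_deriv ht).continuousWithinAt

include hF in
theorem normSq_F_deriv {t : ℝ} (ht : 0 ≤ t) :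
    HasDerivWithinAt (fun r => (v r).normSq (v r).F)
      (2 * (∑ i, ∑ j, (v t).FRate C i j * (v t).raise (v t).F i j)
        + 4 * (Matrix.of ((v t).raise (v t).F) * (v t).Fᵀ * ((v t).gi * (v t).k)).trace)
      (Set.Ici 0) t := by
  have hs := h.g_posDef t ht
  have hX : MDeriv (fun r => (v r).gi * (v r).F * (v r).giᵀ) _ t :=
    ((h.gi_deriv ht).mul (h.F_deriv ht)).mul (h.gi_deriv ht).transpose
  simp only [State.normSq, State.raise_eq]
  refine (HasDerivWithinAt.fun_sum (u := Finset.univ) fun i _ =>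
    HasDerivWithinAt.fun_sum (u := Finset.univ) fun j _ =>
      (h.F_eq t ht i j).mul (hX i j)).congr_deriv ?_
  have hgt : (v t).giᵀ = (v t).gi := by ext x y; exact State.gi_symm hs y x
  have hkt : (v t).kᵀ = (v t).k := (h.k_symm ht).eq
  have hFt : (v t).Fᵀ = -(v t).F := by ext x y; exact hF t ht y x
  set F' : Mat3 := Matrix.of ((v t).FRate C) with hF'
  have hF'' (i j : Fin 3) : (v t).FRate C i j = F' i j := rfl
  simp only [hF'']
  have key (A B : Mat3) : ∑ i, ∑ j, A i j * B i j = (A * Bᵀ).trace := rfl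
  simp only [Finset.sum_add_distrib, key]
  have hraise : (Matrix.of ((v t).raise (v t).F) : Mat3)
      = (v t).gi * (v t).F * (v t).gi := by
    ext i j; rw [Matrix.of_apply, State.raise_eq, hgt]
  rw [hraise]
  simp only [hgt, Matrix.transpose_smul, Matrix.transpose_mul, Matrix.transpose_add, hkt, hFt,
    Matrix.add_mul, Matrix.smul_mul, Matrix.mul_smul, Matrix.mul_add, Matrix.trace_add,
    Matrix.trace_smul, Matrix.mul_neg, Matrix.neg_mul, Matrix.trace_neg, smul_eq_mul,
    smul_neg]
  -- The derivatives of the two inverse metrics give the same trace, and the two derivatives of $F$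
  -- agree by antisymmetry.
  have t1 : ((v t).F * ((v t).gi * ((v t).F * ((v t).gi * ((v t).k * (v t).gi))))).trace
      = ((v t).gi * (v t).F * (v t).gi * (v t).F * ((v t).gi * (v t).k)).trace := by
    rw [show (v t).F * ((v t).gi * ((v t).F * ((v t).gi * ((v t).k * (v t).gi))))
      = (v t).F * (v t).gi * (v t).F * (v t).gi * (v t).k * (v t).gi by
        simp only [Matrix.mul_assoc], Matrix.trace_mul_comm]
    simp only [Matrix.mul_assoc]
  have t2 : ((v t).F * ((v t).gi * (v t).k * (v t).gi * ((v t).F * (v t).gi))).trace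
      = ((v t).gi * (v t).F * (v t).gi * (v t).F * ((v t).gi * (v t).k)).trace := by
    rw [show (v t).F * ((v t).gi * (v t).k * (v t).gi * ((v t).F * (v t).gi))
      = (v t).F * (v t).gi * (v t).k * ((v t).gi * (v t).F * (v t).gi) by
        simp only [Matrix.mul_assoc], Matrix.trace_mul_comm]
    simp only [Matrix.mul_assoc]
  have t3 : ((v t).F * ((v t).gi * (F'ᵀ * (v t).gi))).trace
      = -(F' * ((v t).gi * ((v t).F * (v t).gi))).trace := by
    rw [← Matrix.trace_transpose]
    simp only [Matrix.transpose_mul, hgt, hFt, Matrix.transpose_transpose, Matrix.mul_neg,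
      Matrix.trace_neg, Matrix.mul_assoc]
    rw [Matrix.trace_mul_comm (v t).gi]
    simp only [Matrix.mul_assoc]
  rw [t1, t2, t3]
  ring

include hC hF

/-- Balance of the energy of the electromagnetic field and of the dust. -/
theorem energy_deriv {t : ℝ} (ht : 0 ≤ t) :
    HasDerivWithinAt (fun r => (v r).τ00 + (v r).ρ * (v r).u0 ^ 2)
      ((v t).H * ((v t).τ00 + (v t).ρ * (v t).u0 ^ 2)
        + ((v t).matterMix * ((v t).gi * (v t).k)).trace
        + ∑ i, ∑ j, (v t).gi i j * (traceForm C i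
          * ((v t).τ0 j - (v t).ρ * (v t).u0 * (v t).uLow j))) (Set.Ici 0) t := by
  have hs := h.g_posDef t ht
  have hp := State.u0_pos hs
  have hρ := h.ρ_ne_zero t ht
  have d1 := ((h.ESq_deriv ht).const_mul (1 / 2)).add ((h.normSq_F_deriv hF ht).const_mul (1 / 4))
  have d2 := (h.rho_u0_deriv hC hF ht).mul (h.u0_deriv hC hF ht)
  have e0 (r : ℝ) : (v r).ρ * (v r).u0 ^ 2 = (v r).ρ * (v r).u0 * (v r).u0 := by ring
  simp only [e0]
  refine (d1.add d2).congr_deriv ?_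
  -- The power consists of dilution, the Poynting flux, the exchange with the magnetic energy and
  -- the Joule term. The last two cancel against the rates of $\tfrac14F^{ij}F_{ij}$ and of the dust
  -- energy.
  have hE : ∑ i, (v t).ERate C i * (v t).ELow i = (v t).H * (v t).ESq
      + ∑ i, ∑ j, (v t).gi i j * (traceForm C i * (v t).τ0 j)
      - (1 / 2) * (∑ i, ∑ j, (v t).FRate C i j * (v t).raise (v t).F i j)
      + 4 * Real.pi * (v t).e * (v t).Eu := by
    have e1 : ∑ k, traceForm C k * ∑ i, (v t).raise (v t).F k i * (v t).ELow i
        = -∑ i, ∑ j, (v t).gi i j * (traceForm C i * (v t).τ0 j) := by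
      simp only [State.raise_mul_ELow hs, Fin.sum_univ_three]
      ring
    rw [← neg_eq_iff_eq_neg.2 e1]
    simp only [State.ERate_eq, State.FRate, State.ESq, State.Eu]
    generalize (v t).raise (v t).F = X
    simp only [Fin.sum_univ_three]
    ring
  have hu : ∑ i, ∑ j, (v t).gi i j * (traceForm C i
      * ((v t).τ0 j - (v t).ρ * (v t).u0 * (v t).uLow j))
      = ∑ i, ∑ j, (v t).gi i j * (traceForm C i * (v t).τ0 j)
        - (v t).ρ * (v t).u0 * (v t).divu C := by
    have e1 : (v t).divu C = ∑ i, traceForm C i * ∑ j, (v t).gi i j * (v t).uLow j := by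
      simp only [State.raise_uLow hs]; rfl
    rw [e1]
    simp only [Fin.sum_univ_three]
    ring
  rw [hE, hu, State.trace_matterMix_mul hs (h.k_symm ht), State.τ00]
  generalize ∑ i, ∑ j, (v t).gi i j * (traceForm C i * (v t).τ0 j) = x1
  generalize ∑ i, ∑ j, (v t).FRate C i j * (v t).raise (v t).F i j = x2
  generalize (Matrix.of ((v t).raise (v t).F) * (v t).Fᵀ * ((v t).gi * (v t).k)).trace = x3
  generalize ∑ i, ∑ j, (v t).k i j * (v t).E i * (v t).E j = x4
  field_simp
  ring

/-- The Ricci term in $\dot R$ cancels the one in the derivative of $k_{ij}k^{ij}$, and the matter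
work term cancels through the energy balance. What is left is $2H$ times the defect and a divergence
of the momentum defect. -/
theorem hamiltonian_deriv {t : ℝ} (ht : 0 ≤ t) :
    HasDerivWithinAt (fun r => (v r).R C - (v r).normSq (v r).k + (v r).H ^ 2
        - 16 * Real.pi * ((v r).T00 m + ((v r).τ00 + (v r).ρ * (v r).u0 ^ 2)) - 2 * Λ)
      (2 * (v t).H * ((v t).R C - (v t).normSq (v t).k + (v t).H ^ 2
        - 16 * Real.pi * ((v t).T00 m + ((v t).τ00 + (v t).ρ * (v t).u0 ^ 2)) - 2 * Λ)
        - 2 * ∑ i, ∑ j, (v t).gi i j * (traceForm C i * ((v t).divk C j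
          + 8 * Real.pi * ((v t).τ0 j - (v t).ρ * (v t).u0 * (v t).uLow j)))) (Set.Ici 0) t := by
  have hs := h.g_posDef t ht
  have hK := h.kMixed_deriv ht
  have dk : HasDerivWithinAt (fun r => (v r).normSq (v r).k) _ (Set.Ici 0) t :=
    ((hK.mul hK).trace).congr
      (fun r hr => State.normSq_k_eq (h.g_posDef r hr) (h.k_symm hr))
      (State.normSq_k_eq hs (h.k_symm ht))
  refine (((((h.R_deriv hC.skew ht).sub dk).add ((h.H_deriv ht).pow 2)).sub
    (((h.T00_deriv ht).add (h.energy_deriv hC hF ht)).const_mul (16 * Real.pi))).sub_const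
    (2 * Λ)).congr_deriv ?_
  have e1 : ∑ i, ∑ j, (v t).gi i j * (traceForm C i * ((v t).divk C j
        + 8 * Real.pi * ((v t).τ0 j - (v t).ρ * (v t).u0 * (v t).uLow j)))
      = ∑ i, ∑ j, (v t).gi i j * (traceForm C i * divMix C ((v t).gi * (v t).k) j)
        + 8 * Real.pi * ∑ i, ∑ j, (v t).gi i j * (traceForm C i
          * ((v t).τ0 j - (v t).ρ * (v t).u0 * (v t).uLow j)) := by
    simp only [State.divk_eq hC.skew hs (h.k_symm ht), Finset.mul_sum, ← Finset.sum_add_distrib]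
    exact Finset.sum_congr rfl fun i _ => Finset.sum_congr rfl fun j _ => by ring
  rw [e1, State.normSq_k_eq hs (h.k_symm ht)]
  set K := (v t).gi * (v t).k with hKdef
  have hH : K.trace = (v t).H := ((v t).H_eq (h.k_symm ht)).symm
  simp only [Matrix.add_mul, Matrix.mul_add, Matrix.sub_mul, Matrix.mul_sub, Matrix.smul_mul,
    Matrix.mul_smul, Matrix.trace_add, Matrix.trace_sub, Matrix.trace_smul, smul_eq_mul,
    Matrix.one_mul, Matrix.mul_one, hH]
  rw [Matrix.trace_mul_comm K ((v t).gi * ricMat C (v t)), Matrix.trace_mul_comm K (v t).matterMix]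
  have hu := State.u0_sq hs
  have hT : (v t).T00 m = (v t).U + (1 / 2) * m ^ 2 * (v t).Φ ^ 2 := rfl
  rw [hT, hu]
  generalize ∑ i, ∑ j, (v t).gi i j * (traceForm C i * divMix C K j) = x1
  generalize ∑ i, ∑ j, (v t).gi i j * (traceForm C i
          * ((v t).τ0 j - (v t).ρ * (v t).u0 * (v t).uLow j)) = x2
  push_cast
  ring

end IsGlobalSolution

/-- The evolution system propagates the constraints. -/
theorem IsGlobalSolution.constraints (h : IsGlobalSolution C m Λ v) (hC : IsLieConstants C)
    (hF : ∀ t, 0 ≤ t → ∀ i j, (v t).F i j = -(v t).F j i) (h0 : (v 0).Constraints C m Λ)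
    {t : ℝ} (ht : 0 ≤ t) : (v t).Constraints C m Λ := by
  -- The order is forced by the triangular structure: each defect solves a homogeneous equation once
  -- the preceding ones vanish.
  have hmag : ∀ r, 0 ≤ r → ∀ i j k,
      ∑ l, (C l i j * (v r).F k l + C l k i * (v r).F j l + C l j k * (v r).F i l) = 0 :=
    fun r hr i j k => by
      rw [eq_initial_of_deriv_zero (fun q hq => h.magnetic_deriv hC hq i j k) hr]
      exact h0.magnetic i j k
  have hel : ∀ r, 0 ≤ r →
      (∑ i, ∑ k, C i i k * (v r).E k) + 4 * Real.pi * (v r).e * (v r).u0 = 0 :=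
    fun r hr => eq_zero_of_linear_ode h.H_continuousOn
      (fun q hq => h.electric_deriv hC hF hq) h0.electric hr
  have hmom : ∀ r, 0 ≤ r → ∀ j, (v r).divk C j
        + 8 * Real.pi * ((v r).τ0 j - (v r).ρ * (v r).u0 * (v r).uLow j) = 0 :=
    fun r hr j => eq_zero_of_linear_ode h.H_continuousOn
      (y := fun r => (v r).divk C j
        + 8 * Real.pi * ((v r).τ0 j - (v r).ρ * (v r).u0 * (v r).uLow j))
      (fun q hq => by
        refine (h.momentum_deriv hC hF hq j).congr_deriv ?_
        rw [hel q hq]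
        simp only [hmag q hq, mul_zero, Finset.sum_const_zero, add_zero])
      (by
        simp only [h0.momentum j]
        ring) hr
  have hham := eq_zero_of_linear_ode (h.H_continuousOn.const_smul (2 : ℝ))
      (y := fun r => (v r).R C - (v r).normSq (v r).k + (v r).H ^ 2
        - 16 * Real.pi * ((v r).T00 m + ((v r).τ00 + (v r).ρ * (v r).u0 ^ 2)) - 2 * Λ)
      (fun q hq => by
        refine (h.hamiltonian_deriv hC hF hq).congr_deriv ?_
        simp only [hmom q hq, mul_zero, Finset.sum_const_zero, sub_zero, Pi.smul_apply, smul_eq_mul])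
      (by
        have := h0.hamiltonian
        linarith) ht
  exact ⟨by linarith, fun j => by linarith [hmom t ht j], hmag t ht, hel t ht⟩

end Solution

/-! ### Norms with respect to the metric -/

theorem IsFrame.dotProduct_g {s : State} {P Q : Mat3} (hf : IsFrame s P Q) (x y : Fin 3 → ℝ) :
    x ⬝ᵥ s.g *ᵥ y = (Q *ᵥ x) ⬝ᵥ (Q *ᵥ y) := by
  rw [hf.g_eq, ← Matrix.mulVec_mulVec, Matrix.dotProduct_mulVec, Matrix.vecMul_transpose]

/-- In an orthonormal frame the full contraction is a sum of squares of components; nonnegativity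
and Cauchy–Schwarz follow. -/
theorem IsFrame.normSq_eq {s : State} {P Q : Mat3} (hf : IsFrame s P Q) (A : Mat3) :
    s.normSq A = ∑ a, ∑ b, (Pᵀ * A * P) a b ^ 2 := by
  have e1 : s.normSq A = (Aᵀ * (P * Pᵀ * A * (P * Pᵀ))).trace := by
    simp only [State.normSq, State.raise_eq, Matrix.trace, Matrix.diag]
    rw [Finset.sum_comm]
    refine Finset.sum_congr rfl fun j _ => ?_
    rw [Matrix.mul_apply]
    refine Finset.sum_congr rfl fun i _ => ?_
    rw [hf.gi_eq, Matrix.transpose_mul, Matrix.transpose_transpose, Matrix.transpose_apply]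
  have e2 : ∑ a, ∑ b, (Pᵀ * A * P) a b ^ 2 = ((Pᵀ * A * P)ᵀ * (Pᵀ * A * P)).trace := by
    simp only [Matrix.trace, Matrix.diag, sq]
    rw [Finset.sum_comm]
    rfl
  rw [e1, e2, Matrix.transpose_mul, Matrix.transpose_mul, Matrix.transpose_transpose,
    show Aᵀ * (P * Pᵀ * A * (P * Pᵀ)) = (Aᵀ * P * Pᵀ * A * P) * Pᵀ by
      simp only [Matrix.mul_assoc], Matrix.trace_mul_comm]
  simp only [Matrix.mul_assoc]

namespace State

variable {s : State}

theorem normSq_nonneg (hs : s.g.PosDef) (A : Mat3) : 0 ≤ s.normSq A := by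
  obtain ⟨P, Q, hf⟩ := exists_isFrame hs
  rw [hf.normSq_eq]
  exact Finset.sum_nonneg fun a _ => Finset.sum_nonneg fun b _ => sq_nonneg _

theorem τ00_nonneg (hs : s.g.PosDef) : 0 ≤ s.τ00 := by
  have h1 := ESq_nonneg hs
  have h2 := normSq_nonneg hs s.F
  unfold τ00
  linarith

theorem dotProduct_g_nonneg (hs : s.g.PosDef) (x : Fin 3 → ℝ) : 0 ≤ x ⬝ᵥ s.g *ᵥ x := by
  simpa using hs.posSemidef.dotProduct_mulVec_nonneg x

theorem sq_dotProduct_g_le (hs : s.g.PosDef) (x y : Fin 3 → ℝ) :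
    (x ⬝ᵥ s.g *ᵥ y) ^ 2 ≤ (x ⬝ᵥ s.g *ᵥ x) * (y ⬝ᵥ s.g *ᵥ y) := by
  obtain ⟨P, Q, hf⟩ := exists_isFrame hs
  simp only [hf.dotProduct_g]
  generalize Q *ᵥ x = X
  generalize Q *ᵥ y = Y
  simp only [dotProduct, ← sq]
  exact Finset.sum_mul_sq_le_sq_mul_sq _ _ _

/-- The Cauchy-Schwarz inequality for the full contraction. -/
theorem sq_dotProduct_mulVec_le (hs : s.g.PosDef) (A : Mat3) (x y : Fin 3 → ℝ) :
    (x ⬝ᵥ A *ᵥ y) ^ 2 ≤ s.normSq A * ((x ⬝ᵥ s.g *ᵥ x) * (y ⬝ᵥ s.g *ᵥ y)) := by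
  obtain ⟨P, Q, hf⟩ := exists_isFrame hs
  have e : x ⬝ᵥ A *ᵥ y = (Q *ᵥ x) ⬝ᵥ (Pᵀ * A * P) *ᵥ (Q *ᵥ y) := by
    rw [Matrix.mulVec_mulVec, Matrix.dotProduct_mulVec, Matrix.dotProduct_mulVec,
      ← Matrix.vecMul_transpose, Matrix.vecMul_vecMul,
      show Qᵀ * (Pᵀ * A * P * Q) = (Qᵀ * Pᵀ) * A * (P * Q) by simp only [Matrix.mul_assoc],
      hf.transpose_inv, hf.inv, Matrix.one_mul, Matrix.mul_one]
  rw [e, hf.normSq_eq, hf.dotProduct_g, hf.dotProduct_g]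
  generalize Q *ᵥ x = X
  generalize Q *ᵥ y = Y
  generalize Pᵀ * A * P = S
  have h1 : (X ⬝ᵥ S *ᵥ Y) ^ 2 ≤ (X ⬝ᵥ X) * ∑ a, (S *ᵥ Y) a ^ 2 := by
    simp only [dotProduct, ← sq]
    exact Finset.sum_mul_sq_le_sq_mul_sq _ _ _
  have h2 : ∑ a, (S *ᵥ Y) a ^ 2 ≤ (∑ a, ∑ b, S a b ^ 2) * (Y ⬝ᵥ Y) := by
    rw [Finset.sum_mul]
    refine Finset.sum_le_sum fun a _ => ?_
    simp only [Matrix.mulVec, dotProduct, ← sq]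
    exact Finset.sum_mul_sq_le_sq_mul_sq _ _ _
  have h3 : 0 ≤ X ⬝ᵥ X := by
    simp only [dotProduct, ← sq]
    exact Finset.sum_nonneg fun a _ => sq_nonneg _
  calc _ ≤ _ := h1
    _ ≤ _ := mul_le_mul_of_nonneg_left h2 h3
    _ = _ := by ring

theorem dotProduct_g_gi_col (hs : s.g.PosDef) (i : Fin 3) :
    (s.gi *ᵥ Pi.single i 1) ⬝ᵥ s.g *ᵥ (s.gi *ᵥ Pi.single i 1) = s.gi i i := by
  rw [Matrix.mulVec_mulVec, g_mul_gi hs, Matrix.one_mulVec]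
  simp

theorem sq_apply_le (hs : s.g.PosDef) (A : Mat3) (i j : Fin 3) :
    A i j ^ 2 ≤ s.normSq A * (s.g i i * s.g j j) := by
  have h := sq_dotProduct_mulVec_le hs A (Pi.single i 1) (Pi.single j 1)
  simpa using h

/-- Cauchy–Schwarz for the vectors dual to the coframe, whose squared lengths are $g^{ii}$. -/
theorem sq_raised_apply_le (hs : s.g.PosDef) (A : Mat3) (i j : Fin 3) :
    (s.gi * A * s.gi) i j ^ 2 ≤ s.normSq A * (s.gi i i * s.gi j j) := by
  have h := sq_dotProduct_mulVec_le hs A (s.gi *ᵥ Pi.single i 1) (s.gi *ᵥ Pi.single j 1)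
  rw [dotProduct_g_gi_col hs, dotProduct_g_gi_col hs] at h
  have e : (s.gi *ᵥ Pi.single i 1) ⬝ᵥ A *ᵥ (s.gi *ᵥ Pi.single j 1) = (s.gi * A * s.gi) i j := by
    have hgt : s.giᵀ = s.gi := by ext x y; exact gi_symm hs y x
    rw [← Matrix.vecMul_transpose, hgt, ← Matrix.dotProduct_mulVec, Matrix.mulVec_mulVec,
      Matrix.mulVec_mulVec]
    simp
  rwa [e] at h

theorem sq_E_le (hs : s.g.PosDef) (i : Fin 3) : s.E i ^ 2 ≤ s.gi i i * s.ESq := by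
  have h := sq_dotProduct_g_le hs (s.gi *ᵥ Pi.single i 1) s.E
  rw [dotProduct_g_gi_col hs] at h
  have e : (s.gi *ᵥ Pi.single i 1) ⬝ᵥ s.g *ᵥ s.E = s.E i := by
    have hgt : s.giᵀ = s.gi := by ext x y; exact gi_symm hs y x
    rw [← Matrix.vecMul_transpose, hgt, ← Matrix.dotProduct_mulVec, Matrix.mulVec_mulVec,
      gi_mul_g hs, Matrix.one_mulVec]
    simp
  rwa [e] at h

theorem gi_diag_nonneg (hs : s.g.PosDef) (i : Fin 3) : 0 ≤ s.gi i i :=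
  hs.inv.posSemidef.diag_nonneg

end State

theorem sqrt_mul_diag_le_trace {A : Mat3} (hA : ∀ i, 0 ≤ A i i) {x y : ℝ} (hy : 0 ≤ y)
    (i j : Fin 3) (h : x ^ 2 ≤ y ^ 2 * (A i i * A j j)) : |x| ≤ y * A.trace := by
  have hle (l : Fin 3) : A l l ≤ A.trace :=
    Finset.single_le_sum (f := fun l => A l l) (fun l _ => hA l) (Finset.mem_univ l)
  have h0 : 0 ≤ A.trace := (hA 0).trans (hle 0)
  refine abs_le_of_sq_le_sq ?_ (mul_nonneg hy h0)
  calc x ^ 2 ≤ y ^ 2 * (A i i * A j j) := h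
    _ ≤ y ^ 2 * (A.trace * A.trace) := by
        refine mul_le_mul_of_nonneg_left ?_ (sq_nonneg y)
        exact mul_le_mul (hle i) (hle j) (hA j) h0
    _ = (y * A.trace) ^ 2 := by ring

theorem abs_apply_le_trace {A : Mat3} (hA : A.PosDef) (i j : Fin 3) : |A i j| ≤ A.trace := by
  -- A dummy state whose only relevant entry is the metric $A$.
  have h := State.sq_dotProduct_g_le (s := ⟨A, 0, 0, 0, 0, 0, 0, 0, 0⟩) hA (Pi.single i 1)
    (Pi.single j 1)
  have := sqrt_mul_diag_le_trace (A := A) (x := A i j) (y := 1)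
    (fun l => hA.posSemidef.diag_nonneg) zero_le_one i j (by simpa using h)
  simpa using this

/-- The Euclidean operator norm of a tensor is controlled by its norm with respect to `g`. -/
theorem opNorm_le {s : State} (hs : s.g.PosDef) (A : Mat3) {y : ℝ} (hy : 0 ≤ y)
    (h : s.normSq A ≤ y ^ 2) : opNorm A ≤ y * opNorm s.g := by
  have hg0 : 0 ≤ opNorm s.g := norm_nonneg _
  have hq (x : EuclideanSpace ℝ (Fin 3)) :
      x.ofLp ⬝ᵥ s.g *ᵥ x.ofLp ≤ opNorm s.g * ‖x‖ ^ 2 := by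
    have h1 : x.ofLp ⬝ᵥ s.g *ᵥ x.ofLp
        = inner ℝ x (Matrix.toEuclideanCLM (n := Fin 3) (𝕜 := ℝ) s.g x) := by
      rw [EuclideanSpace.inner_eq_star_dotProduct]
      simp [dotProduct_comm]
    rw [h1]
    refine (real_inner_le_norm _ _).trans ?_
    have := (Matrix.toEuclideanCLM (n := Fin 3) (𝕜 := ℝ) s.g).le_opNorm x
    calc ‖x‖ * _ ≤ ‖x‖ * (opNorm s.g * ‖x‖) := mul_le_mul_of_nonneg_left this (norm_nonneg _)
      _ = _ := by ring
  refine ContinuousLinearMap.opNorm_le_bound _ (mul_nonneg hy hg0) fun x => ?_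
  set z := Matrix.toEuclideanCLM (n := Fin 3) (𝕜 := ℝ) A x with hz
  have h1 : ‖z‖ ^ 2 = z.ofLp ⬝ᵥ A *ᵥ x.ofLp := by
    rw [← real_inner_self_eq_norm_sq, EuclideanSpace.inner_eq_star_dotProduct, hz]
    simp
  have h2 := State.sq_dotProduct_mulVec_le hs A z.ofLp x.ofLp
  rw [← h1] at h2
  -- Cauchy–Schwarz is tested on $z=Ax$ and $x$; a factor $\|z\|$ is cancelled at the end.
  have h3 : (‖z‖ ^ 2) ^ 2 ≤ (y * opNorm s.g * ‖x‖ * ‖z‖) ^ 2 := by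
    calc (‖z‖ ^ 2) ^ 2 ≤ _ := h2
      _ ≤ y ^ 2 * ((opNorm s.g * ‖z‖ ^ 2) * (opNorm s.g * ‖x‖ ^ 2)) := by
          refine mul_le_mul h ?_ ?_ (sq_nonneg _)
          · exact mul_le_mul (hq z) (hq x) (State.dotProduct_g_nonneg hs _) (by positivity)
          · exact mul_nonneg (State.dotProduct_g_nonneg hs _) (State.dotProduct_g_nonneg hs _)
      _ = _ := by ring
  have h4 : ‖z‖ ^ 2 ≤ y * opNorm s.g * ‖x‖ * ‖z‖ :=
    le_of_sq_le_sq h3 (by positivity)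
  rcases (norm_nonneg z).eq_or_lt with h0 | h0
  · rw [← h0]; positivity
  · exact le_of_mul_le_mul_right (by linarith [sq (‖z‖)]) h0

/-! ### The Hamiltonian constraint and the decay of `Q` -/

namespace State

variable {s : State} {C : Fin 3 → Fin 3 → Fin 3 → ℝ} {m Λ : ℝ}

theorem normSq_σ (hs : s.g.PosDef) : s.normSq s.σ = s.normSq s.k - s.H ^ 2 / 3 := by
  have hgt : s.giᵀ = s.gi := by ext x y; exact gi_symm hs y x
  have e1 : ∀ i j, s.raise s.g i j = s.gi i j := by
    intro i j
    rw [raise_eq, gi_mul_g hs, Matrix.one_mul, hgt]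
  have e2 : ∀ i j, s.raise s.σ i j = s.raise s.k i j - s.H / 3 * s.gi i j := by
    intro i j
    rw [← e1]
    simp only [raise, σ, Matrix.sub_apply, Matrix.smul_apply, smul_eq_mul, Fin.sum_univ_three]
    ring
  have e3 : ∑ i, ∑ j, s.g i j * s.gi i j = 3 := by
    have h := congrArg Matrix.trace (g_mul_gi hs)
    simp only [Matrix.trace, Matrix.diag, Matrix.mul_apply] at h
    rw [show ∑ l, ∑ n, s.g l n * s.gi l n = ∑ l, ∑ n, s.g l n * s.gi n l from
      Finset.sum_congr rfl fun l _ => Finset.sum_congr rfl fun n _ => by rw [gi_symm hs], h]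
    simp
  have e4 : ∑ i, ∑ j, s.g i j * s.raise s.k i j = s.H := by
    have : ∑ i, ∑ j, s.g i j * s.raise s.k i j = ∑ i, ∑ j, s.raise s.g i j * s.k i j := by
      simp only [raise, Fin.sum_univ_three, gi_symm hs 1 0, gi_symm hs 2 0, gi_symm hs 2 1]
      ring
    rw [this]
    simp only [e1]
    rfl
  have e5 : ∑ i, ∑ j, s.gi i j * s.k i j = s.H := rfl
  simp only [normSq, e2]
  simp only [σ, Matrix.sub_apply, Matrix.smul_apply, smul_eq_mul]
  generalize s.raise s.k = X at *
  simp only [Fin.sum_univ_three] at e3 e4 e5 ⊢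
  linear_combination -(s.H / 3) * e4 - (s.H / 3) * e5 + (s.H / 3) ^ 2 * e3

/-- This is $\tfrac32$ times the Hamiltonian constraint, after
$k_{ij}k^{ij}=\sigma_{ij}\sigma^{ij}+H^2/3$. It turns $Q$ into a sum of terms of known sign when
$R\le0$ and $\rho\ge0$. -/
theorem Constraints.Q_eq (hc : s.Constraints C m Λ) (hs : s.g.PosDef) :
    s.Q m Λ = 24 * Real.pi * (s.τ00 + s.ρ * s.u0 ^ 2) + 3 / 2 * s.normSq s.σ - 3 / 2 * s.R C := by
  have h := hc.hamiltonian
  rw [normSq_σ hs, Q]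
  linarith

end State

section Solution

variable {C : Fin 3 → Fin 3 → Fin 3 → ℝ} {m Λ : ℝ} {v : ℝ → State}

theorem IsGlobalSolution.Q_deriv (h : IsGlobalSolution C m Λ v) {t : ℝ} (ht : 0 ≤ t)
    (hc : (v t).Constraints C m Λ) :
    HasDerivWithinAt (fun r => (v r).Q m Λ) (2 * (v t).H * ((v t).Q m Λ / 3
      + (v t).normSq (v t).σ + 8 * Real.pi * (v t).τ00
      + 4 * Real.pi * (v t).ρ * ((v t).u0 ^ 2 + (v t).uSq))) (Set.Ici 0) t := by
  have hs := h.g_posDef t ht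
  refine ((((h.H_deriv ht).pow 2).sub ((h.T00_deriv ht).const_mul (24 * Real.pi))).sub_const
    (3 * Λ)).congr_deriv ?_
  have e := hc.Q_eq hs
  have hu := State.u0_sq hs
  have hQ : (v t).Q m Λ = (v t).H ^ 2 - 24 * Real.pi * ((v t).U + 1 / 2 * m ^ 2 * (v t).Φ ^ 2)
    - 3 * Λ := rfl
  rw [hu] at e ⊢
  push_cast
  -- The constraint is used to eliminate $R$; this is what leaves only nonnegative terms beside
  -- $Q/3$ for an expanding solution.
  linear_combination (2 * (v t).H) * (2 / 3 * e - hQ)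

end Solution

/-! ### Differential inequalities on `[0, ∞)` -/

theorem le_of_deriv_nonpos {f f' : ℝ → ℝ} {a b : ℝ} (ha : 0 ≤ a) (hab : a ≤ b)
    (hf : ∀ t, 0 ≤ t → HasDerivWithinAt f (f' t) (Set.Ici 0) t) (h : ∀ t, a ≤ t → f' t ≤ 0) :
    f b ≤ f a := by
  refine antitoneOn_of_hasDerivWithinAt_nonpos (f' := f') (convex_Ici a)
    (fun t ht => ((hf t (ha.trans ht)).continuousWithinAt).mono (Set.Ici_subset_Ici.2 ha))
    (fun t ht => (hf t (ha.trans (interior_subset ht))).mono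
      (interior_subset.trans (Set.Ici_subset_Ici.2 ha)))
    (fun t ht => h t (interior_subset ht)) Set.self_mem_Ici hab hab

theorem hasDerivWithinAt_exp_mul (c t : ℝ) :
    HasDerivWithinAt (fun r => Real.exp (c * r)) (c * Real.exp (c * t)) (Set.Ici 0) t := by
  have h := ((hasDerivAt_id t).const_mul c).exp
  refine (h.hasDerivWithinAt).congr_deriv ?_
  simp [mul_comm]

theorem mul_exp_le_of_deriv_le {y y' : ℝ → ℝ} {a b c : ℝ} (ha : 0 ≤ a) (hab : a ≤ b)
    (hy : ∀ t, 0 ≤ t → HasDerivWithinAt y (y' t) (Set.Ici 0) t)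
    (h : ∀ t, a ≤ t → y' t ≤ -c * y t) : y b * Real.exp (c * b) ≤ y a * Real.exp (c * a) := by
  refine le_of_deriv_nonpos ha hab
    (fun t ht => (hy t ht).mul (hasDerivWithinAt_exp_mul c t)) fun t ht => ?_
  have := h t ht
  have he := Real.exp_pos (c * t)
  nlinarith

/-- The functions $f\pm(K/\gamma)e^{-\gamma t}$ are monotone in opposite senses and enclose the
limit, taken as the supremum of the lower one. -/
theorem exists_limit_of_deriv_le {f f' : ℝ → ℝ} {K γ : ℝ} (hγ : 0 < γ)
    (hf : ∀ t, 0 ≤ t → HasDerivWithinAt f (f' t) (Set.Ici 0) t)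
    (h : ∀ t, 0 ≤ t → |f' t| ≤ K * Real.exp (-γ * t)) :
    ∃ l, ∀ t, 0 ≤ t → |f t - l| ≤ K / γ * Real.exp (-γ * t) := by
  have hd (s t : ℝ) (hs : 0 ≤ s) (hst : s ≤ t) :
      f t + K / γ * Real.exp (-γ * t) ≤ f s + K / γ * Real.exp (-γ * s) := by
    refine le_of_deriv_nonpos hs hst (fun r hr => (hf r hr).add
      ((hasDerivWithinAt_exp_mul (-γ) r).const_mul (K / γ))) fun r hr => ?_
    have h1 := (abs_le.1 (h r (hs.trans hr))).2
    have : K / γ * (-γ * Real.exp (-γ * r)) = -(K * Real.exp (-γ * r)) := by field_simp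
    linarith
  have hu (s t : ℝ) (hs : 0 ≤ s) (hst : s ≤ t) :
      f s - K / γ * Real.exp (-γ * s) ≤ f t - K / γ * Real.exp (-γ * t) := by
    have := le_of_deriv_nonpos hs hst (fun r hr => ((hf r hr).sub
      ((hasDerivWithinAt_exp_mul (-γ) r).const_mul (K / γ))).neg) fun r hr => by
        have h1 := (abs_le.1 (h r (hs.trans hr))).1
        have : K / γ * (-γ * Real.exp (-γ * r)) = -(K * Real.exp (-γ * r)) := by field_simp
        linarith
    simp only [Pi.sub_apply, Pi.neg_apply] at this
    linarith
  have hK : 0 ≤ K := by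
    have := (abs_nonneg _).trans (h 0 le_rfl)
    simpa using this
  have hpos (t : ℝ) : 0 ≤ K / γ * Real.exp (-γ * t) := by positivity
  have hcross (s t : ℝ) (hs : 0 ≤ s) (ht : 0 ≤ t) :
      f s - K / γ * Real.exp (-γ * s) ≤ f t + K / γ * Real.exp (-γ * t) := by
    rcases le_total s t with hst | hst
    · linarith [hu s t hs hst, hpos t]
    · linarith [hd t s ht hst, hpos s]
  let S : Set ℝ := (fun s => f s - K / γ * Real.exp (-γ * s)) '' Set.Ici 0
  have hbdd (t : ℝ) (ht : 0 ≤ t) : f t + K / γ * Real.exp (-γ * t) ∈ upperBounds S := by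
    rintro _ ⟨s, hs, rfl⟩
    exact hcross s t hs ht
  refine ⟨sSup S, fun t ht => abs_le.2 ⟨?_, ?_⟩⟩
  · have := csSup_le (⟨_, 0, Set.self_mem_Ici, rfl⟩ : S.Nonempty) (hbdd t ht)
    linarith
  · have := le_csSup ⟨_, hbdd 0 le_rfl⟩ (⟨t, ht, rfl⟩ : f t - K / γ * Real.exp (-γ * t) ∈ S)
    linarith

/-- Matrix valued functions whose trace dominates the entries and whose relative growth rate
decays exponentially are bounded and converge exponentially. -/
theorem exists_limit_of_relative_deriv_le {X X' : ℝ → Mat3} {K γ : ℝ} (hγ : 0 < γ)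
    (hX : ∀ t, 0 ≤ t → MDeriv X (X' t) t) (htr : ∀ t, 0 ≤ t → ∀ i j, |X t i j| ≤ (X t).trace)
    (h : ∀ t, 0 ≤ t → ∀ i j, |X' t i j| ≤ K * Real.exp (-γ * t) * (X t).trace) :
    ∃ (B : ℝ) (Y : Mat3), 0 < B ∧ (∀ t, 0 ≤ t → ∀ i j, |X t i j| ≤ B) ∧
      ∀ t, 0 ≤ t → ∀ i j, |X t i j - Y i j| ≤ B * Real.exp (-γ * t) := by
  have hn (t : ℝ) (ht : 0 ≤ t) : 0 ≤ (X t).trace := (abs_nonneg _).trans (htr t ht 0 0)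
  set M := max K 0 with hM
  have hM0 : 0 ≤ M := le_max_right _ _
  have h' : ∀ t, 0 ≤ t → ∀ i j, |X' t i j| ≤ M * Real.exp (-γ * t) * (X t).trace := by
    intro t ht i j
    refine (h t ht i j).trans ?_
    have := hn t ht
    have := le_max_left K 0
    gcongr
  -- The integrating factor $\exp(\tfrac{3M}{\gamma}e^{-\gamma t})$ makes the trace nonincreasing;
  -- the 3 counts the diagonal entries. The total growth is finite because $e^{-\gamma t}$ is
  -- integrable.
  have hz : ∀ t, 0 ≤ t → (X t).trace
      ≤ (X 0).trace * Real.exp (3 * M / γ) := by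
    intro t ht
    have hexp (r : ℝ) : HasDerivWithinAt
        (fun r => Real.exp (3 * M / γ * Real.exp (-γ * r)))
        (Real.exp (3 * M / γ * Real.exp (-γ * r)) * (3 * M / γ * (-γ * Real.exp (-γ * r))))
        (Set.Ici 0) r :=
      ((hasDerivWithinAt_exp_mul (-γ) r).const_mul (3 * M / γ)).exp
    have key : (X t).trace * Real.exp (3 * M / γ * Real.exp (-γ * t))
        ≤ (X 0).trace * Real.exp (3 * M / γ * Real.exp (-γ * 0)) := le_of_deriv_nonpos le_rfl ht
      (fun r hr => (hX r hr).trace.mul (hexp r)) fun r hr => by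
        have hp := Real.exp_pos (3 * M / γ * Real.exp (-γ * r))
        have e : 3 * M / γ * (-γ * Real.exp (-γ * r)) = -(3 * (M * Real.exp (-γ * r))) := by
          field_simp
        have hle : (X' r).trace ≤ 3 * (M * Real.exp (-γ * r) * (X r).trace) := by
          rw [Matrix.trace, Fin.sum_univ_three]
          have (i : Fin 3) := (abs_le.1 (h' r hr i i)).2
          linarith [this 0, this 1, this 2, show (X' r).diag 0 = X' r 0 0 from rfl,
            show (X' r).diag 1 = X' r 1 1 from rfl, show (X' r).diag 2 = X' r 2 2 from rfl]
        rw [e]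
        nlinarith
    rw [mul_zero, Real.exp_zero, mul_one] at key
    have h1 : 1 ≤ Real.exp (3 * M / γ * Real.exp (-γ * t)) := by
      rw [← Real.exp_zero]
      exact Real.exp_le_exp.2 (by positivity)
    have := hn t ht
    nlinarith
  set B₀ := (X 0).trace * Real.exp (3 * M / γ) with hB₀
  have hlim (i j : Fin 3) := exists_limit_of_deriv_le (K := M * B₀) hγ
    (fun t ht => hX t ht i j) (fun t ht => by
      refine (h' t ht i j).trans ?_
      have h1 := hz t ht
      have h2 := Real.exp_pos (-γ * t)
      calc M * Real.exp (-γ * t) * (X t).trace ≤ M * Real.exp (-γ * t) * B₀ := by gcongr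
        _ = _ := by ring)
  choose Y hY using hlim
  have hB : 0 ≤ B₀ := mul_nonneg (hn 0 le_rfl) (Real.exp_pos _).le
  refine ⟨B₀ + M * B₀ / γ + 1, Matrix.of Y, by positivity, fun t ht i j => ?_, fun t ht i j => ?_⟩
  · have : 0 ≤ M * B₀ / γ := by positivity
    linarith [htr t ht i j, hz t ht]
  · refine (hY i j t ht).trans ?_
    have := Real.exp_pos (-γ * t)
    gcongr
    linarith

theorem pos_of_ne_zero {f : ℝ → ℝ} (hf : ContinuousOn f (Set.Ici 0))
    (hne : ∀ t, 0 ≤ t → f t ≠ 0) (h0 : 0 < f 0) {t : ℝ} (ht : 0 ≤ t) : 0 < f t := by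
  by_contra! hle
  obtain ⟨s, hs, hs0⟩ := intermediate_value_Icc' ht
    (hf.mono (Set.Icc_subset_Ici_self : Set.Icc 0 t ⊆ Set.Ici 0)) ⟨hle, h0.le⟩
  exact hne s hs.1 hs0

/-! ### Decay of the physical quantities -/

theorem State.H_sq_eq (s : State) (m Λ : ℝ) : s.H ^ 2 = s.Q m Λ + 24 * Real.pi * s.U
    + 12 * Real.pi * m ^ 2 * s.Φ ^ 2 + 3 * Λ := by
  rw [State.Q, State.T00]
  ring

/-- An initially expanding global solution that satisfies the constraints, with nonpositive spatial
scalar curvature and `3 γ² = Λ + 4 π m² Φ(0)²`. -/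
structure IsExpanding (C : Fin 3 → Fin 3 → Fin 3 → ℝ) (m Λ γ : ℝ) (v : ℝ → State) : Prop where
  sol : IsGlobalSolution C m Λ v
  constraints : ∀ t, 0 ≤ t → (v t).Constraints C m Λ
  R_nonpos : ∀ t, 0 ≤ t → (v t).R C ≤ 0
  m_pos : 0 < m
  γ_pos : 0 < γ
  γ_sq : 3 * γ ^ 2 = Λ + 4 * Real.pi * m ^ 2 * (v 0).Φ ^ 2
  Φ_pos : 0 < (v 0).Φ
  ρ_pos : 0 < (v 0).ρ
  H_neg : (v 0).H < 0

namespace IsExpanding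

variable {C : Fin 3 → Fin 3 → Fin 3 → ℝ} {m Λ γ : ℝ} {v : ℝ → State}
  (h : IsExpanding C m Λ γ v)
include h

theorem ρ_pos' {t : ℝ} (ht : 0 ≤ t) : 0 < (v t).ρ :=
  pos_of_ne_zero (fun r hr => (h.sol.ρ_eq r hr).continuousWithinAt) h.sol.ρ_ne_zero h.ρ_pos ht

theorem Φ_mono {a b : ℝ} (ha : 0 ≤ a) (hab : a ≤ b) : (v a).Φ ≤ (v b).Φ := by
  have := le_of_deriv_nonpos ha hab (fun r hr => (h.sol.Φ_eq r hr).neg)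
    fun r _ => neg_nonpos.2 (Real.sqrt_nonneg _)
  exact neg_le_neg_iff.1 this

theorem Φ_pos' {t : ℝ} (ht : 0 ≤ t) : 0 < (v t).Φ := h.Φ_pos.trans_le (h.Φ_mono le_rfl ht)

theorem Φ_sq_mono {a b : ℝ} (ha : 0 ≤ a) (hab : a ≤ b) : (v a).Φ ^ 2 ≤ (v b).Φ ^ 2 :=
  pow_le_pow_left₀ (h.Φ_pos' ha).le (h.Φ_mono ha hab) 2

/-- In `State.Constraints.Q_eq` all terms are nonnegative, their coefficients are at least 1, and
$(u^0)^2\ge1$. -/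
theorem Q_bounds {t : ℝ} (ht : 0 ≤ t) :
    (v t).τ00 ≤ (v t).Q m Λ ∧ (v t).ρ ≤ (v t).Q m Λ ∧ (v t).normSq (v t).σ ≤ (v t).Q m Λ ∧
      -(v t).R C ≤ (v t).Q m Λ := by
  have hs := h.sol.g_posDef t ht
  have e := (h.constraints t ht).Q_eq hs
  have h1 := State.τ00_nonneg hs
  have h2 := State.normSq_nonneg hs (v t).σ
  have h3 := h.R_nonpos t ht
  have h4 : (v t).ρ ≤ (v t).ρ * (v t).u0 ^ 2 := by
    rw [State.u0_sq hs]
    nlinarith [h.ρ_pos' ht, State.uSq_nonneg hs]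
  have h5 := h.ρ_pos' ht
  have hπ := Real.pi_gt_three
  rw [e]
  refine ⟨?_, ?_, ?_, ?_⟩ <;> nlinarith

theorem Q_nonneg {t : ℝ} (ht : 0 ≤ t) : 0 ≤ (v t).Q m Λ :=
  (h.ρ_pos' ht).le.trans (h.Q_bounds ht).2.1

/-- In $H^2=Q+24\pi U+12\pi m^2\Phi^2+3\Lambda$ the first two terms are nonnegative and
$\Phi^2\ge\Phi(0)^2$. -/
theorem H_sq_ge {t : ℝ} (ht : 0 ≤ t) : (3 * γ) ^ 2 ≤ (v t).H ^ 2 := by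
  rw [(v t).H_sq_eq m Λ]
  have h1 := h.Q_nonneg ht
  have h2 := mul_nonneg Real.pi_pos.le (h.sol.U_nonneg t ht)
  have h3 := mul_le_mul_of_nonneg_left (h.Φ_sq_mono le_rfl ht)
    (mul_nonneg Real.pi_pos.le (sq_nonneg m))
  have h4 := h.γ_sq
  nlinarith

theorem H_neg' {t : ℝ} (ht : 0 ≤ t) : (v t).H < 0 := by
  have := pos_of_ne_zero (f := fun r => -(v r).H) h.sol.H_continuousOn.neg
    (fun r hr h0 => by
      have h1 := h.H_sq_ge hr
      have h2 := h.γ_pos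
      rw [neg_eq_zero.1 h0] at h1
      nlinarith) (neg_pos.2 h.H_neg) ht
  simpa using this

theorem H_le {t : ℝ} (ht : 0 ≤ t) : (v t).H ≤ -(3 * γ) := by
  have h1 : (3 * γ) ^ 2 ≤ (-(v t).H) ^ 2 := by rw [neg_sq]; exact h.H_sq_ge ht
  linarith [(abs_le_of_sq_le_sq' h1 (neg_nonneg.2 (h.H_neg' ht).le)).2]

/-- As $H<0$, the nonnegative terms only help. The rate $c$ is kept free: it is $\gamma$ from the
start and $\delta$ once the scalar field has stopped. -/
theorem Q_rate_le {t c : ℝ} (ht : 0 ≤ t) (hc : (v t).H ≤ -(3 * c)) :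
    2 * (v t).H * ((v t).Q m Λ / 3 + (v t).normSq (v t).σ + 8 * Real.pi * (v t).τ00
      + 4 * Real.pi * (v t).ρ * ((v t).u0 ^ 2 + (v t).uSq)) ≤ -(2 * c) * (v t).Q m Λ := by
  have hs := h.sol.g_posDef t ht
  have hQ := h.Q_nonneg ht
  have h1 : 0 ≤ (v t).normSq (v t).σ + 8 * Real.pi * (v t).τ00
      + 4 * Real.pi * (v t).ρ * ((v t).u0 ^ 2 + (v t).uSq) := by
    have := State.normSq_nonneg hs (v t).σ
    have := State.τ00_nonneg hs
    have := State.uSq_nonneg hs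
    have := h.ρ_pos' ht
    positivity
  have h2 := mul_nonneg (neg_nonneg.2 (h.H_neg' ht).le) h1
  have h3 := mul_le_mul_of_nonneg_right hc hQ
  linarith

theorem Q_le_exp {a b c : ℝ} (ha : 0 ≤ a) (hab : a ≤ b) (hc : ∀ t, a ≤ t → (v t).H ≤ -(3 * c)) :
    (v b).Q m Λ * Real.exp (2 * c * b) ≤ (v a).Q m Λ * Real.exp (2 * c * a) :=
  mul_exp_le_of_deriv_le ha hab (fun t ht => h.sol.Q_deriv ht (h.constraints t ht))
    fun t ht => h.Q_rate_le (ha.trans ht) (hc t ht)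

theorem Q_le {t : ℝ} (ht : 0 ≤ t) : (v t).Q m Λ ≤ (v 0).Q m Λ * Real.exp (-2 * γ * t) := by
  have h1 := h.Q_le_exp le_rfl ht fun r hr => h.H_le hr
  rw [mul_zero, Real.exp_zero, mul_one] at h1
  have h2 : Real.exp (2 * γ * t) * Real.exp (-2 * γ * t) = 1 := by
    rw [← Real.exp_add, ← Real.exp_zero]; congr 1; ring
  calc (v t).Q m Λ = (v t).Q m Λ * Real.exp (2 * γ * t) * Real.exp (-2 * γ * t) := by
        rw [mul_assoc, h2, mul_one]
    _ ≤ _ := mul_le_mul_of_nonneg_right h1 (Real.exp_pos _).le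

theorem Q_le_initial {t : ℝ} (ht : 0 ≤ t) : (v t).Q m Λ ≤ (v 0).Q m Λ := by
  refine (h.Q_le ht).trans (mul_le_of_le_one_right (h.Q_nonneg le_rfl) ?_)
  rw [Real.exp_le_one_iff]
  nlinarith [h.γ_pos]

/-! ### The scalar field -/

theorem U_rate_le {t : ℝ} (ht : 0 ≤ t) :
    (v t).URate m ≤ -(m ^ 2 * (v 0).Φ) * √(2 * (v t).U) := by
  have h1 := mul_nonneg (neg_nonneg.2 (h.H_neg' ht).le) (h.sol.U_nonneg t ht)
  have h2 := mul_le_mul_of_nonneg_left (h.Φ_mono le_rfl ht)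
    (mul_nonneg (sq_nonneg m) (Real.sqrt_nonneg (2 * (v t).U)))
  rw [State.URate]
  linarith

theorem U_anti {a b : ℝ} (ha : 0 ≤ a) (hab : a ≤ b) : (v b).U ≤ (v a).U := by
  refine le_of_deriv_nonpos ha hab h.sol.U_eq fun t ht => ?_
  have h1 := h.U_rate_le (ha.trans ht)
  have h2 := mul_nonneg (mul_nonneg (sq_nonneg m) h.Φ_pos.le) (Real.sqrt_nonneg (2 * (v t).U))
  linarith

/-- The kinetic energy of the scalar field vanishes after a finite time. -/
theorem exists_U_eq_zero : ∃ T, 0 ≤ T ∧ ∀ t, T ≤ t → (v t).U = 0 := by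
  have key : ∃ T, 0 ≤ T ∧ (v T).U = 0 := by
    by_contra! hne
    have hpos (t : ℝ) (ht : 0 ≤ t) : 0 < (v t).U :=
      (h.sol.U_nonneg t ht).lt_of_ne (hne t ht).symm
    set c := m ^ 2 * (v 0).Φ with hc
    have hc0 : 0 < c := mul_pos (pow_pos h.m_pos 2) h.Φ_pos
    have hd (t : ℝ) (ht : 0 ≤ t) : HasDerivWithinAt (fun r => √(2 * (v r).U) + c * r)
        (2 * (v t).URate m / (2 * √(2 * (v t).U)) + c * 1) (Set.Ici 0) t :=
      (((h.sol.U_eq t ht).const_mul 2).sqrt (by have := hpos t ht; positivity)).add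
        ((hasDerivWithinAt_id t _).const_mul c)
    -- If $U$ stayed positive, $\sqrt{2U}+ct$ would be nonincreasing; at this time that makes
    -- $\sqrt{2U}\le-1$.
    set T := (√(2 * (v 0).U) + 1) / c with hT
    have hT0 : 0 ≤ T := by positivity
    have hle := le_of_deriv_nonpos le_rfl hT0 hd fun t ht => by
      have hy : 0 < √(2 * (v t).U) := Real.sqrt_pos.2 (by linarith [hpos t ht])
      have h1 := h.U_rate_le ht
      have h2 : 2 * (v t).URate m / (2 * √(2 * (v t).U)) ≤ -c := by
        rw [div_le_iff₀ (by positivity)]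
        linarith
      linarith
    have h3 : c * T = √(2 * (v 0).U) + 1 := by rw [hT]; field_simp
    have h4 := Real.sqrt_nonneg (2 * (v T).U)
    simp only [mul_zero, add_zero] at hle
    linarith
  obtain ⟨T, hT, hU⟩ := key
  exact ⟨T, hT, fun t ht =>
    le_antisymm (hU ▸ h.U_anti hT ht) (h.sol.U_nonneg t (hT.trans ht))⟩

theorem Φ_eq_of_U_eq_zero {T : ℝ} (hT : 0 ≤ T) (hU : ∀ t, T ≤ t → (v t).U = 0) {t : ℝ}
    (ht : T ≤ t) : (v t).Φ = (v T).Φ := by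
  refine le_antisymm ?_ (h.Φ_mono hT ht)
  exact le_of_deriv_nonpos hT ht h.sol.Φ_eq fun r hr => by simp [hU r hr]

/-! ### The mean curvature -/

/-- After $T$ one has $(H-3\delta)(H+3\delta)=Q$ with $H\le-3\delta$. So $|H+3\delta|$ is controlled
by $Q$, and $Q$ itself decays at rate $2\delta$. -/
theorem H_add_le {T δ : ℝ} (hT : 0 ≤ T) (hU : ∀ t, T ≤ t → (v t).U = 0) (hδ : 0 < δ)
    (hδ2 : 3 * δ ^ 2 = Λ + 4 * Real.pi * m ^ 2 * (v T).Φ ^ 2) :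
    ∃ K, 0 ≤ K ∧ ∀ t, 0 ≤ t → |(v t).H + 3 * δ| ≤ K * Real.exp (-2 * δ * t) := by
  have hsq (t : ℝ) (ht : T ≤ t) : (v t).H ^ 2 = (v t).Q m Λ + (3 * δ) ^ 2 := by
    rw [(v t).H_sq_eq m Λ, hU t ht, h.Φ_eq_of_U_eq_zero hT hU ht]
    linarith
  have hHle (t : ℝ) (ht : T ≤ t) : (v t).H ≤ -(3 * δ) := by
    have h0 := hT.trans ht
    have h1 : (3 * δ) ^ 2 ≤ (-(v t).H) ^ 2 := by
      rw [neg_sq, hsq t ht]; linarith [h.Q_nonneg h0]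
    linarith [(abs_le_of_sq_le_sq' h1 (neg_nonneg.2 (h.H_neg' h0).le)).2]
  have hexp (t : ℝ) : Real.exp (2 * δ * t) * Real.exp (-2 * δ * t) = 1 := by
    rw [← Real.exp_add, ← Real.exp_zero]; congr 1; ring
  -- On $[0,T]$ the rate need not hold; a compactness bound is used, and the factor $e^{2\delta T}$
  -- in the constant compensates the exponential.
  obtain ⟨B, hB⟩ := isCompact_Icc.exists_bound_of_continuousOn
    ((h.sol.H_continuousOn.add continuousOn_const).mono
      (Set.Icc_subset_Ici_self : Set.Icc 0 T ⊆ Set.Ici 0) :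
      ContinuousOn (fun r => (v r).H + 3 * δ) (Set.Icc 0 T))
  have hB0 : 0 ≤ B := (norm_nonneg _).trans (hB 0 ⟨le_rfl, hT⟩)
  set K₁ := (v T).Q m Λ * Real.exp (2 * δ * T) / (3 * δ) with hK₁
  have hK₁0 : 0 ≤ K₁ := by
    have := h.Q_nonneg hT
    positivity
  refine ⟨K₁ + B * Real.exp (2 * δ * T), by positivity, fun t ht => ?_⟩
  have he := Real.exp_pos (-2 * δ * t)
  rcases le_total T t with htT | htT
  · have h1 := h.Q_le_exp hT htT hHle
    have h2 : -((v t).H + 3 * δ) ≤ (v t).Q m Λ / (3 * δ) := by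
      rw [le_div_iff₀ (by positivity)]
      nlinarith [hsq t htT, hHle t htT]
    have h3 : (v t).Q m Λ / (3 * δ) ≤ K₁ * Real.exp (-2 * δ * t) := by
      rw [hK₁, div_mul_eq_mul_div]
      refine div_le_div_of_nonneg_right ?_ (by positivity)
      calc (v t).Q m Λ = (v t).Q m Λ * Real.exp (2 * δ * t) * Real.exp (-2 * δ * t) := by
            rw [mul_assoc, hexp, mul_one]
        _ ≤ _ := mul_le_mul_of_nonneg_right h1 he.le
    rw [abs_of_nonpos (by linarith [hHle t htT])]
    have : 0 ≤ B * Real.exp (2 * δ * T) * Real.exp (-2 * δ * t) := by positivity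
    linarith
  · have h1 : |(v t).H + 3 * δ| ≤ B := hB t ⟨ht, htT⟩
    have h2 : 1 ≤ Real.exp (2 * δ * T) * Real.exp (-2 * δ * t) := by
      rw [← Real.exp_add, ← Real.exp_zero]
      exact Real.exp_le_exp.2 (by nlinarith)
    have h3 : 0 ≤ K₁ * Real.exp (-2 * δ * t) := by positivity
    nlinarith

end IsExpanding

/-! ### Asymptotics of the metric -/

theorem State.k_eq_σ_add (s : State) (i j : Fin 3) : s.k i j = s.σ i j + s.H / 3 * s.g i j := by
  simp [State.σ]

theorem State.gi_posDef {s : State} (hs : s.g.PosDef) : s.gi.PosDef := hs.inv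

theorem State.raised_k_apply {s : State} (hs : s.g.PosDef) (i j : Fin 3) :
    (s.gi * s.k * s.gi) i j = (s.gi * s.σ * s.gi) i j + s.H / 3 * s.gi i j := by
  have e : s.k = s.σ + (s.H / 3) • s.g := by simp [State.σ]
  have e2 : s.gi * s.k * s.gi = s.gi * s.σ * s.gi + (s.H / 3) • s.gi := by
    conv_lhs => rw [e]
    rw [Matrix.mul_add, Matrix.add_mul, Matrix.mul_smul, State.gi_mul_g hs, Matrix.smul_mul,
      Matrix.one_mul]
  rw [e2]
  rfl

theorem State.abs_apply_le {s : State} (hs : s.g.PosDef) (A : Mat3) {y : ℝ} (hy : 0 ≤ y)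
    (h : s.normSq A ≤ y ^ 2) (i j : Fin 3) : |A i j| ≤ y * s.g.trace := by
  have hp := hs.posSemidef
  refine sqrt_mul_diag_le_trace (fun l => hp.diag_nonneg) hy i j ?_
  exact (State.sq_apply_le hs _ i j).trans
    (mul_le_mul_of_nonneg_right h (mul_nonneg hp.diag_nonneg hp.diag_nonneg))

theorem State.abs_raised_apply_le {s : State} (hs : s.g.PosDef) (A : Mat3) {y : ℝ} (hy : 0 ≤ y)
    (h : s.normSq A ≤ y ^ 2) (i j : Fin 3) : |(s.gi * A * s.gi) i j| ≤ y * s.gi.trace := by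
  have hp := (State.gi_posDef hs).posSemidef
  refine sqrt_mul_diag_le_trace (fun l => hp.diag_nonneg) hy i j ?_
  exact (State.sq_raised_apply_le hs _ i j).trans
    (mul_le_mul_of_nonneg_right h (mul_nonneg hp.diag_nonneg hp.diag_nonneg))

/-- Limits of mutually inverse families of positive definite matrices are positive definite and
mutually inverse. -/
theorem posDef_of_tendsto {l : Filter ℝ} [l.NeBot] {X Y : ℝ → Mat3} {G G' : Mat3}
    (hX : ∀ᶠ t in l, (X t).PosDef) (hXY : ∀ᶠ t in l, X t * Y t = 1)
    (hG : ∀ i j, Tendsto (fun t => X t i j) l (𝓝 (G i j)))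
    (hG' : ∀ i j, Tendsto (fun t => Y t i j) l (𝓝 (G' i j))) : G.PosDef ∧ G⁻¹ = G' := by
  have tX : Tendsto X l (𝓝 G) := tendsto_pi_nhds.2 fun i => tendsto_pi_nhds.2 (hG i)
  have tY : Tendsto Y l (𝓝 G') := tendsto_pi_nhds.2 fun i => tendsto_pi_nhds.2 (hG' i)
  have hmul : G * G' = 1 :=
    tendsto_nhds_unique (((continuous_fst.matrix_mul continuous_snd).tendsto (G, G')).comp
      (tX.prodMk_nhds tY)) (tendsto_const_nhds.congr' (hXY.mono fun t ht => ht.symm))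
  have hherm : G.IsHermitian := by
    ext i j
    refine tendsto_nhds_unique (hG j i) ((hG i j).congr' (hX.mono fun t ht => ?_))
    exact (ht.isHermitian.apply i j).symm
  have hpsd : G.PosSemidef := by
    refine Matrix.PosSemidef.of_dotProduct_mulVec_nonneg hherm fun x => ?_
    have hc : Continuous fun A : Mat3 => star x ⬝ᵥ A *ᵥ x := by fun_prop
    exact ge_of_tendsto ((hc.tendsto G).comp tX)
      (hX.mono fun t ht => ht.posSemidef.dotProduct_mulVec_nonneg x)
  -- The limit of positive definite matrices is only semidefinite; the limit of the inverses shows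
  -- that it is invertible.
  have hunit : IsUnit G := IsUnit.of_mul_eq_one G' hmul
  exact ⟨hpsd.posDef_iff_isUnit.2 hunit, Matrix.inv_eq_right_inv hmul⟩

namespace IsExpanding

variable {C : Fin 3 → Fin 3 → Fin 3 → ℝ} {m Λ γ : ℝ} {v : ℝ → State}
  (h : IsExpanding C m Λ γ v)
include h

theorem normSq_σ_le {t : ℝ} (ht : 0 ≤ t) :
    (v t).normSq (v t).σ ≤ (√((v 0).Q m Λ) * Real.exp (-γ * t)) ^ 2 := by
  refine (h.Q_bounds ht).2.2.1.trans ((h.Q_le ht).trans_eq ?_)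
  rw [mul_pow, Real.sq_sqrt (h.Q_nonneg le_rfl), ← Real.exp_nat_mul]
  congr 2
  push_cast
  ring

/-- Writing $k=\sigma+\tfrac H3g$, rescaling by $e^{\mp2\delta t}$ replaces $H$ by $H+3\delta$. Only
this defect and $\sigma$, both $O(e^{-\gamma t})$, drive the rescaled metric and its inverse. -/
theorem exists_metric_limit {δ K : ℝ} (hγδ : γ ≤ δ)
    (hH : ∀ t, 0 ≤ t → |(v t).H + 3 * δ| ≤ K * Real.exp (-2 * δ * t)) :
    ∃ (B : ℝ) (G : Mat3), 0 < B ∧ G.PosDef ∧ ∀ t, 0 ≤ t → ∀ i j,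
      |Real.exp (-2 * δ * t) * (v t).g i j| ≤ B ∧ |Real.exp (2 * δ * t) * (v t).gi i j| ≤ B ∧
      |Real.exp (-2 * δ * t) * (v t).g i j - G i j| ≤ B * Real.exp (-γ * t) ∧
      |Real.exp (2 * δ * t) * (v t).gi i j - G⁻¹ i j| ≤ B * Real.exp (-γ * t) := by
  have hγ := h.γ_pos
  have hK : 0 ≤ K := by simpa using (abs_nonneg _).trans (hH 0 le_rfl)
  -- The rate $2\delta$ is weakened to $\gamma$, the rate available for $\sigma$.
  have hH' (t : ℝ) (ht : 0 ≤ t) : |(v t).H + 3 * δ| ≤ K * Real.exp (-γ * t) :=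
    (hH t ht).trans (mul_le_mul_of_nonneg_left (Real.exp_le_exp.2 (by nlinarith)) hK)
  set S := √((v 0).Q m Λ) with hS
  have bound {A D : Mat3} (hA : A.PosDef) {t c p : ℝ} (hc : |c| ≤ K * Real.exp (-γ * t))
      (hp : 0 < p) (hD : ∀ i j, |D i j| ≤ S * Real.exp (-γ * t) * A.trace) (i j : Fin 3) :
      |p * (2 / 3 * c * A i j + 2 * D i j)|
        ≤ (K + 2 * S) * Real.exp (-γ * t) * (p • A).trace := by
    have h1 := abs_apply_le_trace hA i j
    have h2 : |c * A i j| ≤ K * Real.exp (-γ * t) * A.trace := by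
      rw [abs_mul]
      exact mul_le_mul hc h1 (abs_nonneg _) ((abs_nonneg _).trans hc)
    have h3 := hD i j
    have h4 : |2 / 3 * c * A i j + 2 * D i j|
        ≤ (K + 2 * S) * Real.exp (-γ * t) * A.trace := by
      have h5 := (abs_nonneg _).trans h2
      rw [abs_le] at h2 h3 ⊢
      constructor <;> linarith
    rw [abs_mul, abs_of_pos hp, Matrix.trace_smul, smul_eq_mul]
    exact (mul_le_mul_of_nonneg_left h4 hp.le).trans_eq (by ring)
  obtain ⟨B₁, G, hB₁, b₁, l₁⟩ := exists_limit_of_relative_deriv_le hγ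
    (X := fun t => Real.exp (-2 * δ * t) • (v t).g)
    (X' := fun t i j => Real.exp (-2 * δ * t) *
      (2 / 3 * (-((v t).H + 3 * δ)) * (v t).g i j + 2 * (-(v t).σ) i j))
    (fun t ht i j => by
      have := (hasDerivWithinAt_exp_mul (-2 * δ) t).mul (h.sol.g_deriv ht i j)
      refine this.congr_deriv ?_
      simp only [Matrix.smul_apply, smul_eq_mul, (v t).k_eq_σ_add i j, Matrix.neg_apply]
      ring)
    (fun t ht => abs_apply_le_trace ((h.sol.g_posDef t ht).smul (Real.exp_pos _)))
    (fun t ht => bound (h.sol.g_posDef t ht) (by rw [abs_neg]; exact hH' t ht) (Real.exp_pos _)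
      fun i j => by
        rw [Matrix.neg_apply, abs_neg]
        exact State.abs_apply_le (h.sol.g_posDef t ht) _ (by positivity) (h.normSq_σ_le ht) i j)
  obtain ⟨B₂, G', hB₂, b₂, l₂⟩ := exists_limit_of_relative_deriv_le hγ
    (X := fun t => Real.exp (2 * δ * t) • (v t).gi)
    (X' := fun t i j => Real.exp (2 * δ * t) *
      (2 / 3 * ((v t).H + 3 * δ) * (v t).gi i j + 2 * ((v t).gi * (v t).σ * (v t).gi) i j))
    (fun t ht i j => by
      have := (hasDerivWithinAt_exp_mul (2 * δ) t).mul (h.sol.gi_deriv ht i j)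
      refine this.congr_deriv ?_
      simp only [Matrix.smul_apply, smul_eq_mul, State.raised_k_apply (h.sol.g_posDef t ht)]
      ring)
    (fun t ht => abs_apply_le_trace
      ((State.gi_posDef (h.sol.g_posDef t ht)).smul (Real.exp_pos _)))
    (fun t ht => bound (State.gi_posDef (h.sol.g_posDef t ht)) (hH' t ht) (Real.exp_pos _)
      (State.abs_raised_apply_le (h.sol.g_posDef t ht) _ (by positivity) (h.normSq_σ_le ht)))
  have lim {f : ℝ → ℝ} {a B : ℝ} (hf : ∀ t, 0 ≤ t → |f t - a| ≤ B * Real.exp (-γ * t)) :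
      Tendsto f atTop (𝓝 a) := by
    rw [tendsto_iff_norm_sub_tendsto_zero]
    have he : Tendsto (fun t => B * Real.exp (-γ * t)) atTop (𝓝 0) := by
      simpa using (Real.tendsto_exp_atBot.comp
        (tendsto_id.const_mul_atTop_of_neg (neg_neg_of_pos hγ))).const_mul B
    refine squeeze_zero' (Eventually.of_forall fun t => norm_nonneg _) ?_ he
    filter_upwards [eventually_ge_atTop 0] with t ht using hf t ht
  obtain ⟨hG, hGi⟩ := posDef_of_tendsto
    (X := fun t => Real.exp (-2 * δ * t) • (v t).g) (Y := fun t => Real.exp (2 * δ * t) • (v t).gi)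
    ((eventually_ge_atTop 0).mono fun t ht => (h.sol.g_posDef t ht).smul (Real.exp_pos _))
    ((eventually_ge_atTop 0).mono fun t ht => by
      rw [Matrix.smul_mul, Matrix.mul_smul, smul_smul, State.g_mul_gi (h.sol.g_posDef t ht),
        ← Real.exp_add]
      simp)
    (fun i j => lim fun t ht => l₁ t ht i j) (fun i j => lim fun t ht => l₂ t ht i j)
  refine ⟨max B₁ B₂, G, lt_max_of_lt_left hB₁, hG, fun t ht i j => ?_⟩
  have he := (Real.exp_pos (-γ * t)).le
  refine ⟨(b₁ t ht i j).trans (le_max_left _ _), (b₂ t ht i j).trans (le_max_right _ _),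
    (l₁ t ht i j).trans (mul_le_mul_of_nonneg_right (le_max_left _ _) he), ?_⟩
  rw [hGi]
  exact (l₂ t ht i j).trans (mul_le_mul_of_nonneg_right (le_max_right _ _) he)

end IsExpanding

/-! ### Bounds on the components of the fields -/

theorem exp_le_exp_mul {a b t : ℝ} (hab : a ≤ b) (ht : 0 ≤ t) :
    Real.exp (a * t) ≤ Real.exp (b * t) :=
  Real.exp_le_exp.2 (mul_le_mul_of_nonneg_right hab ht)

theorem trace_le_of_abs_le {A : Mat3} {p B : ℝ} (hp : 0 < p) (h : ∀ i j, |p⁻¹ * A i j| ≤ B) :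
    A.trace ≤ 3 * B * p := by
  have hle (i : Fin 3) : A i i ≤ B * p := by
    have := (le_abs_self _).trans (h i i)
    rwa [inv_mul_le_iff₀ hp, mul_comm] at this
  rw [Matrix.trace_fin_three]
  linarith [hle 0, hle 1, hle 2]

theorem exists_pos_bound {ι : Type*} {f : ℝ → ι → ℝ} {c : ℝ} {w : ℝ → ℝ} (hw : ∀ t, 0 < w t)
    (h : ∀ t, 0 ≤ t → ∀ i, |f t i| ≤ c * w t) :
    ∃ K > 0, ∀ t, 0 ≤ t → ∀ i, |f t i| ≤ K * w t :=
  ⟨max c 1, lt_max_of_lt_right one_pos, fun t ht i =>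
    (h t ht i).trans (mul_le_mul_of_nonneg_right (le_max_left _ _) (hw t).le)⟩

namespace IsExpanding

variable {C : Fin 3 → Fin 3 → Fin 3 → ℝ} {m Λ γ : ℝ} {v : ℝ → State}
  (h : IsExpanding C m Λ γ v)
include h

theorem τ00_le {t : ℝ} (ht : 0 ≤ t) : (v t).τ00 ≤ (v 0).Q m Λ * Real.exp (-2 * γ * t) :=
  (h.Q_bounds ht).1.trans (h.Q_le ht)

theorem normSq_F_le {t : ℝ} (ht : 0 ≤ t) :
    (v t).normSq (v t).F ≤ 4 * (v 0).Q m Λ * Real.exp (-2 * γ * t) := by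
  have h1 := h.τ00_le ht
  have h2 := State.ESq_nonneg (h.sol.g_posDef t ht)
  rw [State.τ00] at h1
  linarith

theorem ESq_le {t : ℝ} (ht : 0 ≤ t) :
    (v t).ESq ≤ 2 * (v 0).Q m Λ * Real.exp (-2 * γ * t) := by
  have h1 := h.τ00_le ht
  have h2 := State.normSq_nonneg (h.sol.g_posDef t ht) (v t).F
  rw [State.τ00] at h1
  linarith

theorem normSq_F_le_sq {t : ℝ} (ht : 0 ≤ t) :
    (v t).normSq (v t).F ≤ (2 * √((v 0).Q m Λ) * Real.exp (-γ * t)) ^ 2 := by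
  refine (h.normSq_F_le ht).trans_eq ?_
  rw [mul_pow, mul_pow, Real.sq_sqrt (h.Q_nonneg le_rfl), ← Real.exp_nat_mul]
  congr 1
  · norm_num
  · congr 1
    push_cast
    ring

variable {δ B : ℝ}

theorem exists_k_le (hδ : 0 < δ) {K : ℝ}
    (hH : ∀ t, 0 ≤ t → |(v t).H + 3 * δ| ≤ K * Real.exp (-2 * δ * t))
    (hg : ∀ t, 0 ≤ t → ∀ i j, |Real.exp (-2 * δ * t) * (v t).g i j| ≤ B) :
    ∃ c > 0, ∀ t, 0 ≤ t → ∀ i j, |(v t).k i j| ≤ c * Real.exp (2 * δ * t) := by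
  have hK : 0 ≤ K := by simpa using (abs_nonneg _).trans (hH 0 le_rfl)
  set S := √((v 0).Q m Λ) with hS
  have key : ∀ t, 0 ≤ t → ∀ p : Fin 3 × Fin 3,
      |(v t).k p.1 p.2| ≤ (S + (K / 3 + δ)) * (3 * B) * Real.exp (2 * δ * t) := by
    rintro t ht ⟨i, j⟩
    have hs := h.sol.g_posDef t ht
    have htr : (v t).g.trace ≤ 3 * B * Real.exp (2 * δ * t) :=
      trace_le_of_abs_le (Real.exp_pos _) fun i j => by
        rw [← Real.exp_neg, ← neg_mul, ← neg_mul]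
        exact hg t ht i j
    have h0 : 0 ≤ (v t).g.trace := (abs_nonneg _).trans (abs_apply_le_trace hs 0 0)
    have h1 := State.abs_apply_le hs _ (by positivity) (h.normSq_σ_le ht) i j
    have h2 : S * Real.exp (-γ * t) ≤ S := mul_le_of_le_one_right (Real.sqrt_nonneg _)
      (Real.exp_le_one_iff.2 (by nlinarith [h.γ_pos]))
    have h3 : |(v t).H / 3| ≤ K / 3 + δ := by
      have h4 := (hH t ht).trans (mul_le_of_le_one_right hK
        (Real.exp_le_one_iff.2 (by nlinarith)))
      rw [abs_le] at h4 ⊢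
      constructor <;> linarith
    calc |(v t).k i j| = |(v t).σ i j + (v t).H / 3 * (v t).g i j| := by
          rw [(v t).k_eq_σ_add]
      _ ≤ |(v t).σ i j| + |(v t).H / 3| * |(v t).g i j| := by
          rw [← abs_mul]; exact abs_add_le _ _
      _ ≤ S * (v t).g.trace + (K / 3 + δ) * (v t).g.trace :=
          add_le_add (h1.trans (mul_le_mul_of_nonneg_right h2 h0))
            (mul_le_mul h3 (abs_apply_le_trace hs i j) (abs_nonneg _) (by positivity))
      _ ≤ _ := by
          rw [← add_mul, mul_assoc _ (3 * B)]
          exact mul_le_mul_of_nonneg_left htr (by positivity)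
  obtain ⟨c, hc, hk⟩ := exists_pos_bound (fun t => Real.exp_pos (2 * δ * t)) key
  exact ⟨c, hc, fun t ht i j => hk t ht (i, j)⟩

/-- The norms give growth at most $e^{(2\delta-\gamma)t}$, which is relaxed to the required
exponent. -/
theorem exists_F_le (hg : ∀ t, 0 ≤ t → ∀ i j, |Real.exp (-2 * δ * t) * (v t).g i j| ≤ B) {ν : ℝ}
    (hν : 0 ≤ ν) :
    ∃ c > 0, ∀ t, 0 ≤ t → ∀ i j, |(v t).F i j| ≤ c * Real.exp ((2 * δ + ν) * t) := by
  have hB : 0 ≤ B := (abs_nonneg _).trans (hg 0 le_rfl 0 0)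
  set S := √((v 0).Q m Λ) with hS
  have key : ∀ t, 0 ≤ t → ∀ p : Fin 3 × Fin 3,
      |(v t).F p.1 p.2| ≤ 2 * S * (3 * B) * Real.exp ((2 * δ + ν) * t) := by
    rintro t ht ⟨i, j⟩
    have hs := h.sol.g_posDef t ht
    have htr : (v t).g.trace ≤ 3 * B * Real.exp (2 * δ * t) :=
      trace_le_of_abs_le (Real.exp_pos _) fun i j => by
        rw [← Real.exp_neg, ← neg_mul, ← neg_mul]
        exact hg t ht i j
    refine (State.abs_apply_le hs _ (by positivity) (h.normSq_F_le_sq ht) i j).trans ?_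
    refine (mul_le_mul_of_nonneg_left htr (by positivity)).trans ?_
    rw [show 2 * √((v 0).Q m Λ) * Real.exp (-γ * t) * (3 * B * Real.exp (2 * δ * t))
      = 2 * S * (3 * B) * Real.exp ((-γ + 2 * δ) * t) by rw [add_mul, Real.exp_add]; ring]
    exact mul_le_mul_of_nonneg_left (exp_le_exp_mul (by linarith [h.γ_pos]) ht) (by positivity)
  obtain ⟨c, hc, hk⟩ := exists_pos_bound (fun t => Real.exp_pos ((2 * δ + ν) * t)) key
  exact ⟨c, hc, fun t ht i j => hk t ht (i, j)⟩

/-- The estimate obtained is $e^{-(2\delta+\gamma)t}$; the required exponent is larger. -/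
theorem exists_raise_F_le (hδ : 0 < δ)
    (hg : ∀ t, 0 ≤ t → ∀ i j, |Real.exp (2 * δ * t) * (v t).gi i j| ≤ B) :
    ∃ c > 0, ∀ t, 0 ≤ t → ∀ i j,
      |(v t).raise (v t).F i j| ≤ c * Real.exp ((δ - γ) * t) := by
  have hB : 0 ≤ B := (abs_nonneg _).trans (hg 0 le_rfl 0 0)
  set S := √((v 0).Q m Λ) with hS
  have key : ∀ t, 0 ≤ t → ∀ p : Fin 3 × Fin 3,
      |(v t).raise (v t).F p.1 p.2| ≤ 2 * S * (3 * B) * Real.exp ((δ - γ) * t) := by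
    rintro t ht ⟨i, j⟩
    have hs := h.sol.g_posDef t ht
    have htr : (v t).gi.trace ≤ 3 * B * Real.exp (-(2 * δ * t)) :=
      trace_le_of_abs_le (Real.exp_pos _) fun i j => by
        rw [← Real.exp_neg, neg_neg]
        exact hg t ht i j
    have hgt : (v t).giᵀ = (v t).gi := by ext x y; exact State.gi_symm hs y x
    rw [State.raise_eq, hgt]
    refine (State.abs_raised_apply_le hs _ (by positivity) (h.normSq_F_le_sq ht) i j).trans ?_
    refine (mul_le_mul_of_nonneg_left htr (by positivity)).trans ?_
    rw [show 2 * √((v 0).Q m Λ) * Real.exp (-γ * t) * (3 * B * Real.exp (-(2 * δ * t)))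
      = 2 * S * (3 * B) * Real.exp ((-γ + -(2 * δ)) * t) by
        rw [add_mul, Real.exp_add, neg_mul (2 * δ)]; ring]
    exact mul_le_mul_of_nonneg_left (exp_le_exp_mul (by linarith) ht) (by positivity)
  obtain ⟨c, hc, hk⟩ := exists_pos_bound (fun t => Real.exp_pos ((δ - γ) * t)) key
  exact ⟨c, hc, fun t ht i j => hk t ht (i, j)⟩

theorem exists_E_le (hδ : 0 < δ)
    (hg : ∀ t, 0 ≤ t → ∀ i j, |Real.exp (2 * δ * t) * (v t).gi i j| ≤ B) {ν : ℝ} (hν : 0 ≤ ν) :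
    ∃ c > 0, ∀ t, 0 ≤ t → ∀ i, |(v t).E i| ≤ c * Real.exp (ν * t) := by
  have hB : 0 ≤ B := (abs_nonneg _).trans (hg 0 le_rfl 0 0)
  have hQ := h.Q_nonneg le_rfl
  set c := B * (2 * (v 0).Q m Λ) with hc
  have hc0 : 0 ≤ c := by positivity
  refine ⟨c + 1, by positivity, fun t ht i => ?_⟩
  have hs := h.sol.g_posDef t ht
  have h1 : (v t).gi i i ≤ B := by
    refine le_trans ?_ ((le_abs_self _).trans (hg t ht i i))
    exact le_mul_of_one_le_left (State.gi_diag_nonneg hs i) (Real.one_le_exp (by positivity))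
  have h2 : (v t).ESq ≤ 2 * (v 0).Q m Λ :=
    (h.ESq_le ht).trans (mul_le_of_le_one_right (by positivity)
      (Real.exp_le_one_iff.2 (by nlinarith [h.γ_pos])))
  have h3 : (v t).E i ^ 2 ≤ c :=
    (State.sq_E_le hs i).trans (mul_le_mul h1 h2 (State.ESq_nonneg hs) hB)
  -- From $x^2\le c$ follows $|x|\le c+1$, since $c\le(c+1)^2$; the shift also keeps the constant
  -- positive.
  have h4 : |(v t).E i| ≤ c + 1 := abs_le_of_sq_le_sq (by nlinarith) (by positivity)
  exact h4.trans (le_mul_of_one_le_right (by positivity) (Real.one_le_exp (by positivity)))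

/-- The evolution equations give $e$ and $\rho$ the same logarithmic rate, so the specific charge is
conserved. Bounds on $e$ reduce to those on $\rho$. -/
theorem e_div_ρ_eq {t : ℝ} (ht : 0 ≤ t) : (v t).e / (v t).ρ = (v 0).e / (v 0).ρ := by
  refine eq_initial_of_deriv_zero (y := fun r => (v r).e / (v r).ρ) (fun r hr => ?_) ht
  have hρ := h.sol.ρ_ne_zero r hr
  refine ((h.sol.e_eq r hr).div (h.sol.ρ_eq r hr) hρ).congr_deriv ?_
  rw [State.eRate, State.ρRate]
  field_simp
  ring

theorem exists_e_le {ν : ℝ} (hν : 0 ≤ ν) :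
    ∃ c > 0, ∀ t, 0 ≤ t → |(v t).e| ≤ c * Real.exp (ν * t) := by
  have hQ := h.Q_nonneg le_rfl
  set q := |(v 0).e / (v 0).ρ| with hq
  refine ⟨q * (v 0).Q m Λ + 1, by positivity, fun t ht => ?_⟩
  have hρ := h.ρ_pos' ht
  have h1 : |(v t).e| = q * (v t).ρ := by
    rw [hq, ← h.e_div_ρ_eq ht, abs_div, abs_of_pos hρ, div_mul_cancel₀ _ hρ.ne']
  have h2 : (v t).ρ ≤ (v 0).Q m Λ :=
    (h.Q_bounds ht).2.1.trans (h.Q_le_initial ht)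
  have h3 : |(v t).e| ≤ q * (v 0).Q m Λ + 1 := by
    rw [h1]
    linarith [mul_le_mul_of_nonneg_left h2 (abs_nonneg ((v 0).e / (v 0).ρ))]
  exact h3.trans (le_mul_of_one_le_right (by positivity) (Real.one_le_exp (by positivity)))

end IsExpanding

end EMSF

end

-- Assembly of the asymptotic statements.

theorem theorem4 {𝔤 : Type*} [LieRing 𝔤] [LieAlgebra ℝ 𝔤] (b : Module.Basis (Fin 3) ℝ 𝔤)
    (h_type : ¬ EMSF.IsBianchiIX 𝔤)
    (m Λ : ℝ) (hm : 0 < m)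
    (v : ℝ → EMSF.State)
    (h_data : (v 0).IsInitialData (EMSF.structureConstants b) m Λ)
    (hΛ : -(4 * Real.pi * m ^ 2 * (v 0).Φ ^ 2) < Λ)
    (hH : (v 0).H < 0)
    (h_sol : EMSF.IsGlobalSolution (EMSF.structureConstants b) m Λ v)
    (γ : ℝ) (hγ : γ = √((Λ + 4 * Real.pi * m ^ 2 * (v 0).Φ ^ 2) / 3)) :
    ∃ (L C₀ δ ν : ℝ) (G : EMSF.Mat3),
      0 < L ∧
      C₀ = Λ + 4 * Real.pi * m ^ 2 * L ∧
      δ = √((Λ + 4 * Real.pi * m ^ 2 * L) / 3) ∧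
      ν = 3 * δ - γ ∧
      G.PosDef ∧
      ((fun t => (v t).Q m Λ) =O[atTop] fun t => Real.exp (-2 * γ * t)) ∧
      ((fun t => (v t).normSq (v t).σ) =O[atTop] fun t => Real.exp (-2 * γ * t)) ∧
      ((fun t => |(v t).R (EMSF.structureConstants b)|)
        =O[atTop] fun t => Real.exp (-2 * γ * t)) ∧
      ((fun t => (v t).τ00) =O[atTop] fun t => Real.exp (-2 * γ * t)) ∧
      ((fun t => (v t).ρ) =O[atTop] fun t => Real.exp (-2 * γ * t)) ∧
      ((fun t => deriv (fun r => (v r).Φ) t ^ 2) =O[atTop] fun t => Real.exp (-2 * γ * t)) ∧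
      ((fun t => (v t).normSq (v t).F) =O[atTop] fun t => Real.exp (-2 * γ * t)) ∧
      ((fun t => (v t).ESq) =O[atTop] fun t => Real.exp (-2 * γ * t)) ∧
      (∃ C > 0, ∀ t, 0 ≤ t →
        EMSF.opNorm (v t).σ ≤ C * Real.exp (-γ * t) * EMSF.opNorm (v t).g) ∧
      Tendsto (fun t => (v t).Φ ^ 2) atTop (𝓝 L) ∧
      Tendsto (fun t => (v t).T00 m) atTop (𝓝 (m ^ 2 / 2 * L)) ∧
      ((fun t => (v t).H - (-√(3 * C₀))) =O[atTop] fun t => Real.exp (-2 * δ * t)) ∧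
      (∃ C > 0, ∀ t, 0 ≤ t → ∀ i j, |Real.exp (-2 * δ * t) * (v t).g i j| ≤ C) ∧
      (∃ C > 0, ∀ t, 0 ≤ t → ∀ i j, |Real.exp (2 * δ * t) * (v t).gi i j| ≤ C) ∧
      (∀ i j, ∃ r : ℝ → ℝ, (r =O[atTop] fun t => Real.exp (-γ * t)) ∧
        ∀ t, 0 ≤ t → (v t).g i j = Real.exp (2 * δ * t) * (G i j + r t)) ∧
      (∀ i j, ∃ r : ℝ → ℝ, (r =O[atTop] fun t => Real.exp (-γ * t)) ∧
        ∀ t, 0 ≤ t → (v t).gi i j = Real.exp (-2 * δ * t) * (G⁻¹ i j + r t)) ∧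
      (∃ C > 0, ∀ t, 0 ≤ t → ∀ i j, |(v t).k i j| ≤ C * Real.exp (2 * δ * t)) ∧
      (∃ C > 0, ∀ t, 0 ≤ t → ∀ i, |(v t).E i| ≤ C * Real.exp (ν * t)) ∧
      (∃ C > 0, ∀ t, 0 ≤ t → ∀ i j, |(v t).F i j| ≤ C * Real.exp ((2 * δ + ν) * t)) ∧
      (∃ C > 0, ∀ t, 0 ≤ t → ∀ i j,
        |(v t).raise (v t).F i j| ≤ C * Real.exp ((δ - γ) * t)) ∧
      (∃ C > 0, ∀ t, 0 ≤ t → |(v t).e| ≤ C * Real.exp (ν * t)) := by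
  have hC := EMSF.isLieConstants_structureConstants b
  have h : EMSF.IsExpanding (EMSF.structureConstants b) m Λ γ v :=
    { sol := h_sol
      constraints := fun t ht => h_sol.constraints hC
        (fun r hr => h_sol.F_antisymm hC.skew h_data.F_antisymm hr) h_data.constraints ht
      R_nonpos := fun t ht => EMSF.R_nonpos b h_type (h_sol.g_posDef t ht)
      m_pos := hm
      γ_pos := by rw [hγ]; exact Real.sqrt_pos.2 (by linarith)
      γ_sq := by rw [hγ, Real.sq_sqrt (by linarith)]; ring
      Φ_pos := h_data.Φ_pos
      ρ_pos := h_data.ρ_pos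
      H_neg := hH }
  obtain ⟨T, hT, hU⟩ := h.exists_U_eq_zero
  -- The limit of $\Phi^2$ is already attained at the stopping time of the scalar field.
  set L := (v T).Φ ^ 2 with hL
  have hL0 : (v 0).Φ ^ 2 ≤ L := h.Φ_sq_mono le_rfl hT
  have hC₀ : Λ + 4 * Real.pi * m ^ 2 * (v 0).Φ ^ 2 ≤ Λ + 4 * Real.pi * m ^ 2 * L := by gcongr
  have hC₀pos : 0 < Λ + 4 * Real.pi * m ^ 2 * L := by linarith
  set δ := √((Λ + 4 * Real.pi * m ^ 2 * L) / 3) with hδdef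
  have hδ : 0 < δ := Real.sqrt_pos.2 (by linarith)
  have hδ2 : 3 * δ ^ 2 = Λ + 4 * Real.pi * m ^ 2 * L := by
    rw [hδdef, Real.sq_sqrt (by linarith)]; ring
  have hγδ : γ ≤ δ := by
    rw [hγ, hδdef]
    exact Real.sqrt_le_sqrt (by linarith)
  -- From $\gamma\le\delta$; hence bounded components satisfy the estimates with $e^{\nu t}$.
  have hν : 0 ≤ 3 * δ - γ := by linarith
  obtain ⟨K, hK, hHle⟩ := h.H_add_le hT hU hδ hδ2
  obtain ⟨B, G, hB, hG, hlim⟩ := h.exists_metric_limit hγδ hHle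
  have bigO {f w : ℝ → ℝ} {c : ℝ} (hf : ∀ t, 0 ≤ t → |f t| ≤ c * Real.exp (w t)) :
      f =O[atTop] fun t => Real.exp (w t) := by
    refine IsBigO.of_bound c ((eventually_ge_atTop 0).mono fun t ht => ?_)
    rw [Real.norm_eq_abs, Real.norm_eq_abs, Real.abs_exp]
    exact hf t ht
  have hQ0 := h.Q_nonneg le_rfl
  have hpd := h_sol.g_posDef
  have hΦ : ∀ t, T ≤ t → (v t).Φ ^ 2 = L := fun t ht => by
    rw [h.Φ_eq_of_U_eq_zero hT hU ht]
  refine ⟨L, _, δ, _, G, (pow_pos h_data.Φ_pos 2).trans_le hL0, rfl, hδdef, rfl, hG,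
    bigO (c := (v 0).Q m Λ) fun t ht => ?_, bigO (c := (v 0).Q m Λ) fun t ht => ?_,
    bigO (c := (v 0).Q m Λ) fun t ht => ?_, bigO (c := (v 0).Q m Λ) fun t ht => ?_,
    bigO (c := (v 0).Q m Λ) fun t ht => ?_, ?_, bigO (c := 4 * (v 0).Q m Λ) fun t ht => ?_,
    bigO (c := 2 * (v 0).Q m Λ) fun t ht => ?_,
    ⟨√((v 0).Q m Λ) + 1, by positivity, fun t ht => ?_⟩,
    tendsto_const_nhds.congr' ((eventually_ge_atTop T).mono fun t ht => (hΦ t ht).symm),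
    tendsto_const_nhds.congr' ((eventually_ge_atTop T).mono fun t ht => ?_),
    bigO (c := K) fun t ht => ?_, ⟨B, hB, fun t ht i j => (hlim t ht i j).1⟩,
    ⟨B, hB, fun t ht i j => (hlim t ht i j).2.1⟩,
    fun i j => ⟨fun t => Real.exp (-2 * δ * t) * (v t).g i j - G i j,
      bigO fun t ht => (hlim t ht i j).2.2.1, fun t _ => ?_⟩,
    fun i j => ⟨fun t => Real.exp (2 * δ * t) * (v t).gi i j - G⁻¹ i j,
      bigO fun t ht => (hlim t ht i j).2.2.2, fun t _ => ?_⟩,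
    h.exists_k_le hδ hHle fun t ht i j => (hlim t ht i j).1,
    h.exists_E_le hδ (fun t ht i j => (hlim t ht i j).2.1) hν,
    h.exists_F_le (fun t ht i j => (hlim t ht i j).1) hν,
    h.exists_raise_F_le hδ fun t ht i j => (hlim t ht i j).2.1, h.exists_e_le hν⟩
  · rw [abs_of_nonneg (h.Q_nonneg ht)]
    exact h.Q_le ht
  · rw [abs_of_nonneg (EMSF.State.normSq_nonneg (hpd t ht) _)]
    exact (h.Q_bounds ht).2.2.1.trans (h.Q_le ht)
  · rw [abs_abs, abs_of_nonpos (h.R_nonpos t ht)]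
    exact (h.Q_bounds ht).2.2.2.trans (h.Q_le ht)
  · rw [abs_of_nonneg (EMSF.State.τ00_nonneg (hpd t ht))]
    exact h.τ00_le ht
  · rw [abs_of_pos (h.ρ_pos' ht)]
    exact (h.Q_bounds ht).2.1.trans (h.Q_le ht)
  -- The derivative vanishes identically after $T$, so the constant is 0. Strict inequality $t>T$
  -- makes $t$ interior, where the one-sided derivative is the genuine one.
  · refine IsBigO.of_bound 0 ((eventually_gt_atTop T).mono fun t ht => ?_)
    have hd := (h_sol.Φ_eq t (hT.trans ht.le)).hasDerivAt (Ici_mem_nhds (hT.trans_lt ht))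
    rw [hd.deriv, hU t ht.le]
    simp
  · rw [abs_of_nonneg (EMSF.State.normSq_nonneg (hpd t ht) _)]
    exact h.normSq_F_le ht
  · rw [abs_of_nonneg (EMSF.State.ESq_nonneg (hpd t ht))]
    exact h.ESq_le ht
  · refine (EMSF.opNorm_le (hpd t ht) _ (by positivity) (h.normSq_σ_le ht)).trans ?_
    have h1 : 0 ≤ EMSF.opNorm (v t).g := norm_nonneg _
    gcongr
    linarith
  · change m ^ 2 / 2 * L = (v t).U + 1 / 2 * m ^ 2 * (v t).Φ ^ 2
    rw [hU t ht, hΦ t ht]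
    ring
  · have h1 : √(3 * (Λ + 4 * Real.pi * m ^ 2 * L)) = 3 * δ := by
      rw [← hδ2, show 3 * (3 * δ ^ 2) = (3 * δ) ^ 2 by ring, Real.sqrt_sq (by positivity)]
    rw [h1, sub_neg_eq_add]
    exact hHle t ht
  · rw [add_sub_cancel, ← mul_assoc, ← Real.exp_add, neg_mul, neg_mul, add_neg_cancel,
      Real.exp_zero, one_mul]
  · rw [add_sub_cancel, ← mul_assoc, ← Real.exp_add, neg_mul, neg_mul, neg_add_cancel,
      Real.exp_zero, one_mul]
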